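/- Let $n\ge 1$, $0<s<1$, $T>0$. For $a>0$ let $(-\Delta)^a$ be the Fourier multiplier with symbol $|\xi|^{2a}$; for functions that are not in $L^2$ it is understood by duality, i.e. $(-\Delta)^a u=g$ means $\int u\,\mathcal F^{-1}(|\xi|^{2a}\hat\eta)\,dx=\int g\,\eta\,dx$ for all Schwartz functions $\eta$. For $p\in C[0,T]$, a source $F$ and an initial value $u_0$, a (bounded) strong solution of $$\partial_t u+(-\Delta)^s u=p(t)u+F\ \text{ in }\mathbb R^n\times(0,T),\qquad u(\cdot,0)=u_0, \tag{1}$$ is a bounded function $u\in C(\mathbb R^n\times[0,T])$ whose classical derivative $u_t$ exists and is continuous on $\mathbb R^n\times(0,T)$, with $u(\cdot,0)=u_0$, and such that for every $(x,t)\in\mathbb R^n\times(0,T)$ the principal value below exists and $$u_t(x,t)+c(n,s)\,\mathrm{P.V.}\!\int_{\mathbb R^n}\frac{u(x,t)-u(y,t)}{|x-y|^{n+2s}}\,dy=p(t)u(x,t)+F(x,t),\qquad c(n,s)=\frac{4^s s\,\Gamma(\frac n2+s)}{\pi^{n/2}\Gamma(1-s)} .$$ Let $\varphi,(-\Delta)^s\varphi\in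 C(\mathbb R^n)\cap L^\infty(\mathbb R^n)$. Let $f$ and $(-\Delta)^s f$ be continuous on $\mathbb R^n\times[0,T]$ (here $(-\Delta)^s$ acts in $x$), let $f$ have compact support in $\mathbb R^n\times[0,T]$, let the weak derivatives $f_t$, $\partial_t((-\Delta)^s f)$ and the functions $(-\Delta)^s f$, $(-\Delta)^{2s}f$ belong to $L^\infty(\mathbb R^n\times(0,T))$, and let $(-\Delta)^s f(\cdot,t)\in\hat H^s(\mathbb R^n)=\{g\in L^2(\mathbb R^n):\int(1+|\xi|^{2s})|\hat g(\xi)|^2d\xi<\infty\}$ for all $t\in[0,T]$. Let $q\in\mathbb R^n$ be such that $f(q,\cdot)\in C^1[0,T]$ and $f(q,t)\ne0$ for all $t\in[0,T]$. Then for every $p\in C[0,T]$ the problem (1) has exactly one bounded strong solution $v_1$ for the data $(u_0,F)=(\varphi,f)$ and exactly one bounded strong solution $v_2$ for the data $(u_0,F)=((-\Delta)^s\varphi,(-\Delta)^s f)$; call $w_1(t)=v_1(q,t)$, $w_2(t)=v_2(q,t)$, $t\in[0,T]$, the observations produced by $p$. Moreover, let $w_1,w_2$ be observations produced by some coefficient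 in $C[0,T]$. Then there is exactly one pair $(u,p)$ such that $p\in C[0,T]$, $u$ is a bounded strong solution of (1) for the data $(\varphi,f)$, and $p$ produces the observations $w_1,w_2$. The function $w_1$ is differentiable on $[0,T]$ (one-sidedly at the end points), and $$p(t)\,w_1(t)=w_1'(t)+w_2(t)-f(q,t),\qquad t\in[0,T].$$ -/

import Mathlib

open MeasureTheory Set Filter Topology
open scoped FourierTransform SchwartzMap ContDiff

noncomputable section

namespace FracHeat

/-- The Euclidean space `ℝⁿ`. -/
abbrev E (n : ℕ) : Type := EuclideanSpace ℝ (Fin n)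

/-- The space-time slab `ℝⁿ × (0,T)`. -/
def slab (n : ℕ) (T : ℝ) : Set (E n × ℝ) := univ ×ˢ Ioo 0 T

/-- `F ∈ L^∞(ℝⁿ × (0,T))`. -/
def MemLInfty {n : ℕ} (T : ℝ) (F : E n → ℝ → ℝ) : Prop :=
  MemLp (fun z : E n × ℝ => F z.1 z.2) ⊤ (volume.restrict (slab n T))

/-- `G` is the weak time derivative of `F` on `ℝⁿ × (0,T)`, tested with `C_c^∞(ℝⁿ × (0,T))`. -/
def IsWeakTimeDeriv {n : ℕ} (T : ℝ) (F G : E n → ℝ → ℝ) : Prop :=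
  ∀ η : E n × ℝ → ℝ, ContDiff ℝ ∞ η → HasCompactSupport η → tsupport η ⊆ slab n T →
    ∫ z in slab n T, F z.1 z.2 * deriv (fun τ : ℝ => η (z.1, τ)) z.2 =
      - ∫ z in slab n T, G z.1 z.2 * η z

/-- `(-Δ)^a η = 𝓕⁻¹(|ξ|^{2a} 𝓕η)` for a Schwartz function `η`. Mathlib's Fourier transform has the
kernel `exp(-2πi x·ξ)`, so that the symbol `|ξ|^{2a}` becomes `(2π|ξ|)^{2a}`. -/
def fracLapSchwartz {n : ℕ} (a : ℝ) (η : 𝓢(E n, ℂ)) : E n → ℂ :=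
  𝓕⁻ (fun ξ : E n => (((2 * Real.pi * ‖ξ‖) ^ (2 * a) : ℝ) : ℂ) * 𝓕 (η : E n → ℂ) ξ)

/-- `(-Δ)^a u = g` in the sense of the Fourier multiplier `|ξ|^{2a}`, for functions that need not
be square integrable: the multiplier acts on `u` by duality with Schwartz functions. -/
def IsFracLaplacian {n : ℕ} (a : ℝ) (u g : E n → ℝ) : Prop :=
  ∀ η : 𝓢(E n, ℂ),
    Integrable (fun x => (u x : ℂ) * fracLapSchwartz a η x) ∧
    Integrable (fun x => (g x : ℂ) * η x) ∧
    ∫ x, (u x : ℂ) * fracLapSchwartz a η x = ∫ x, (g x : ℂ) * η x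

/-- The fractional Sobolev space of all `g ∈ L²` with `∫ (1 + |ξ|^{2s}) |ĝ(ξ)|² dξ < ∞`. -/
def MemFracSobolev {n : ℕ} (s : ℝ) (g : E n → ℝ) : Prop :=
  ∃ hg : MemLp (fun x => (g x : ℂ)) 2 (volume : Measure (E n)),
    Integrable (fun ξ : E n =>
      (1 + (2 * Real.pi * ‖ξ‖) ^ (2 * s)) * ‖(𝓕 (hg.toLp (fun x => (g x : ℂ))) : Lp ℂ 2 (volume : Measure (E n))) ξ‖ ^ 2)

/-- The constant `c(n,s) = 4^s s Γ(n/2 + s) / (π^{n/2} Γ(1 - s))`, for which the singular integral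
below has the symbol `|ξ|^{2s}`. -/
def fracConst (n : ℕ) (s : ℝ) : ℝ :=
  (4 : ℝ) ^ s * s * Real.Gamma ((n : ℝ) / 2 + s) /
    (Real.pi ^ ((n : ℝ) / 2) * Real.Gamma (1 - s))

/-- The principal value `c(n,s) P.V. ∫ (u(x) - u(y)) / |x - y|^{n+2s} dy` exists and equals `ℓ`. -/
def HasFracLaplacianAt {n : ℕ} (s : ℝ) (u : E n → ℝ) (x : E n) (ℓ : ℝ) : Prop :=
  (∀ ε > 0, IntegrableOn (fun y => (u x - u y) / ‖x - y‖ ^ ((n : ℝ) + 2 * s))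
      {y | ε < ‖x - y‖}) ∧
  Tendsto (fun ε : ℝ => fracConst n s *
      ∫ y in {y | ε < ‖x - y‖}, (u x - u y) / ‖x - y‖ ^ ((n : ℝ) + 2 * s))
    (𝓝[>] 0) (𝓝 ℓ)

/-- `u` is a bounded strong solution of the Cauchy problem
`∂ₜu + (-Δ)^s u = p(t) u + F` on `ℝⁿ × (0,T)`, `u(·,0) = u₀`. -/
structure IsStrongSolution {n : ℕ} (s T : ℝ) (p : ℝ → ℝ) (F : E n → ℝ → ℝ) (u₀ : E n → ℝ)
    (u : E n → ℝ → ℝ) : Prop where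
  continuousOn : ContinuousOn (fun z : E n × ℝ => u z.1 z.2) (univ ×ˢ Icc 0 T)
  bounded : ∃ C : ℝ, ∀ x, ∀ t ∈ Icc 0 T, |u x t| ≤ C
  differentiableAt : ∀ x, ∀ t ∈ Ioo 0 T, DifferentiableAt ℝ (u x) t
  continuousOn_deriv : ContinuousOn (fun z : E n × ℝ => deriv (u z.1) z.2) (slab n T)
  equation : ∀ x, ∀ t ∈ Ioo 0 T, ∃ ℓ : ℝ,
    HasFracLaplacianAt s (fun y => u y t) x ℓ ∧ deriv (u x) t + ℓ = p t * u x t + F x t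
  initial : ∀ x, u x 0 = u₀ x

/-- The Cauchy problem has exactly one bounded strong solution on `ℝⁿ × [0,T]`. -/
def HasUniqueStrongSolution {n : ℕ} (s T : ℝ) (p : ℝ → ℝ) (F : E n → ℝ → ℝ) (u₀ : E n → ℝ) :
    Prop :=
  ∃ v, IsStrongSolution s T p F u₀ v ∧
    ∀ v', IsStrongSolution s T p F u₀ v' → ∀ x, ∀ t ∈ Icc 0 T, v' x t = v x t

/-- `w₁ = v₁(q,·)` and `w₂ = v₂(q,·)` on `[0,T]`, where `v₁` solves the Cauchy problem with
coefficient `p` and data `φ, f`, and `v₂` the one with the same `p` and the data `φs, fs`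
(to be read as `(-Δ)^s φ, (-Δ)^s f`). -/
def IsObservation {n : ℕ} (s T : ℝ) (φ φs : E n → ℝ) (f fs : E n → ℝ → ℝ) (q : E n)
    (p w₁ w₂ : ℝ → ℝ) : Prop :=
  ∃ v₁ v₂ : E n → ℝ → ℝ, IsStrongSolution s T p f φ v₁ ∧ IsStrongSolution s T p fs φs v₂ ∧
    ∀ t ∈ Icc 0 T, w₁ t = v₁ q t ∧ w₂ t = v₂ q t

/-- `(u,p)` solves the inverse problem with the observations `w₁, w₂`. -/
def IsInverseSolution {n : ℕ} (s T : ℝ) (φ φs : E n → ℝ) (f fs : E n → ℝ → ℝ) (q : E n)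
    (w₁ w₂ : ℝ → ℝ) (u : E n → ℝ → ℝ) (p : ℝ → ℝ) : Prop :=
  ContinuousOn p (Icc 0 T) ∧ IsStrongSolution s T p f φ u ∧
    IsObservation s T φ φs f fs q p w₁ w₂

end FracHeat

end

/-! Write S(t) for exp(-t(-Δ)^s). The operator (-Δ)^s commutes with S(t) and with multiplication by
functions of time, so the solution for the data ((-Δ)^s φ, (-Δ)^s f) is v₂ = (-Δ)^s v₁. The equation
for v₁ at the point q then reads w₁' + w₂ = p w₁ + f(q,·). This is the asserted formula, and it
determines p wherever w₁ ≠ 0.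

The zeros of w₁ are the difficulty in `coefficient_unique`. Let p, p' give the same observations,
and put P = exp(∫₀ᵗ p), P' likewise, D = 1/P - 1/P'. Suppose D = 0 on [0,t]. If w₁(t) ≠ 0 or w₁'(t)
≠ 0, then w₁ ≠ 0 just after t, so p = p' there and D stays zero. Otherwise the formula gives w₂(t) =
f(q,t) ≠ 0. The function Z = v₂/P - v₂'/P' has no zeroth order term, source D (-Δ)^s f, and vanishes
at time t. The maximum principle bounds |Z(q,r)| by M (r-t) max |D|, whereas Z(q,r) = w₂(r) D(r)
with |w₂| bounded below. On a short interval this forces D = 0. Hence the zero set of D extends to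
all of [0,T], P = P', and p = p'.

Uniqueness for the direct problem follows from the maximum principle for bounded functions
(`le_mul_of_subsolution`), after the integrating factor P has removed p. Existence is Duhamel's
formula. The integrand (-Δ)^s S(t-r)F(r) must be integrable in r, for which bounded F is not enough.
But a bounded function with bounded fractional Laplacian has second differences O(|h|^s)
(`exists_secondDiff_le_of_heatA`), and interpolation with the smoothing of S(τ) gives second
differences O(τ^{-α}|h|^γ) with α < 1 and γ > 2s (`exists_secondDiff_heat_le_sing`). The bounds on
(-Δ)^s f and (-Δ)^{2s} f make both sources admissible (`exists_goodSource`).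

All kernel estimates reduce, by scaling, to two facts at time one: the heat kernel is in L¹, and its
second differences are O(min(1,|h|²)) in L¹. Its symbol exp(-|ξ|^{2s}) is not smooth at the origin.
In x^s = C∫₀^∞ (1-e^{-xσ})σ^{-1-s}dσ with x = |ξ|², the part σ ≤ 1 is smooth in x and yields a
Schwartz factor. The part σ > 1 is a constant minus the Fourier transform of a finite mixture of
Gaussians, whose exponential acts boundedly on functions with integrable inverse transform. No
pointwise bound on the kernel is needed. -/

noncomputable section

namespace FracHeat

/-! ### Second differences and the singular integral -/

section

variable {n : ℕ} {V : Type*} [NormedAddCommGroup V] [NormedSpace ℝ V]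

/-- The centred second difference `u(x+h) + u(x-h) - 2u(x)`. -/
def secondDiff (u : E n → V) (x h : E n) : V := u (x + h) + u (x - h) - (2 : ℝ) • u x

/-- The kernel `|h|^{-(n+2s)}`. -/
def kerW (s : ℝ) (h : E n) : ℝ := (‖h‖ ^ ((n : ℝ) + 2 * s))⁻¹

/-- The fractional Laplacian in second difference form. -/
def fracOp (s : ℝ) (u : E n → V) (x : E n) : V :=
  (-(fracConst n s / 2)) • ∫ h, kerW s h • secondDiff u x h

lemma kerW_nonneg (s : ℝ) (h : E n) : 0 ≤ kerW s h := by unfold kerW; positivity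

lemma kerW_neg (s : ℝ) (h : E n) : kerW s (-h) = kerW s h := by simp [kerW]

lemma measurable_kerW (s : ℝ) : Measurable (kerW s : E n → ℝ) := by
  unfold kerW; fun_prop

lemma continuous_secondDiff {u : E n → V} (hu : Continuous u) :
    Continuous fun z : E n × E n => secondDiff u z.1 z.2 := by
  unfold secondDiff; fun_prop

lemma norm_secondDiff_le {u : E n → V} {M : ℝ} (hM : ∀ x, ‖u x‖ ≤ M) (x h : E n) :
    ‖secondDiff u x h‖ ≤ 4 * M := by
  unfold secondDiff
  calc _ ≤ ‖u (x + h)‖ + ‖u (x - h)‖ + ‖(2 : ℝ) • u x‖ :=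
        (norm_sub_le _ _).trans (by gcongr; exact norm_add_le _ _)
    _ ≤ M + M + 2 * M := by
        gcongr
        · exact hM _
        · exact hM _
        · rw [norm_smul]; simpa using hM x
    _ = 4 * M := by ring

/-- The weight `min(1,|h|^γ) |h|^{-(n+2s)}`. -/
def weight (s γ : ℝ) (h : E n) : ℝ := min 1 (‖h‖ ^ γ) * kerW s h

lemma weight_nonneg (s γ : ℝ) (h : E n) : 0 ≤ weight s γ h :=
  mul_nonneg (le_min zero_le_one (by positivity)) (kerW_nonneg s h)

/-- In polar coordinates the radial density is r^{γ-2s-1} on (0,1] and r^{-1-2s} on (1,∞). The first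
is integrable because γ > 2s, the second because s > 0. -/
lemma integrable_weight (hn : 0 < n) {s γ : ℝ} (hs : 0 < s) (hγ : 2 * s < γ) :
    Integrable (weight s γ : E n → ℝ) := by
  have : Nonempty (Fin n) := ⟨⟨0, hn⟩⟩
  have key := integrable_fun_norm_addHaar (volume : Measure (E n))
    (f := fun r : ℝ => min 1 (r ^ γ) * (r ^ ((n : ℝ) + 2 * s))⁻¹)
  unfold weight kerW
  rw [key, finrank_euclideanSpace_fin]
  rw [← Ioc_union_Ioi_eq_Ioi (zero_le_one' ℝ)]
  have hpow : ∀ y : ℝ, 0 < y → y ^ (n - 1) = y ^ ((n : ℝ) - 1) := fun y hy => by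
    rw [← Real.rpow_natCast, Nat.cast_sub hn]; simp
  refine IntegrableOn.union ?_ ?_
  · have h1 : IntegrableOn (fun y : ℝ => y ^ (γ - 2 * s - 1)) (Ioc 0 1) := by
      rw [← intervalIntegrable_iff_integrableOn_Ioc_of_le zero_le_one]
      exact intervalIntegral.intervalIntegrable_rpow' (by linarith)
    refine h1.congr_fun (fun y hy => ?_) measurableSet_Ioc
    have hy0 := hy.1
    simp only [smul_eq_mul]
    rw [min_eq_right (Real.rpow_le_one hy0.le hy.2 (by linarith)), hpow y hy0, ← Real.rpow_neg hy0.le,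
      ← Real.rpow_add hy0, ← Real.rpow_add hy0]
    ring_nf
  · have h1 : IntegrableOn (fun y : ℝ => y ^ (-1 - 2 * s)) (Ioi 1) :=
      integrableOn_Ioi_rpow_of_lt (by linarith) one_pos
    refine h1.congr_fun (fun y hy => ?_) measurableSet_Ioi
    have hy0 : (0 : ℝ) < y := zero_lt_one.trans hy
    simp only [smul_eq_mul]
    rw [min_eq_left (Real.one_le_rpow (le_of_lt hy) (by linarith)), hpow y hy0,
      ← Real.rpow_neg hy0.le, one_mul, ← Real.rpow_add hy0]
    ring_nf

lemma norm_kerW_smul_secondDiff_le {s γ C : ℝ} {u : E n → V} {x h : E n}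
    (hC : ‖secondDiff u x h‖ ≤ C * min 1 (‖h‖ ^ γ)) :
    ‖kerW s h • secondDiff u x h‖ ≤ C * weight s γ h := by
  rw [norm_smul, Real.norm_of_nonneg (kerW_nonneg s h), weight]
  calc _ ≤ kerW s h * (C * min 1 (‖h‖ ^ γ)) := by gcongr; exact kerW_nonneg s h
    _ = _ := by ring

lemma integrable_kerW_smul_secondDiff (hn : 0 < n) {s γ C : ℝ} (hs : 0 < s) (hγ : 2 * s < γ)
    {u : E n → V} (hu : Continuous u) {x : E n}
    (hC : ∀ h, ‖secondDiff u x h‖ ≤ C * min 1 (‖h‖ ^ γ)) :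
    Integrable (fun h => kerW s h • secondDiff u x h) := by
  refine ((integrable_weight hn hs hγ).const_mul C).mono' ?_
    (Eventually.of_forall fun h => norm_kerW_smul_secondDiff_le (hC h))
  refine (measurable_kerW s).aestronglyMeasurable.smul ?_
  exact ((continuous_secondDiff hu).comp (Continuous.prodMk_right x)).aestronglyMeasurable

lemma norm_fracOp_le (hn : 0 < n) {s γ C : ℝ} (hs : 0 < s) (hγ : 2 * s < γ)
    {u : E n → V} {x : E n} (hC : ∀ h, ‖secondDiff u x h‖ ≤ C * min 1 (‖h‖ ^ γ)) :
    ‖fracOp s u x‖ ≤ |fracConst n s / 2| * (C * ∫ h : E n, weight s γ h) := by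
  unfold fracOp
  rw [norm_smul, norm_neg, Real.norm_eq_abs, ← integral_const_mul]
  gcongr
  exact norm_integral_le_of_norm_le ((integrable_weight hn hs hγ).const_mul C)
    (Eventually.of_forall fun h => norm_kerW_smul_secondDiff_le (hC h))

lemma integrableOn_kerW (hn : 0 < n) {s ε : ℝ} (hs : 0 < s) (hε : 0 < ε) :
    IntegrableOn (kerW s : E n → ℝ) {h | ε < ‖h‖} := by
  have hw := ((integrable_weight (n := n) hn hs (γ := 2 * s + 1) (by linarith)).const_mul
    (min 1 (ε ^ (2 * s + 1)))⁻¹).integrableOn (s := {h | ε < ‖h‖})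
  have hpos : 0 < min 1 (ε ^ (2 * s + 1)) := lt_min one_pos (by positivity)
  refine hw.mono' (measurable_kerW s).aestronglyMeasurable ?_
  refine (ae_restrict_iff' (measurableSet_lt measurable_const measurable_norm)).2
    (Eventually.of_forall fun h hh => ?_)
  rw [Real.norm_of_nonneg (kerW_nonneg s h), weight, ← mul_assoc]
  refine le_mul_of_one_le_left (kerW_nonneg s h) ?_
  rw [← div_eq_inv_mul, one_le_div hpos]
  have : ε ≤ ‖h‖ := le_of_lt hh
  gcongr

/-- The truncated region and the kernel are invariant under h ↦ -h, so averaging with the reflected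
integral replaces first differences by second ones. These are absolutely integrable against the
kernel, and the principal value is then a dominated limit. -/
lemma hasFracLaplacianAt_of_secondDiff (hn : 0 < n) {s γ C M : ℝ} (hs : 0 < s) (hγ : 2 * s < γ)
    {u : E n → ℝ} (hu : Continuous u) (hM : ∀ x, |u x| ≤ M) {x : E n}
    (hC : ∀ h, ‖secondDiff u x h‖ ≤ C * min 1 (‖h‖ ^ γ)) :
    HasFracLaplacianAt s u x (fracOp s u x) := by
  have hmeas : ∀ ε : ℝ, MeasurableSet {h : E n | ε < ‖h‖} := fun ε =>
    measurableSet_lt measurable_const measurable_norm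
  have hmp := (Measure.measurePreserving_sub_left (volume : Measure (E n)) x)
  have hemb : MeasurableEmbedding (fun y : E n => x - y) :=
    (Homeomorph.subLeft x).measurableEmbedding
  have hint : ∀ ε > 0, IntegrableOn (fun h => (u x - u (x - h)) * kerW s h) {h : E n | ε < ‖h‖} := by
    intro ε hε
    refine (integrableOn_kerW hn hs hε).bdd_mul (c := 2 * M) ?_ ?_
    · exact (by fun_prop : Continuous fun h => u x - u (x - h)).aestronglyMeasurable
    · refine Eventually.of_forall fun h => ?_
      calc _ ≤ |u x| + |u (x - h)| := abs_sub _ _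
        _ ≤ _ := by linarith [hM x, hM (x - h)]
  have hset : ∀ ε : ℝ, {y : E n | ε < ‖x - y‖} = (fun y => x - y) ⁻¹' {h | ε < ‖h‖} := fun _ => rfl
  have hfun : (fun y => (u x - u y) / ‖x - y‖ ^ ((n : ℝ) + 2 * s)) =
      (fun h => (u x - u (x - h)) * kerW s h) ∘ fun y => x - y := by
    ext y; simp [kerW, div_eq_mul_inv]
  refine ⟨fun ε hε => ?_, ?_⟩
  · rw [hset, hfun, hmp.integrableOn_comp_preimage hemb]
    exact hint ε hε
  have heq : ∀ ε > 0, ∫ y in {y : E n | ε < ‖x - y‖}, (u x - u y) / ‖x - y‖ ^ ((n : ℝ) + 2 * s) =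
      -(1 / 2) * ∫ h in {h : E n | ε < ‖h‖}, kerW s h • secondDiff u x h := by
    intro ε hε
    rw [hset, hfun]
    simp only [Function.comp_def]
    rw [hmp.setIntegral_preimage_emb hemb (fun h => (u x - u (x - h)) * kerW s h)]
    have hneg : ∫ h in {h : E n | ε < ‖h‖}, (u x - u (x - h)) * kerW s h =
        ∫ h in {h : E n | ε < ‖h‖}, (u x - u (x + h)) * kerW s h := by
      rw [← (Measure.measurePreserving_neg (volume : Measure (E n))).setIntegral_preimage_emb
        (Homeomorph.neg (E n)).measurableEmbedding]
      simp [kerW_neg]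
    have hint' : IntegrableOn (fun h => (u x - u (x + h)) * kerW s h) {h : E n | ε < ‖h‖} := by
      have := ((Measure.measurePreserving_neg (volume : Measure (E n))).integrableOn_comp_preimage
        (Homeomorph.neg (E n)).measurableEmbedding (s := {h | ε < ‖h‖})).2 (hint ε hε)
      simpa [Function.comp_def, kerW_neg] using this
    have hsum : ∫ h in {h : E n | ε < ‖h‖}, kerW s h • secondDiff u x h =
        -((∫ h in {h : E n | ε < ‖h‖}, (u x - u (x - h)) * kerW s h) +
          ∫ h in {h : E n | ε < ‖h‖}, (u x - u (x + h)) * kerW s h) := by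
      rw [← integral_add (hint ε hε) hint', ← integral_neg]
      congr 1; ext h; simp [secondDiff]; ring
    rw [hsum, ← hneg]; ring
  have hI := integrable_kerW_smul_secondDiff hn hs hγ hu hC
  have hlim : Tendsto (fun ε : ℝ => ∫ h in {h : E n | ε < ‖h‖}, kerW s h • secondDiff u x h)
      (𝓝[>] 0) (𝓝 (∫ h, kerW s h • secondDiff u x h)) := by
    simp_rw [← integral_indicator (hmeas _)]
    refine tendsto_integral_filter_of_dominated_convergence
      (fun h => ‖kerW s h • secondDiff u x h‖) ?_ ?_ hI.norm ?_
    · exact Eventually.of_forall fun ε => hI.aestronglyMeasurable.indicator (hmeas ε)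
    · exact Eventually.of_forall fun ε => Eventually.of_forall fun h => norm_indicator_le_norm_self _ _
    · refine Eventually.of_forall fun h => ?_
      by_cases hh : h = 0
      · subst hh
        have h0 : kerW s (0 : E n) • secondDiff u x 0 = 0 := by simp [secondDiff, two_mul]
        rw [h0]
        refine tendsto_const_nhds.congr fun ε => ?_
        rw [indicator_apply, h0, ite_self]
      · refine tendsto_const_nhds.congr' ?_
        have : ∀ᶠ ε : ℝ in 𝓝[>] 0, ε < ‖h‖ :=
          nhdsWithin_le_nhds (eventually_lt_nhds (norm_pos_iff.2 hh))
        filter_upwards [this] with ε hε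
        rw [indicator_of_mem (by exact hε)]
  have h2 := hlim.const_mul (fracConst n s * -(1 / 2))
  have e : fracConst n s * -(1 / 2) * ∫ h : E n, kerW s h • secondDiff u x h = fracOp s u x := by
    rw [fracOp, smul_eq_mul]; ring
  rw [e] at h2
  refine h2.congr' ?_
  filter_upwards [self_mem_nhdsWithin] with ε hε
  rw [heq ε hε]; ring

lemma secondDiff_integral {Y : Type*} [MeasurableSpace Y] {μ : Measure Y} {W : Y → E n → V}
    (hW : ∀ z, Integrable (fun y => W y z) μ) (x h : E n) :
    secondDiff (fun z => ∫ y, W y z ∂μ) x h = ∫ y, secondDiff (W y) x h ∂μ := by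
  unfold secondDiff
  beta_reduce
  rw [← integral_smul, ← integral_add (hW _) (hW _)]
  exact (integral_sub ((hW _).add (hW _)) ((hW x).smul (2 : ℝ))).symm

lemma norm_secondDiff_integral_le {Y : Type*} [MeasurableSpace Y] {μ : Measure Y} {γ : ℝ}
    {W : Y → E n → V} {B : Y → ℝ} (hB : Integrable B μ) (hW : ∀ z, Integrable (fun y => W y z) μ)
    {x : E n} (hC : ∀ᵐ y ∂μ, ∀ h, ‖secondDiff (W y) x h‖ ≤ B y * min 1 (‖h‖ ^ γ)) (h : E n) :
    ‖secondDiff (fun z => ∫ y, W y z ∂μ) x h‖ ≤ (∫ y, B y ∂μ) * min 1 (‖h‖ ^ γ) := by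
  rw [secondDiff_integral hW, ← integral_mul_const]
  refine norm_integral_le_of_norm_le (hB.mul_const _) ?_
  filter_upwards [hC] with y hy using hy h

/-- The fractional Laplacian commutes with integrals over a parameter. -/
lemma fracOp_integral (hn : 0 < n) {s γ : ℝ} (hs : 0 < s) (hγ : 2 * s < γ)
    {Y : Type*} [MeasurableSpace Y] {μ : Measure Y} [SFinite μ] {W : Y → E n → V} {B : Y → ℝ}
    (hWm : StronglyMeasurable (fun z : Y × E n => W z.1 z.2))
    (hB : Integrable B μ) (hW : ∀ z, Integrable (fun y => W y z) μ) {x : E n}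
    (hC : ∀ᵐ y ∂μ, ∀ h, ‖secondDiff (W y) x h‖ ≤ B y * min 1 (‖h‖ ^ γ)) :
    fracOp s (fun z => ∫ y, W y z ∂μ) x = ∫ y, fracOp s (W y) x ∂μ := by
  unfold fracOp
  simp_rw [secondDiff_integral hW]
  rw [integral_smul]
  congr 1
  simp_rw [← integral_smul]
  rw [integral_integral_swap]
  have hm : StronglyMeasurable (fun z : E n × Y => secondDiff (W z.2) x z.1) := by
    unfold secondDiff
    refine ((hWm.comp_measurable (g := fun z : E n × Y => (z.2, x + z.1)) (by fun_prop)).add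
      (hWm.comp_measurable (g := fun z : E n × Y => (z.2, x - z.1)) (by fun_prop))).sub
      ((hWm.comp_measurable (g := fun z : E n × Y => (z.2, x)) (by fun_prop)).const_smul _)
  refine ((integrable_weight (n := n) hn hs hγ).mul_prod hB).mono' ?_ ?_
  · exact ((measurable_kerW s).comp measurable_fst).stronglyMeasurable.aestronglyMeasurable.smul
      hm.aestronglyMeasurable
  · have : ∀ᵐ z : E n × Y ∂(volume.prod μ), ∀ h, ‖secondDiff (W z.2) x h‖ ≤ B z.2 * min 1 (‖h‖ ^ γ) :=
      Measure.quasiMeasurePreserving_snd.ae hC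
    filter_upwards [this] with z hz
    have := norm_kerW_smul_secondDiff_le (s := s) (hz z.1)
    simpa [Function.uncurry, mul_comm] using this

/-- Translating the integration variable moves the difference from u to κ; the sign of h is
irrelevant because the difference is centred. A merely bounded u thereby inherits the L¹ smoothness
of κ. -/
lemma secondDiff_correlation {κ u : E n → ℝ} {M : ℝ} (hκ : Integrable κ) (hu : Continuous u)
    (hM : ∀ x, |u x| ≤ M) (x h : E n) :
    secondDiff (fun x => ∫ y, κ y * u (x + y)) x h = ∫ y, secondDiff κ y h * u (x + y) := by
  have hi : ∀ (a b : E n), Integrable fun y => κ (y + b) * u (a + y) := fun a b =>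
    (hκ.comp_add_right b).mul_bdd (c := M) (by fun_prop) (Eventually.of_forall fun y => hM _)
  have hsh : ∀ b : E n, ∫ y, κ y * u (x + b + y) = ∫ y, κ (y + -b) * u (x + y) := fun b => by
    rw [← integral_add_right_eq_self (fun y => κ y * u (x + b + y)) (-b)]
    congr 1; ext y; congr 2; abel
  unfold secondDiff
  have h2 := hsh (-h)
  rw [← sub_eq_add_neg] at h2
  beta_reduce
  rw [hsh h, h2, smul_eq_mul, ← integral_const_mul]
  have h0 : Integrable fun y => 2 * (κ y * u (x + y)) := by simpa using (hi x 0).const_mul 2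
  rw [← integral_add (hi _ _) (hi _ _)]
  refine (integral_sub ((hi _ _).add (hi _ _)) h0).symm.trans ?_
  congr 1; ext y; simp [sub_eq_add_neg]; ring

lemma integrable_secondDiff {κ : E n → ℝ} (hκ : Integrable κ) (h : E n) :
    Integrable fun y => secondDiff κ y h := by
  unfold secondDiff
  exact ((hκ.comp_add_right h).add (hκ.comp_sub_right h)).sub (hκ.smul (2 : ℝ))

lemma abs_secondDiff_correlation_le {κ u : E n → ℝ} {M : ℝ} (hκ : Integrable κ) (hu : Continuous u)
    (hM : ∀ x, |u x| ≤ M) (x h : E n) :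
    ‖secondDiff (fun x => ∫ y, κ y * u (x + y)) x h‖ ≤ M * ∫ y, |secondDiff κ y h| := by
  rw [secondDiff_correlation hκ hu hM, ← integral_const_mul]
  refine norm_integral_le_of_norm_le ((integrable_secondDiff hκ h).abs.const_mul M)
    (Eventually.of_forall fun y => ?_)
  rw [norm_mul, mul_comm]
  exact mul_le_mul_of_nonneg_right (hM _) (abs_nonneg _)

/-- Integrating in y first leaves a multiple of `weight s γ`. This is what permits Fubini when the
operator is moved from a correlation to its kernel. -/
lemma integrable_prod_kerW_secondDiff (hn : 0 < n) {s γ C : ℝ} (hs : 0 < s) (hγ : 2 * s < γ)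
    {κ : E n → ℝ} (hκ : Integrable κ) (hκc : Continuous κ)
    (hC : ∀ h, ∫ y, |secondDiff κ y h| ≤ C * min 1 (‖h‖ ^ γ)) :
    Integrable (fun z : E n × E n => kerW s z.1 * secondDiff κ z.2 z.1) (volume.prod volume) := by
  have hm : AEStronglyMeasurable (fun z : E n × E n => kerW s z.1 * secondDiff κ z.2 z.1)
      (volume.prod volume) :=
    ((measurable_kerW s).comp measurable_fst).aestronglyMeasurable.mul
      ((continuous_secondDiff hκc).comp continuous_swap).aestronglyMeasurable
  rw [integrable_prod_iff hm]
  refine ⟨Eventually.of_forall fun h => (integrable_secondDiff hκ h).const_mul (kerW s h), ?_⟩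
  refine ((integrable_weight hn hs hγ).const_mul C).mono' hm.norm.integral_prod_right'
    (Eventually.of_forall fun h => ?_)
  simp only [norm_mul, integral_const_mul, Real.norm_of_nonneg (kerW_nonneg s h)]
  rw [Real.norm_of_nonneg (integral_nonneg fun _ => norm_nonneg _)]
  calc _ ≤ kerW s h * (C * min 1 (‖h‖ ^ γ)) := by
        gcongr
        · exact kerW_nonneg s h
        · exact hC h
    _ = _ := by rw [weight]; ring

lemma integrable_fracOp (hn : 0 < n) {s γ C : ℝ} (hs : 0 < s) (hγ : 2 * s < γ)
    {κ : E n → ℝ} (hκ : Integrable κ) (hκc : Continuous κ)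
    (hC : ∀ h, ∫ y, |secondDiff κ y h| ≤ C * min 1 (‖h‖ ^ γ)) :
    Integrable (fracOp s κ) := by
  have := (integrable_prod_kerW_secondDiff hn hs hγ hκ hκc hC).integral_prod_right
  exact this.smul (-(fracConst n s / 2))

/-- The fractional Laplacian of a correlation, when the second differences are put on the kernel. -/
lemma fracOp_correlation (hn : 0 < n) {s γ C M : ℝ} (hs : 0 < s) (hγ : 2 * s < γ)
    {κ u : E n → ℝ} (hκ : Integrable κ) (hκc : Continuous κ)
    (hC : ∀ h, ∫ y, |secondDiff κ y h| ≤ C * min 1 (‖h‖ ^ γ))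
    (hu : Continuous u) (hM : ∀ x, |u x| ≤ M) (x : E n) :
    fracOp s (fun x => ∫ y, κ y * u (x + y)) x = ∫ y, fracOp s κ y * u (x + y) := by
  unfold fracOp
  simp_rw [secondDiff_correlation hκ hu hM, smul_eq_mul, mul_assoc, integral_const_mul]
  congr 1
  simp_rw [← integral_const_mul, ← integral_mul_const]
  rw [integral_integral_swap]
  · simp_rw [mul_assoc]
  · have h1 := (integrable_prod_kerW_secondDiff hn hs hγ hκ hκc hC).mul_bdd (c := M)
      (g := fun z : E n × E n => u (x + z.2)) (by fun_prop) (Eventually.of_forall fun y => hM _)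
    simpa [Function.uncurry_def, mul_assoc] using h1

lemma fracOp_ofReal (s : ℝ) (u : E n → ℝ) (x : E n) :
    fracOp s (fun y => (u y : ℂ)) x = ((fracOp s u x : ℝ) : ℂ) := by
  unfold fracOp secondDiff
  simp only [smul_eq_mul, Complex.ofReal_mul, Complex.real_smul]
  rw [← integral_complex_ofReal]
  congr 2; ext h; push_cast; ring

end

/-! ### The symbol of the singular integral -/

section

variable {n : ℕ}

lemma one_sub_exp_neg_le (x : ℝ) : 1 - Real.exp (-x) ≤ min 1 x :=
  le_min (by linarith [Real.exp_pos (-x)]) (by linarith [Real.add_one_le_exp (-x)])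

lemma one_sub_exp_neg_nonneg {x : ℝ} (hx : 0 ≤ x) : 0 ≤ 1 - Real.exp (-x) := by
  simpa using hx

lemma integrableOn_one_sub_exp_mul_rpow {s c : ℝ} (hs₀ : 0 < s) (hs₁ : s < 1) (hc : 0 ≤ c) :
    IntegrableOn (fun σ : ℝ => (1 - Real.exp (-(c * σ))) * σ ^ (-1 - s)) (Ioi 0) := by
  have hm : Measurable (fun σ : ℝ => (1 - Real.exp (-(c * σ))) * σ ^ (-1 - s)) := by fun_prop
  rw [← Ioc_union_Ioi_eq_Ioi (zero_le_one' ℝ)]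
  refine IntegrableOn.union ?_ ?_
  · have h1 : IntegrableOn (fun y : ℝ => c * y ^ (-s)) (Ioc 0 1) := by
      refine Integrable.const_mul ?_ c
      rw [← IntegrableOn, ← intervalIntegrable_iff_integrableOn_Ioc_of_le zero_le_one]
      exact intervalIntegral.intervalIntegrable_rpow' (by linarith)
    refine h1.mono' hm.aestronglyMeasurable ((ae_restrict_iff' measurableSet_Ioc).2
      (Eventually.of_forall fun y hy => ?_))
    have hy0 := hy.1
    have hcy : 0 ≤ c * y := by positivity
    rw [Real.norm_of_nonneg (mul_nonneg (one_sub_exp_neg_nonneg hcy) (by positivity))]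
    calc _ ≤ c * y * y ^ (-1 - s) := by
          gcongr; exact (one_sub_exp_neg_le _).trans (min_le_right _ _)
      _ = c * y ^ (-s) := by
          rw [mul_assoc, mul_comm y, ← Real.rpow_add_one hy0.ne']; ring_nf
  · have h1 : IntegrableOn (fun y : ℝ => y ^ (-1 - s)) (Ioi 1) :=
      integrableOn_Ioi_rpow_of_lt (by linarith) one_pos
    refine h1.mono' hm.aestronglyMeasurable ((ae_restrict_iff' measurableSet_Ioi).2
      (Eventually.of_forall fun y hy => ?_))
    have hy0 : (0 : ℝ) < y := zero_lt_one.trans hy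
    have hcy : 0 ≤ c * y := by positivity
    rw [Real.norm_of_nonneg (mul_nonneg (one_sub_exp_neg_nonneg hcy) (by positivity))]
    exact mul_le_of_le_one_left (by positivity) ((one_sub_exp_neg_le _).trans (min_le_left _ _))

/-- Integration by parts with the primitive -σ^{-s}/s. Since 1 - e^{-cσ} ≤ min(1, cσ), the boundary
terms vanish at both ends, and a Gamma integral of parameter 1 - s remains. -/
lemma integral_one_sub_exp_mul_rpow {s c : ℝ} (hs₀ : 0 < s) (hs₁ : s < 1) (hc : 0 ≤ c) :
    ∫ σ in Ioi (0 : ℝ), (1 - Real.exp (-(c * σ))) * σ ^ (-1 - s) = c ^ s * Real.Gamma (1 - s) / s := by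
  rcases hc.eq_or_lt with rfl | hc
  · simp [Real.zero_rpow hs₀.ne']
  have hibp := integral_Ioi_mul_deriv_eq_deriv_mul (a := 0) (a' := (0 : ℝ)) (b' := (0 : ℝ))
    (u := fun σ : ℝ => 1 - Real.exp (-(c * σ))) (u' := fun σ => c * Real.exp (-(c * σ)))
    (v := fun σ : ℝ => -(σ ^ (-s) / s)) (v' := fun σ => σ ^ (-1 - s))
    (fun x _ => by
      have := (((hasDerivAt_id x).const_mul c).neg.exp).const_sub 1
      simpa [mul_comm] using this)
    (fun x hx => by
      have := ((Real.hasDerivAt_rpow_const (p := -s) (Or.inl (ne_of_gt hx))).div_const s).neg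
      convert! this using 1
      rw [show -s - 1 = -1 - s by ring]; field_simp)
    (integrableOn_one_sub_exp_mul_rpow hs₀ hs₁ hc.le)
    (by
      have h2 : IntegrableOn (fun x : ℝ => x ^ ((1 - s) - 1) * Real.exp (-(c * x))) (Ioi 0) := by
        have := (integrableOn_rpow_mul_exp_neg_mul_rpow (p := 1) (s := -s) (b := c) (by linarith) one_pos hc)
        refine this.congr_fun (fun x hx => ?_) measurableSet_Ioi
        simp
      refine (h2.const_mul (-(c / s))).congr (Eventually.of_forall fun x => ?_)
      simp only [Pi.mul_apply]
      rw [show (1 - s - 1) = -s by ring]; ring)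
    (by
      have h0 : Tendsto (fun σ : ℝ => c / s * σ ^ (1 - s)) (𝓝[>] 0) (𝓝 0) := by
        have := (Real.continuousAt_rpow_const 0 (1 - s) (Or.inr (by linarith))).tendsto.const_mul (c / s)
        rw [Real.zero_rpow (by linarith), mul_zero] at this
        exact this.mono_left nhdsWithin_le_nhds
      refine squeeze_zero_norm' ?_ h0
      filter_upwards [self_mem_nhdsWithin] with x hx
      have hx : 0 < x := hx
      have hcx : 0 ≤ c * x := by positivity
      simp only [Pi.mul_apply, norm_mul, norm_neg]
      rw [Real.norm_of_nonneg (one_sub_exp_neg_nonneg hcx), Real.norm_of_nonneg (by positivity)]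
      calc _ ≤ c * x * (x ^ (-s) / s) := by
            gcongr; exact (one_sub_exp_neg_le _).trans (min_le_right _ _)
        _ = c / s * x ^ (1 - s) := by
            rw [sub_eq_add_neg, Real.rpow_add hx, Real.rpow_one]; ring)
    (by
      have h0 : Tendsto (fun σ : ℝ => σ ^ (-s) / s) atTop (𝓝 0) := by
        simpa using (tendsto_rpow_neg_atTop hs₀).div_const s
      refine squeeze_zero_norm' ?_ h0
      filter_upwards [eventually_gt_atTop 0] with x hx
      have hcx : 0 ≤ c * x := by positivity
      simp only [Pi.mul_apply, norm_mul, norm_neg]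
      rw [Real.norm_of_nonneg (one_sub_exp_neg_nonneg hcx), Real.norm_of_nonneg (by positivity)]
      exact mul_le_of_le_one_left (by positivity) ((one_sub_exp_neg_le _).trans (min_le_left _ _)))
  rw [hibp]
  have hG := Real.integral_rpow_mul_exp_neg_mul_Ioi (a := 1 - s) (r := c) (by linarith) hc
  have e : ∫ x in Ioi (0 : ℝ), c * Real.exp (-(c * x)) * -(x ^ (-s) / s) =
      -(c / s) * ∫ x in Ioi (0 : ℝ), x ^ (1 - s - 1) * Real.exp (-(c * x)) := by
    rw [← integral_const_mul]
    congr 1; ext x; rw [show (1 - s - 1) = -s by ring]; ring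
  rw [e, hG, Real.div_rpow zero_le_one hc.le, Real.one_rpow, Real.rpow_sub hc, Real.rpow_one]
  field_simp
  ring

/-- The substitution σ = 1/r. This is the form in which the integral appears when the kernel is
written as a mixture of Gaussians with inverse variance r. -/
lemma integrableOn_rpow_mul_one_sub_exp_inv {s c : ℝ} (hs₀ : 0 < s) (hs₁ : s < 1) (hc : 0 ≤ c) :
    IntegrableOn (fun r : ℝ => r ^ (s - 1) * (1 - Real.exp (-(c / r)))) (Ioi 0) := by
  have := (integrableOn_Ioi_comp_rpow_iff
    (fun σ : ℝ => (1 - Real.exp (-(c * σ))) * σ ^ (-1 - s)) (p := -1) (by norm_num)).2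
    (integrableOn_one_sub_exp_mul_rpow hs₀ hs₁ hc)
  refine this.congr_fun (fun x hx => ?_) measurableSet_Ioi
  have hx : 0 < x := hx
  simp only [smul_eq_mul, abs_neg, abs_one, one_mul]
  rw [← Real.rpow_mul hx.le, mul_comm (1 - _), ← mul_assoc, ← Real.rpow_add hx, Real.rpow_neg_one]
  ring_nf

lemma integral_rpow_mul_one_sub_exp_inv {s c : ℝ} (hs₀ : 0 < s) (hs₁ : s < 1) (hc : 0 ≤ c) :
    ∫ r in Ioi (0 : ℝ), r ^ (s - 1) * (1 - Real.exp (-(c / r))) = c ^ s * Real.Gamma (1 - s) / s := by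
  rw [← integral_one_sub_exp_mul_rpow hs₀ hs₁ hc, ← integral_comp_rpow_Ioi
    (fun σ : ℝ => (1 - Real.exp (-(c * σ))) * σ ^ (-1 - s)) (p := -1) (by norm_num)]
  refine setIntegral_congr_fun measurableSet_Ioi (fun x hx => ?_)
  have hx : 0 < x := hx
  simp only [smul_eq_mul, abs_neg, abs_one, one_mul]
  rw [← Real.rpow_mul hx.le, mul_comm (1 - _) (x ^ (-1 * _)), ← mul_assoc, ← Real.rpow_add hx, Real.rpow_neg_one]
  ring_nf

lemma integrable_exp_neg_mul_sq {r : ℝ} (hr : 0 < r) :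
    Integrable (fun h : E n => Real.exp (-r * ‖h‖ ^ 2)) := by
  have := (GaussianFourier.integrable_cexp_neg_mul_sq_norm_add (V := E n) (b := (r : ℂ))
    (by simpa using hr) 0 0).re
  refine this.congr (Eventually.of_forall fun h => ?_)
  simp only [zero_mul, add_zero]
  rw [← Complex.exp_ofReal_re]
  push_cast; rfl

/-- The character `exp(2πi⟨ξ,x⟩)`. -/
def chr (ξ x : E n) : ℂ := Complex.exp (((2 * Real.pi * inner ℝ ξ x : ℝ) : ℂ) * Complex.I)

lemma norm_chr (ξ x : E n) : ‖chr ξ x‖ = 1 := by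
  unfold chr; exact Complex.norm_exp_ofReal_mul_I _

lemma continuous_chr : Continuous fun z : E n × E n => chr z.1 z.2 := by
  unfold chr; fun_prop

lemma chr_add (ξ x h : E n) : chr ξ (x + h) = chr ξ x * chr ξ h := by
  unfold chr; rw [← Complex.exp_add, inner_add_right]; congr 1; push_cast; ring

lemma integral_exp_neg_mul_sq_mul_chr {r : ℝ} (hr : 0 < r) (ξ : E n) :
    ∫ h : E n, (Real.exp (-r * ‖h‖ ^ 2) : ℂ) * chr ξ h =
      (((Real.pi / r) ^ ((n : ℝ) / 2) * Real.exp (-(Real.pi ^ 2 * ‖ξ‖ ^ 2 / r)) : ℝ) : ℂ) := by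
  have hb : 0 < (r : ℂ).re := by simpa using hr
  have h1 := GaussianFourier.integral_cexp_neg_mul_sq_norm_add hb (2 * Real.pi * Complex.I) ξ
  have e1 : ∀ h : E n, Complex.exp (-(r : ℂ) * ‖h‖ ^ 2 + 2 * Real.pi * Complex.I * (inner ℝ ξ h : ℝ))
      = (Real.exp (-r * ‖h‖ ^ 2) : ℂ) * chr ξ h := by
    intro h
    rw [chr, Complex.ofReal_exp, ← Complex.exp_add]
    congr 1; push_cast; ring
  simp_rw [e1] at h1
  have e2 : ((Real.pi : ℂ) / r) ^ ((Module.finrank ℝ (E n) : ℂ) / 2) =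
      (((Real.pi / r) ^ ((n : ℝ) / 2) : ℝ) : ℂ) := by
    rw [Complex.ofReal_cpow (by positivity)]; simp
  have e3 : Complex.exp ((2 * Real.pi * Complex.I) ^ 2 * ‖ξ‖ ^ 2 / (4 * r)) =
      ((Real.exp (-(Real.pi ^ 2 * ‖ξ‖ ^ 2 / r)) : ℝ) : ℂ) := by
    rw [Complex.ofReal_exp]; congr 1; push_cast
    rw [mul_pow, mul_pow, Complex.I_sq]
    have : (r : ℂ) ≠ 0 := by exact_mod_cast hr.ne'
    field_simp; ring
  rw [h1, e2, e3, ← Complex.ofReal_mul]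

lemma chr_re (ξ x : E n) : (chr ξ x).re = Real.cos (2 * Real.pi * inner ℝ ξ x) := by
  unfold chr; exact Complex.exp_ofReal_mul_I_re _

lemma integral_exp_neg_mul_sq_mul_cos {r : ℝ} (hr : 0 < r) (ξ : E n) :
    ∫ h : E n, Real.exp (-r * ‖h‖ ^ 2) * Real.cos (2 * Real.pi * inner ℝ ξ h) =
      (Real.pi / r) ^ ((n : ℝ) / 2) * Real.exp (-(Real.pi ^ 2 * ‖ξ‖ ^ 2 / r)) := by
  have h1 := congrArg Complex.re (integral_exp_neg_mul_sq_mul_chr hr ξ)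
  have h2 : Integrable fun h : E n => (Real.exp (-r * ‖h‖ ^ 2) : ℂ) * chr ξ h :=
    (integrable_exp_neg_mul_sq hr).ofReal.mul_bdd (c := 1)
      (continuous_chr.comp (by fun_prop : Continuous fun x => (ξ, x))).aestronglyMeasurable
      (Eventually.of_forall fun x => (norm_chr ξ x).le)
  rw [← RCLike.re_eq_complex_re, ← integral_re h2, RCLike.re_eq_complex_re, Complex.ofReal_re] at h1
  rw [← h1]
  congr 1; ext h
  rw [Complex.re_ofReal_mul, chr_re]

lemma fracConst_pos {s : ℝ} (hs₀ : 0 < s) (hs₁ : s < 1) : 0 < fracConst n s := by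
  unfold fracConst
  have := Real.Gamma_pos_of_pos (show 0 < (n : ℝ) / 2 + s by positivity)
  have := Real.Gamma_pos_of_pos (show 0 < 1 - s by linarith)
  positivity

/-- The Gamma integral evaluated at |h|². As a mixture of Gaussians the kernel can be paired with
cosines explicitly, which yields the symbol with its exact constant. -/
lemma kerW_eq_integral {s : ℝ} (hs : 0 < s) {h : E n} (hh : h ≠ 0) :
    kerW s h = (Real.Gamma ((n : ℝ) / 2 + s))⁻¹ *
      ∫ r in Ioi (0 : ℝ), r ^ ((n : ℝ) / 2 + s - 1) * Real.exp (-r * ‖h‖ ^ 2) := by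
  have hp : 0 < (n : ℝ) / 2 + s := by positivity
  have hG := Real.Gamma_pos_of_pos hp
  have hh' : 0 < ‖h‖ := norm_pos_iff.2 hh
  have e := Real.integral_rpow_mul_exp_neg_mul_Ioi hp (r := ‖h‖ ^ 2) (by positivity)
  have e2 : ∫ r in Ioi (0 : ℝ), r ^ ((n : ℝ) / 2 + s - 1) * Real.exp (-r * ‖h‖ ^ 2) =
      (1 / ‖h‖ ^ 2) ^ ((n : ℝ) / 2 + s) * Real.Gamma ((n : ℝ) / 2 + s) := by
    rw [← e]; congr 1; ext r; ring_nf
  rw [e2, mul_comm, mul_assoc, mul_inv_cancel₀ hG.ne', mul_one, kerW, one_div,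
    Real.inv_rpow (by positivity), ← Real.rpow_two, ← Real.rpow_mul hh'.le]
  ring_nf

/-- The symbol of the singular integral. -/
lemma integral_kerW_mul_one_sub_cos (hn : 0 < n) {s : ℝ} (hs₀ : 0 < s) (hs₁ : s < 1) (ξ : E n) :
    fracConst n s * ∫ h, kerW s h * (1 - Real.cos (2 * Real.pi * inner ℝ ξ h)) =
      (2 * Real.pi * ‖ξ‖) ^ (2 * s) := by
  have : Nonempty (Fin n) := ⟨⟨0, hn⟩⟩
  set q : ℝ := (n : ℝ) / 2 + s with hq
  have hp : 0 < q := by positivity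
  have hG := Real.Gamma_pos_of_pos hp
  have hG' := Real.Gamma_pos_of_pos (show 0 < 1 - s by linarith)
  set g : E n → ℝ := fun h => 1 - Real.cos (2 * Real.pi * inner ℝ ξ h) with hg
  have hg0 : ∀ h, 0 ≤ g h := fun h => by simp only [hg]; linarith [Real.cos_le_one (2 * Real.pi * inner ℝ ξ h)]
  have hgc : Continuous g := by simp only [hg]; fun_prop
  have hgi : ∀ r : ℝ, 0 < r → ∫ h, Real.exp (-r * ‖h‖ ^ 2) * g h =
      (Real.pi / r) ^ ((n : ℝ) / 2) * (1 - Real.exp (-(Real.pi ^ 2 * ‖ξ‖ ^ 2 / r))) := by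
    intro r hr
    have h1 := integral_exp_neg_mul_sq_mul_cos hr ξ
    have h0 : ∫ h : E n, Real.exp (-r * ‖h‖ ^ 2) = (Real.pi / r) ^ ((n : ℝ) / 2) := by
      simpa using integral_exp_neg_mul_sq_mul_cos hr (0 : E n)
    have hi := integrable_exp_neg_mul_sq (n := n) hr
    have hi2 : Integrable fun h : E n => Real.exp (-r * ‖h‖ ^ 2) * Real.cos (2 * Real.pi * inner ℝ ξ h) :=
      hi.mul_bdd (c := 1) (by fun_prop) (Eventually.of_forall fun h => Real.abs_cos_le_one _)
    simp only [hg, mul_sub, mul_one]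
    rw [integral_sub hi hi2, h0, h1]
  have hgint : ∀ r : ℝ, 0 < r → Integrable fun h : E n => Real.exp (-r * ‖h‖ ^ 2) * g h := by
    intro r hr
    refine (integrable_exp_neg_mul_sq hr).mul_bdd (c := 2) (by fun_prop) (Eventually.of_forall fun h => ?_)
    rw [Real.norm_of_nonneg (hg0 h)]
    simp only [hg]; linarith [Real.neg_one_le_cos (2 * Real.pi * inner ℝ ξ h)]
  -- The Gaussian integral contributes r^{-n/2}, which lowers the exponent q - 1 = n/2 + s - 1 to s
  -- - 1.
  have hrad : ∀ r : ℝ, 0 < r → r ^ (q - 1) * ((Real.pi / r) ^ ((n : ℝ) / 2) *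
      (1 - Real.exp (-(Real.pi ^ 2 * ‖ξ‖ ^ 2 / r)))) = Real.pi ^ ((n : ℝ) / 2) *
      (r ^ (s - 1) * (1 - Real.exp (-(Real.pi ^ 2 * ‖ξ‖ ^ 2 / r)))) := by
    intro r hr
    rw [Real.div_rpow Real.pi_pos.le hr.le, div_eq_mul_inv, ← Real.rpow_neg hr.le,
      show s - 1 = (q - 1) + -((n : ℝ) / 2) by rw [hq]; ring, Real.rpow_add hr]
    ring
  have hprod : Integrable (fun z : ℝ × E n => z.1 ^ (q - 1) * (Real.exp (-z.1 * ‖z.2‖ ^ 2) * g z.2))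
      ((volume.restrict (Ioi 0)).prod volume) := by
    have hm : AEStronglyMeasurable (fun z : ℝ × E n => z.1 ^ (q - 1) * (Real.exp (-z.1 * ‖z.2‖ ^ 2) * g z.2))
      ((volume.restrict (Ioi 0)).prod volume) := by
      refine Measurable.aestronglyMeasurable ?_
      have := hgc.measurable
      fun_prop
    rw [integrable_prod_iff hm]
    constructor
    · refine (ae_restrict_iff' measurableSet_Ioi).2 (Eventually.of_forall fun r hr => ?_)
      exact (hgint r hr).const_mul (r ^ (q - 1))
    · refine ((integrableOn_rpow_mul_one_sub_exp_inv hs₀ hs₁ (c := Real.pi ^ 2 * ‖ξ‖ ^ 2)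
        (by positivity)).const_mul (Real.pi ^ ((n : ℝ) / 2))).congr ?_
      refine (ae_restrict_iff' measurableSet_Ioi).2 (Eventually.of_forall fun r hr => ?_)
      have hr : 0 < r := hr
      beta_reduce
      rw [← hrad r hr, ← hgi r hr, ← integral_const_mul]
      congr 1; ext h
      rw [Real.norm_of_nonneg (mul_nonneg (by positivity) (mul_nonneg (by positivity) (hg0 h)))]
  have hae : (fun h : E n => kerW s h * g h) =ᵐ[volume] fun h => (Real.Gamma q)⁻¹ *
      ∫ r in Ioi (0 : ℝ), r ^ (q - 1) * (Real.exp (-r * ‖h‖ ^ 2) * g h) := by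
    have : ∀ᵐ h : E n, h ≠ 0 := by simp [ae_iff]
    filter_upwards [this] with h hh
    rw [kerW_eq_integral hs₀ hh, mul_assoc, ← integral_mul_const]
    simp_rw [mul_assoc]; rfl
  rw [integral_congr_ae hae, integral_const_mul, ← integral_integral_swap hprod]
  have : ∫ r in Ioi (0 : ℝ), ∫ h, r ^ (q - 1) * (Real.exp (-r * ‖h‖ ^ 2) * g h) =
      Real.pi ^ ((n : ℝ) / 2) * ((Real.pi ^ 2 * ‖ξ‖ ^ 2) ^ s * Real.Gamma (1 - s) / s) := by
    rw [← integral_rpow_mul_one_sub_exp_inv hs₀ hs₁ (by positivity), ← integral_const_mul]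
    refine setIntegral_congr_fun measurableSet_Ioi fun r hr => ?_
    beta_reduce
    rw [integral_const_mul, hgi r hr, hrad r hr]
  rw [this, fracConst, ← hq]
  have e4 : (2 * Real.pi * ‖ξ‖) ^ (2 * s) = 4 ^ s * (Real.pi ^ 2 * ‖ξ‖ ^ 2) ^ s := by
    rw [← Real.mul_rpow (by norm_num) (by positivity), Real.rpow_mul (by positivity), Real.rpow_two]
    ring_nf
  rw [e4]
  have := (Real.rpow_pos_of_pos Real.pi_pos ((n : ℝ) / 2)).ne'
  have := hG.ne'
  have := hG'.ne'
  field_simp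

lemma secondDiff_chr (ξ x h : E n) : secondDiff (chr ξ) x h =
    ((-2 * (1 - Real.cos (2 * Real.pi * inner ℝ ξ h)) : ℝ) : ℂ) * chr ξ x := by
  have e : chr ξ h + chr ξ (-h) = ((2 * Real.cos (2 * Real.pi * inner ℝ ξ h) : ℝ) : ℂ) := by
    unfold chr
    rw [inner_neg_right]
    push_cast
    rw [Complex.two_cos]
    ring_nf
  unfold secondDiff
  rw [sub_eq_add_neg x h, chr_add, chr_add, ← mul_add, e, Complex.real_smul]
  push_cast; ring

lemma norm_secondDiff_chr_le (ξ x h : E n) :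
    ‖secondDiff (chr ξ) x h‖ ≤ (4 + (2 * Real.pi * ‖ξ‖) ^ 2) * min 1 (‖h‖ ^ (2 : ℝ)) := by
  rw [secondDiff_chr, norm_mul, norm_chr, mul_one, Complex.norm_real, norm_mul, Real.rpow_two]
  set θ := 2 * Real.pi * inner ℝ ξ h with hθ
  have h0 : 0 ≤ 1 - Real.cos θ := by linarith [Real.cos_le_one θ]
  have h1 : 1 - Real.cos θ ≤ 2 := by linarith [Real.neg_one_le_cos θ]
  have h2 : 1 - Real.cos θ ≤ θ ^ 2 / 2 := by linarith [Real.one_sub_sq_div_two_le_cos (x := θ)]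
  have h3 : θ ^ 2 ≤ (2 * Real.pi * ‖ξ‖) ^ 2 * ‖h‖ ^ 2 := by
    rw [← mul_pow]
    refine sq_le_sq' ?_ ?_
    · have := abs_le.1 (abs_real_inner_le_norm ξ h)
      rw [hθ]; nlinarith [Real.pi_pos, mul_le_mul_of_nonneg_left this.1 Real.two_pi_pos.le]
    · have := abs_le.1 (abs_real_inner_le_norm ξ h)
      rw [hθ]; nlinarith [Real.pi_pos, mul_le_mul_of_nonneg_left this.2 Real.two_pi_pos.le]
  rw [Real.norm_of_nonneg h0, norm_neg, Real.norm_ofNat]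
  rcases le_total 1 (‖h‖ ^ 2) with h4 | h4
  · rw [min_eq_left h4]; nlinarith [sq_nonneg (2 * Real.pi * ‖ξ‖)]
  · rw [min_eq_right h4]; nlinarith [sq_nonneg ‖h‖]

lemma fracOp_chr (hn : 0 < n) {s : ℝ} (hs₀ : 0 < s) (hs₁ : s < 1) (ξ x : E n) :
    fracOp s (chr ξ) x = (((2 * Real.pi * ‖ξ‖) ^ (2 * s) : ℝ) : ℂ) * chr ξ x := by
  unfold fracOp
  simp_rw [secondDiff_chr, Complex.real_smul, ← mul_assoc, integral_mul_const, ← Complex.ofReal_mul,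
    integral_complex_ofReal]
  rw [← mul_assoc, ← Complex.ofReal_mul, ← integral_kerW_mul_one_sub_cos hn hs₀ hs₁]
  congr 2
  rw [← integral_const_mul, ← integral_const_mul]
  congr 1; ext h; ring

lemma fourierInv_eq_integral_chr (H : E n → ℂ) (x : E n) : 𝓕⁻ H x = ∫ ξ, H ξ * chr ξ x := by
  rw [Real.fourierInv_eq']
  congr 1; ext ξ
  rw [smul_eq_mul, mul_comm]; rfl

lemma integrable_mul_chr {H : E n → ℂ} (hH : Integrable H) (x : E n) :
    Integrable fun ξ => H ξ * chr ξ x :=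
  hH.mul_bdd (c := 1) (continuous_chr.comp (by fun_prop : Continuous fun ξ => (ξ, x))).aestronglyMeasurable
    (Eventually.of_forall fun ξ => (norm_chr ξ x).le)

lemma secondDiff_mul_chr (a : ℂ) (ξ x h : E n) :
    secondDiff (fun z => a * chr ξ z) x h = a * secondDiff (chr ξ) x h := by
  unfold secondDiff; simp only [Complex.real_smul]; ring

lemma norm_secondDiff_fourierInv_le {H : E n → ℂ} (hH : Integrable H)
    (hH2 : Integrable fun ξ => ‖ξ‖ ^ 2 * ‖H ξ‖) (x h : E n) :
    ‖secondDiff (𝓕⁻ H) x h‖ ≤ (∫ ξ, ‖H ξ‖ * (4 + (2 * Real.pi * ‖ξ‖) ^ 2)) * min 1 (‖h‖ ^ (2 : ℝ)) := by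
  have e : 𝓕⁻ H = fun z => ∫ ξ, H ξ * chr ξ z := funext (fourierInv_eq_integral_chr H)
  rw [e]
  refine norm_secondDiff_integral_le ?_ (integrable_mul_chr hH) ?_ h
  · refine ((hH.norm.const_mul 4).add (hH2.const_mul ((2 * Real.pi) ^ 2))).congr
      (Eventually.of_forall fun ξ => ?_)
    simp only [Pi.add_apply]; ring
  · refine Eventually.of_forall fun ξ h => ?_
    rw [secondDiff_mul_chr, norm_mul, mul_assoc]
    gcongr
    exact norm_secondDiff_chr_le ξ x h

/-- Superposition of the eigenfunctions `chr ξ`. Their second differences grow like |ξ|², so a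
second moment of H suffices to exchange the integrals; the exponent 2 exceeds 2s. -/
lemma fracOp_fourierInv (hn : 0 < n) {s : ℝ} (hs₀ : 0 < s) (hs₁ : s < 1) {H : E n → ℂ}
    (hHc : Continuous H) (hH : Integrable H)
    (hH2 : Integrable fun ξ => ‖ξ‖ ^ 2 * ‖H ξ‖) (x : E n) :
    fracOp s (𝓕⁻ H) x = 𝓕⁻ (fun ξ => (((2 * Real.pi * ‖ξ‖) ^ (2 * s) : ℝ) : ℂ) * H ξ) x := by
  have e : 𝓕⁻ H = fun z => ∫ ξ, H ξ * chr ξ z := funext (fourierInv_eq_integral_chr H)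
  rw [e, fourierInv_eq_integral_chr, fracOp_integral hn hs₀ (γ := 2) (by linarith)
    (B := fun ξ => ‖H ξ‖ * (4 + (2 * Real.pi * ‖ξ‖) ^ 2))]
  · congr 1; ext ξ
    have : fracOp s (fun z => H ξ * chr ξ z) x = H ξ * fracOp s (chr ξ) x := by
      unfold fracOp
      simp_rw [secondDiff_mul_chr, Complex.real_smul, mul_left_comm _ (H ξ), integral_const_mul]
      ring
    rw [this, fracOp_chr hn hs₀ hs₁]; ring
  · exact ((hHc.comp continuous_fst).mul continuous_chr).stronglyMeasurable
  · refine ((hH.norm.const_mul 4).add (hH2.const_mul ((2 * Real.pi) ^ 2))).congr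
      (Eventually.of_forall fun ξ => ?_)
    simp only [Pi.add_apply]; ring
  · exact integrable_mul_chr hH
  · refine Eventually.of_forall fun ξ h => ?_
    rw [secondDiff_mul_chr, norm_mul, mul_assoc]
    gcongr
    exact norm_secondDiff_chr_le ξ x h

end

/-! ### The low frequency part of the symbol on the half line -/

section

variable {n : ℕ}

/-- `∫₀¹ exp(-xσ) σ^{j-s} dσ`. -/
def lowInt (s : ℝ) (j : ℕ) (x : ℝ) : ℝ :=
  ∫ σ in Ioc (0 : ℝ) 1, Real.exp (-(x * σ)) * σ ^ ((j : ℝ) - s)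

lemma integrableOn_rpow_Ioc {s : ℝ} (hs₁ : s < 1) (j : ℕ) :
    IntegrableOn (fun σ : ℝ => σ ^ ((j : ℝ) - s)) (Ioc 0 1) := by
  rw [← intervalIntegrable_iff_integrableOn_Ioc_of_le zero_le_one]
  have : (0 : ℝ) ≤ j := j.cast_nonneg
  exact intervalIntegral.intervalIntegrable_rpow' (by linarith)

lemma neg_mul_le_of_mem_ball {x x₀ σ : ℝ} (hx : x ∈ Metric.ball x₀ 1) (hσ : σ ∈ Ioc (0 : ℝ) 1) :
    -(x * σ) ≤ |x₀| + 1 := by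
  have h1 : |x - x₀| < 1 := by simpa [Real.dist_eq] using hx
  have h2 : |x| ≤ |x₀| + 1 := by
    have := abs_add_le (x - x₀) x₀
    rw [sub_add_cancel] at this; linarith
  calc -(x * σ) ≤ |x * σ| := neg_le_abs _
    _ = |x| * σ := by rw [abs_mul, abs_of_pos hσ.1]
    _ ≤ |x| * 1 := by gcongr; exact hσ.2
    _ ≤ _ := by linarith

lemma hasDerivAt_lowInt {s : ℝ} (hs₁ : s < 1) (j : ℕ) (x₀ : ℝ) :
    HasDerivAt (lowInt s j) (-lowInt s (j + 1) x₀) x₀ := by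
  have hm : ∀ (i : ℕ) (x : ℝ), AEStronglyMeasurable
      (fun σ : ℝ => Real.exp (-(x * σ)) * σ ^ ((i : ℝ) - s)) (volume.restrict (Ioc 0 1)) :=
    fun i x => (by fun_prop : Measurable _).aestronglyMeasurable
  have key := hasDerivAt_integral_of_dominated_loc_of_deriv_le (μ := volume.restrict (Ioc (0 : ℝ) 1))
    (F := fun x σ => Real.exp (-(x * σ)) * σ ^ ((j : ℝ) - s))
    (F' := fun x σ => -(Real.exp (-(x * σ)) * σ ^ (((j + 1 : ℕ) : ℝ) - s))) (x₀ := x₀)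
    (bound := fun σ => Real.exp (|x₀| + 1) * σ ^ (((j + 1 : ℕ) : ℝ) - s))
    (Metric.ball_mem_nhds x₀ one_pos) (Eventually.of_forall fun x => hm j x) ?_ (hm (j + 1) x₀).neg ?_
    ((integrableOn_rpow_Ioc hs₁ (j + 1)).const_mul _) ?_
  · have := key.2
    rw [integral_neg] at this
    exact this
  · refine ((integrableOn_rpow_Ioc hs₁ j).const_mul (Real.exp (|x₀| + 1))).mono' (hm j x₀) ?_
    refine (ae_restrict_iff' measurableSet_Ioc).2 (Eventually.of_forall fun σ hσ => ?_)
    have := hσ.1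
    rw [Real.norm_of_nonneg (by positivity)]
    gcongr
    exact neg_mul_le_of_mem_ball (Metric.mem_ball_self one_pos) hσ
  · refine (ae_restrict_iff' measurableSet_Ioc).2 (Eventually.of_forall fun σ hσ x hx => ?_)
    have := hσ.1
    rw [norm_neg, Real.norm_of_nonneg (by positivity)]
    gcongr
    exact neg_mul_le_of_mem_ball hx hσ
  · refine (ae_restrict_iff' measurableSet_Ioc).2 (Eventually.of_forall fun σ hσ x hx => ?_)
    have h1 := ((hasDerivAt_id x).mul_const σ).neg.exp.mul_const (σ ^ ((j : ℝ) - s))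
    convert! h1 using 1
    simp only [id, Pi.neg_apply]
    rw [Nat.cast_add_one, show (j : ℝ) + 1 - s = (j - s) + 1 by ring, Real.rpow_add_one hσ.1.ne']
    ring

lemma abs_lowInt_le {s : ℝ} (hs₁ : s < 1) (j : ℕ) {x : ℝ} (hx : 0 ≤ x) :
    |lowInt s j x| ≤ ∫ σ in Ioc (0 : ℝ) 1, σ ^ ((j : ℝ) - s) := by
  rw [← Real.norm_eq_abs, lowInt]
  refine norm_integral_le_of_norm_le (integrableOn_rpow_Ioc hs₁ j)
    ((ae_restrict_iff' measurableSet_Ioc).2 (Eventually.of_forall fun σ hσ => ?_))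
  have := hσ.1
  rw [Real.norm_of_nonneg (by positivity)]
  exact mul_le_of_le_one_left (by positivity) (Real.exp_le_one_iff.2 (by simp; positivity))

/-- The constant in `x^s = C ∫₀^∞ (1 - exp(-xσ)) σ^{-1-s} dσ`. -/
def subConst (s : ℝ) : ℝ := s / Real.Gamma (1 - s)

/-- The part of `x^s = C ∫₀^∞ (1 - exp(-xσ)) σ^{-1-s} dσ` with `σ ≤ 1`. -/
def lowExp (s : ℝ) (x : ℝ) : ℝ :=
  subConst s * ∫ σ in Ioc (0 : ℝ) 1, (1 - Real.exp (-(x * σ))) * σ ^ (-1 - s)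

lemma subConst_pos {s : ℝ} (hs₀ : 0 < s) (hs₁ : s < 1) : 0 < subConst s := by
  have := Real.Gamma_pos_of_pos (show 0 < 1 - s by linarith)
  unfold subConst; positivity

lemma hasDerivAt_lowExp {s : ℝ} (hs₁ : s < 1) (x₀ : ℝ) :
    HasDerivAt (lowExp s) (subConst s * lowInt s 0 x₀) x₀ := by
  have hm : ∀ (x : ℝ), AEStronglyMeasurable
      (fun σ : ℝ => (1 - Real.exp (-(x * σ))) * σ ^ (-1 - s)) (volume.restrict (Ioc 0 1)) :=
    fun x => (by fun_prop : Measurable _).aestronglyMeasurable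
  have hm' : ∀ (i : ℕ) (x : ℝ), AEStronglyMeasurable
      (fun σ : ℝ => Real.exp (-(x * σ)) * σ ^ ((i : ℝ) - s)) (volume.restrict (Ioc 0 1)) :=
    fun i x => (by fun_prop : Measurable _).aestronglyMeasurable
  refine HasDerivAt.const_mul _ ?_
  have key := hasDerivAt_integral_of_dominated_loc_of_deriv_le (μ := volume.restrict (Ioc (0 : ℝ) 1))
    (F := fun x σ => (1 - Real.exp (-(x * σ))) * σ ^ (-1 - s))
    (F' := fun x σ => Real.exp (-(x * σ)) * σ ^ (((0 : ℕ) : ℝ) - s)) (x₀ := x₀)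
    (bound := fun σ => Real.exp (|x₀| + 1) * σ ^ (((0 : ℕ) : ℝ) - s))
    (Metric.ball_mem_nhds x₀ one_pos) (Eventually.of_forall fun x => hm x) ?_ (hm' 0 x₀) ?_
    ((integrableOn_rpow_Ioc hs₁ 0).const_mul _) ?_
  · exact key.2
  · refine ((integrableOn_rpow_Ioc hs₁ 0).const_mul (|x₀| * Real.exp |x₀|)).mono' (hm x₀) ?_
    refine (ae_restrict_iff' measurableSet_Ioc).2 (Eventually.of_forall fun σ hσ => ?_)
    have hσ0 := hσ.1
    have h1 : |1 - Real.exp (-(x₀ * σ))| ≤ |x₀| * Real.exp |x₀| * σ := by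
      have hle : |x₀ * σ| ≤ |x₀| := by
        rw [abs_mul, abs_of_pos hσ0]; exact mul_le_of_le_one_right (abs_nonneg _) hσ.2
      have h2 : |1 - Real.exp (-(x₀ * σ))| ≤ |x₀ * σ| * Real.exp |x₀ * σ| := by
        rcases le_total 0 (x₀ * σ) with h | h
        · rw [abs_of_nonneg (one_sub_exp_neg_nonneg h), abs_of_nonneg h]
          calc _ ≤ x₀ * σ := (one_sub_exp_neg_le _).trans (min_le_right _ _)
            _ ≤ _ := le_mul_of_one_le_right h (Real.one_le_exp h)
        · rw [abs_sub_comm, abs_of_nonneg (by linarith [Real.one_le_exp (show 0 ≤ -(x₀ * σ) by linarith)]),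
            abs_of_nonpos h]
          have := (one_sub_exp_neg_le (-(x₀ * σ))).trans (min_le_right _ _)
          have h3 := mul_le_mul_of_nonneg_right this (Real.exp_pos (-(x₀ * σ))).le
          rw [sub_mul, ← Real.exp_add] at h3
          simpa using h3
      calc _ ≤ _ := h2
        _ ≤ |x₀ * σ| * Real.exp |x₀| := by gcongr
        _ = _ := by rw [abs_mul, abs_of_pos hσ0]; ring
    rw [norm_mul, Real.norm_eq_abs, Real.norm_of_nonneg (by positivity)]
    calc _ ≤ |x₀| * Real.exp |x₀| * σ * σ ^ (-1 - s) := by gcongr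
      _ = _ := by
        rw [mul_assoc _ σ, mul_comm σ, ← Real.rpow_add_one hσ0.ne']; congr 2; push_cast; ring
  · refine (ae_restrict_iff' measurableSet_Ioc).2 (Eventually.of_forall fun σ hσ x hx => ?_)
    have := hσ.1
    rw [Real.norm_of_nonneg (by positivity)]
    gcongr
    exact neg_mul_le_of_mem_ball hx hσ
  · refine (ae_restrict_iff' measurableSet_Ioc).2 (Eventually.of_forall fun σ hσ x hx => ?_)
    have h1 := (((hasDerivAt_id x).mul_const σ).neg.exp.const_sub 1).mul_const (σ ^ (-1 - s))
    convert! h1 using 1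
    simp only [id, Pi.neg_apply]
    rw [show ((0 : ℕ) : ℝ) - s = (-1 - s) + 1 by push_cast; ring, Real.rpow_add_one hσ.1.ne']
    ring

/-- The algebra of functions generated by the `lowInt s j`. -/
inductive LowAlg (s : ℝ) : (ℝ → ℝ) → Prop
  | const (c : ℝ) : LowAlg s fun _ => c
  | low (j : ℕ) : LowAlg s (lowInt s j)
  | add {f g : ℝ → ℝ} : LowAlg s f → LowAlg s g → LowAlg s fun x => f x + g x
  | mul {f g : ℝ → ℝ} : LowAlg s f → LowAlg s g → LowAlg s fun x => f x * g x

lemma LowAlg.exists_deriv {s : ℝ} (hs₁ : s < 1) {f : ℝ → ℝ} (hf : LowAlg s f) :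
    ∃ f', LowAlg s f' ∧ ∀ x, HasDerivAt f (f' x) x := by
  induction hf with
  | const c => exact ⟨_, .const 0, fun x => hasDerivAt_const x c⟩
  | low j =>
    refine ⟨_, (LowAlg.const (-1)).mul (.low (j + 1)), fun x => ?_⟩
    simpa using hasDerivAt_lowInt hs₁ j x
  | add _ _ hf hg =>
    obtain ⟨f', hf', hf⟩ := hf
    obtain ⟨g', hg', hg⟩ := hg
    exact ⟨_, hf'.add hg', fun x => (hf x).add (hg x)⟩
  | mul h1 h2 hf hg =>
    obtain ⟨f', hf', hf⟩ := hf
    obtain ⟨g', hg', hg⟩ := hg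
    exact ⟨_, (hf'.mul h2).add (h1.mul hg'), fun x => (hf x).mul (hg x)⟩

lemma LowAlg.exists_bound {s : ℝ} (hs₁ : s < 1) {f : ℝ → ℝ} (hf : LowAlg s f) :
    ∃ C, ∀ x, 0 ≤ x → |f x| ≤ C := by
  induction hf with
  | const c => exact ⟨|c|, fun _ _ => le_rfl⟩
  | low j => exact ⟨_, fun x hx => abs_lowInt_le hs₁ j hx⟩
  | add _ _ hf hg =>
    obtain ⟨C, hC⟩ := hf
    obtain ⟨D, hD⟩ := hg
    exact ⟨C + D, fun x hx => (abs_add_le _ _).trans (add_le_add (hC x hx) (hD x hx))⟩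
  | mul h1 h2 hf hg =>
    obtain ⟨C, hC⟩ := hf
    obtain ⟨D, hD⟩ := hg
    refine ⟨C * D, fun x hx => ?_⟩
    rw [abs_mul]
    exact mul_le_mul (hC x hx) (hD x hx) (abs_nonneg _) ((abs_nonneg _).trans (hC x hx))

/-- The algebra is closed under differentiation, contains the derivative of `lowExp`, and consists
of functions bounded on [0,∞). Hence every derivative of exp(-lowExp) is at most a constant times
exp(-lowExp) itself there, and inherits its decay. -/
lemma exists_iteratedDeriv_exp_neg_lowExp {s : ℝ} (hs₁ : s < 1) (i : ℕ) :
    ∃ g, LowAlg s g ∧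
      iteratedDeriv i (fun x => Real.exp (-lowExp s x)) = fun x => g x * Real.exp (-lowExp s x) := by
  induction i with
  | zero => exact ⟨_, .const 1, by simp⟩
  | succ i ih =>
    obtain ⟨g, hg, hi⟩ := ih
    obtain ⟨g', hg', hd⟩ := hg.exists_deriv hs₁
    refine ⟨_, hg'.add (hg.mul ((LowAlg.const (-subConst s)).mul (.low 0))), ?_⟩
    rw [iteratedDeriv_succ, hi]
    ext x
    refine ((hd x).mul (hasDerivAt_lowExp hs₁ x).neg.exp).deriv.trans ?_
    simp only [Pi.neg_apply]
    ring

lemma contDiff_exp_neg_lowExp {s : ℝ} (hs₁ : s < 1) :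
    ContDiff ℝ ∞ (fun x => Real.exp (-lowExp s x)) := by
  refine contDiff_of_differentiable_iteratedDeriv fun m _ => ?_
  obtain ⟨g, hg, hi⟩ := exists_iteratedDeriv_exp_neg_lowExp hs₁ m
  obtain ⟨g', hg', hd⟩ := hg.exists_deriv hs₁
  rw [hi]
  exact fun x => ((hd x).mul (hasDerivAt_lowExp hs₁ x).neg.exp).differentiableAt

/-- Splitting of `x^s`. -/
lemma rpow_eq_lowExp_add {s x : ℝ} (hs₀ : 0 < s) (hs₁ : s < 1) (hx : 0 ≤ x) :
    x ^ s = lowExp s x + subConst s * (∫ σ in Ioi (1 : ℝ), σ ^ (-1 - s)) -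
      subConst s * ∫ σ in Ioi (1 : ℝ), Real.exp (-(x * σ)) * σ ^ (-1 - s) := by
  have hI := integrableOn_one_sub_exp_mul_rpow hs₀ hs₁ hx
  have h := integral_one_sub_exp_mul_rpow hs₀ hs₁ hx
  have h1 : IntegrableOn (fun y : ℝ => y ^ (-1 - s)) (Ioi 1) :=
    integrableOn_Ioi_rpow_of_lt (by linarith) one_pos
  rw [← Ioc_union_Ioi_eq_Ioi (zero_le_one' ℝ)] at h hI
  rw [setIntegral_union Ioc_disjoint_Ioi_same measurableSet_Ioi hI.left_of_union hI.right_of_union] at h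
  have h2 : ∫ σ in Ioi (1 : ℝ), (1 - Real.exp (-(x * σ))) * σ ^ (-1 - s) =
      (∫ σ in Ioi (1 : ℝ), σ ^ (-1 - s)) - ∫ σ in Ioi (1 : ℝ), Real.exp (-(x * σ)) * σ ^ (-1 - s) := by
    have h3 : IntegrableOn (fun σ : ℝ => Real.exp (-(x * σ)) * σ ^ (-1 - s)) (Ioi 1) := by
      refine (h1.sub hI.right_of_union).congr (Eventually.of_forall fun σ => ?_)
      simp only [Pi.sub_apply]; ring
    rw [← integral_sub h1 h3]
    congr 1; ext σ; ring
  have hG := (Real.Gamma_pos_of_pos (show 0 < 1 - s by linarith)).ne'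
  have h4 : x ^ s = subConst s * (x ^ s * Real.Gamma (1 - s) / s) := by
    unfold subConst; field_simp
  rw [h4, ← h, h2, lowExp]; ring

end

/-! ### Schwartz functions -/

section

variable {n : ℕ} {V : Type*} [NormedAddCommGroup V] [NormedSpace ℝ V]

lemma exists_one_add_pow_mul_exp_neg_rpow_le {s : ℝ} (hs₀ : 0 < s) (p : ℕ) :
    ∃ K, ∀ x : ℝ, 0 ≤ x → (1 + x) ^ p * Real.exp (-(x ^ (2 * s))) ≤ K := by
  -- With 2sN ≥ p, the N-th term of the series of exp(x^{2s}) already dominates x^p for x ≥ 1.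
  obtain ⟨N, hN⟩ := exists_nat_ge ((p : ℝ) / (2 * s))
  rw [div_le_iff₀ (by positivity)] at hN
  refine ⟨2 ^ p * N.factorial, fun x hx => ?_⟩
  have hfac : (1 : ℝ) ≤ N.factorial := by exact_mod_cast N.factorial_pos
  rcases le_total x 1 with h1 | h1
  · have : Real.exp (-(x ^ (2 * s))) ≤ 1 := Real.exp_le_one_iff.2 (by simp; positivity)
    calc _ ≤ ((1 : ℝ) + 1) ^ p * 1 := by gcongr
      _ = 2 ^ p * 1 := by norm_num
      _ ≤ 2 ^ p * (N.factorial : ℝ) := by gcongr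
  · have h0 : 0 < x := by linarith
    have h2 := Real.pow_div_factorial_le_exp (x ^ (2 * s)) (by positivity) N
    rw [div_le_iff₀ (by positivity)] at h2
    rw [Real.exp_neg, ← div_eq_mul_inv, div_le_iff₀ (Real.exp_pos _)]
    calc (1 + x) ^ p ≤ (2 * x) ^ p := by gcongr; linarith
      _ = 2 ^ p * x ^ (p : ℝ) := by rw [mul_pow, Real.rpow_natCast]
      _ ≤ 2 ^ p * x ^ (N * (2 * s)) := by gcongr
      _ = 2 ^ p * (x ^ (2 * s)) ^ N := by rw [mul_comm (N : ℝ), Real.rpow_mul hx, Real.rpow_natCast]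
      _ ≤ 2 ^ p * (Real.exp (x ^ (2 * s)) * N.factorial) := by gcongr
      _ = _ := by ring

/-- In the splitting of x^s the exponential integral over σ > 1 enters with a negative sign.
Dropping it shows that `lowExp` differs from x^s by at most a constant from below. -/
lemma lowSymbol_le {s x : ℝ} (hs₀ : 0 < s) (hs₁ : s < 1) (hx : 0 ≤ x) :
    Real.exp (-lowExp s x) ≤
      Real.exp (subConst s * ∫ σ in Ioi (1 : ℝ), σ ^ (-1 - s)) * Real.exp (-(x ^ s)) := by
  rw [← Real.exp_add, Real.exp_le_exp, rpow_eq_lowExp_add hs₀ hs₁ hx]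
  have : 0 ≤ subConst s * ∫ σ in Ioi (1 : ℝ), Real.exp (-(x * σ)) * σ ^ (-1 - s) :=
    mul_nonneg (subConst_pos hs₀ hs₁).le (setIntegral_nonneg measurableSet_Ioi fun σ hσ => by
      have : (0 : ℝ) < σ := one_pos.trans hσ
      positivity)
  linarith

lemma rpow_two_mul {s x : ℝ} (hx : 0 ≤ x) : x ^ (2 * s) = (x ^ 2) ^ s := by
  rw [Real.rpow_mul hx, Real.rpow_two]

lemma norm_rpow_le {s : ℝ} (hs₀ : 0 < s) (ξ : E n) : ‖ξ‖ ^ (2 * s) ≤ (2 * Real.pi * ‖ξ‖) ^ (2 * s) := by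
  have : 1 ≤ 2 * Real.pi := by linarith [Real.pi_gt_three]
  gcongr
  exact le_mul_of_one_le_left (norm_nonneg _) this

/-- The smooth factor of the symbol `exp(-(2π|ξ|)^{2s})`. -/
lemma exists_schwartz_lowSymbol {s : ℝ} (hs₀ : 0 < s) (hs₁ : s < 1) :
    ∃ Θ : 𝓢(E n, ℂ), ∀ ξ, Θ ξ = (Real.exp (-lowExp s ((2 * Real.pi * ‖ξ‖) ^ 2)) : ℂ) := by
  set θ : ℝ → ℝ := fun x => Real.exp (-lowExp s x) with hθ
  set N : E n → ℝ := fun ξ => (2 * Real.pi * ‖ξ‖) ^ 2 with hN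
  have hθc : ContDiff ℝ ∞ θ := contDiff_exp_neg_lowExp hs₁
  have hNt : N.HasTemperateGrowth := by
    have : N = fun ξ => (2 * Real.pi) ^ 2 * ‖ξ‖ ^ 2 := by ext ξ; simp only [hN]; ring
    rw [this]
    fun_prop
  have hNc : ContDiff ℝ ∞ N := hNt.1
  have hcomp : ContDiff ℝ ∞ (θ ∘ N) := hθc.comp hNc
  refine ⟨⟨fun ξ => ((θ (N ξ) : ℝ) : ℂ), Complex.ofRealCLM.contDiff.comp hcomp, fun k m => ?_⟩,
    fun ξ => rfl⟩
  obtain ⟨p, C₁, hC₁, hD⟩ := hNt.norm_iteratedFDeriv_le_uniform m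
  -- On [0,∞), where `N` takes its values, all derivatives of θ up to order m are bounded by a
  -- common multiple of θ.
  have hB : ∃ C, ∀ i ≤ m, ∀ x, 0 ≤ x → |iteratedDeriv i θ x| ≤ C * θ x := by
    choose g hg hgi using fun i => exists_iteratedDeriv_exp_neg_lowExp (s := s) hs₁ i
    choose C hC using fun i => (hg i).exists_bound hs₁
    refine ⟨∑ i ∈ Finset.range (m + 1), |C i|, fun i hi x hx => ?_⟩
    rw [hθ, hgi i, abs_mul, Real.abs_exp]
    gcongr
    exact (hC i x hx).trans ((le_abs_self _).trans (Finset.single_le_sum (f := fun i => |C i|)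
      (fun _ _ => abs_nonneg _) (Finset.mem_range.2 (by omega))))
  obtain ⟨C, hC⟩ := hB
  have hC0 : 0 ≤ C := by
    have := (abs_nonneg _).trans (hC 0 (Nat.zero_le _) 0 le_rfl)
    exact nonneg_of_mul_nonneg_left this (Real.exp_pos _)
  obtain ⟨K, hK⟩ := exists_one_add_pow_mul_exp_neg_rpow_le hs₀ (k + p * m)
  set A := Real.exp (subConst s * ∫ σ in Ioi (1 : ℝ), σ ^ (-1 - s))
  refine ⟨m.factorial * C * A * (C₁ + 1) ^ m * K, fun ξ => ?_⟩
  have e1 : ‖iteratedFDeriv ℝ m (fun ξ => ((θ (N ξ) : ℝ) : ℂ)) ξ‖ = ‖iteratedFDeriv ℝ m (θ ∘ N) ξ‖ :=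
    Complex.ofRealLI.norm_iteratedFDeriv_comp_left hcomp.contDiffAt (by exact_mod_cast le_top)
  rw [e1]
  have h2 := norm_iteratedFDeriv_comp_le hθc hNc (n := m) (by exact_mod_cast le_top) ξ
    (C := C * θ (N ξ)) (D := (C₁ + 1) * (1 + ‖ξ‖) ^ p)
    (fun i hi => by
      rw [norm_iteratedFDeriv_eq_norm_iteratedDeriv]
      exact hC i hi _ (by positivity))
    -- The composition estimate asks for the i-th power of a single base. Enlarging C₁ to C₁ + 1
    -- makes the base at least 1, so that it is below its i-th power for i ≥ 1.
    (fun i hi1 hi => by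
      have h1 : 1 ≤ (1 + ‖ξ‖) ^ p := one_le_pow₀ (by linarith [norm_nonneg ξ])
      calc _ ≤ C₁ * (1 + ‖ξ‖) ^ p := hD i hi ξ
        _ ≤ (C₁ + 1) * (1 + ‖ξ‖) ^ p := by gcongr; linarith
        _ ≤ _ := le_self_pow₀ (by nlinarith) (by omega))
  have h3 : θ (N ξ) ≤ A * Real.exp (-(‖ξ‖ ^ (2 * s))) := by
    refine (lowSymbol_le hs₀ hs₁ (by positivity)).trans ?_
    rw [← rpow_two_mul (by positivity)]
    gcongr ?_ * Real.exp (-?_)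
    exact norm_rpow_le hs₀ ξ
  calc _ ≤ (1 + ‖ξ‖) ^ k * (m.factorial * (C * (A * Real.exp (-(‖ξ‖ ^ (2 * s))))) *
        ((C₁ + 1) * (1 + ‖ξ‖) ^ p) ^ m) := by
        gcongr
        · linarith
        · refine h2.trans ?_
          gcongr
    _ = m.factorial * C * A * (C₁ + 1) ^ m * ((1 + ‖ξ‖) ^ (k + p * m) * Real.exp (-(‖ξ‖ ^ (2 * s)))) := by
        rw [pow_add, pow_mul, mul_pow]; ring
    _ ≤ _ := by gcongr; exact hK _ (norm_nonneg _)

/-- Second differences of Schwartz functions in `L¹`. -/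
lemma exists_integral_secondDiff_schwartz_le (ψ : 𝓢(E n, V)) :
    ∃ C, ∀ h : E n, ∫ y, ‖secondDiff ψ y h‖ ≤ C * min 1 (‖h‖ ^ (2 : ℝ)) := by
  set ψ' := SchwartzMap.fderivCLM ℝ (E n) V ψ with hψ'
  set ψ'' := SchwartzMap.fderivCLM ℝ (E n) (E n →L[ℝ] V) ψ' with hψ''
  obtain ⟨C, hC⟩ : ∃ C, ∀ x, (1 + ‖x‖) ^ (n + 1) * ‖ψ'' x‖ ≤ C := by
    refine ⟨2 ^ (n + 1) * (Finset.Iic (n + 1, 0)).sup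
      (fun m => SchwartzMap.seminorm ℝ m.1 m.2) ψ'', fun x => ?_⟩
    simpa using SchwartzMap.one_add_le_sup_seminorm_apply (𝕜 := ℝ) (m := (n + 1, 0)) le_rfl le_rfl ψ'' x
  have hC0 : 0 ≤ C := le_trans (by positivity) (hC 0)
  -- Within distance one the weights at y and z are comparable, 1 + |y| ≤ 2(1 + |z|), so decay at z
  -- becomes an integrable majorant in y.
  have hloc : ∀ y z : E n, ‖z - y‖ ≤ 1 → ‖ψ'' z‖ ≤ C * 2 ^ (n + 1) * ((1 + ‖y‖) ^ (n + 1))⁻¹ := by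
    intro y z hz
    have h1 : 1 + ‖y‖ ≤ 2 * (1 + ‖z‖) := by
      have := norm_sub_norm_le y z
      rw [norm_sub_rev] at this
      linarith [norm_nonneg z]
    rw [← div_eq_mul_inv, le_div_iff₀ (by positivity)]
    calc ‖ψ'' z‖ * (1 + ‖y‖) ^ (n + 1) ≤ ‖ψ'' z‖ * (2 * (1 + ‖z‖)) ^ (n + 1) := by gcongr
      _ = ((1 + ‖z‖) ^ (n + 1) * ‖ψ'' z‖) * 2 ^ (n + 1) := by rw [mul_pow]; ring
      _ ≤ _ := by gcongr; exact hC z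
  have hpt : ∀ y h : E n, ‖h‖ ≤ 1 →
      ‖secondDiff ψ y h‖ ≤ C * 2 ^ (n + 1) * ((1 + ‖y‖) ^ (n + 1))⁻¹ * ‖h‖ * ‖h‖ := by
    intro y h hh
    set S := C * 2 ^ (n + 1) * ((1 + ‖y‖) ^ (n + 1))⁻¹ with hS
    have hd1 : ∀ z, HasFDerivAt ψ (ψ' z) z := fun z => by
      rw [hψ', SchwartzMap.fderivCLM_apply]; exact ψ.differentiableAt.hasFDerivAt
    have hd2 : ∀ z, HasFDerivAt ψ' (ψ'' z) z := fun z => by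
      rw [hψ'', SchwartzMap.fderivCLM_apply]; exact ψ'.differentiableAt.hasFDerivAt
    have hball : ∀ z w, z ∈ Metric.closedBall y ‖h‖ → w ∈ Metric.closedBall y ‖h‖ →
        ‖ψ' w - ψ' z‖ ≤ S * ‖w - z‖ := fun z w hz hw =>
      (convex_closedBall y ‖h‖).norm_image_sub_le_of_norm_hasFDerivWithin_le
        (fun x _ => (hd2 x).hasFDerivWithinAt)
        (fun x hx => hloc y x ((mem_closedBall_iff_norm.1 hx).trans hh)) hz hw
    have hseg : ∀ t ∈ Icc (0 : ℝ) 1, y + t • h ∈ Metric.closedBall y ‖h‖ ∧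
        y + t • h - h ∈ Metric.closedBall y ‖h‖ := by
      intro t ht
      constructor
      · rw [mem_closedBall_iff_norm, add_sub_cancel_left, norm_smul, Real.norm_of_nonneg ht.1]
        exact mul_le_of_le_one_left (norm_nonneg _) ht.2
      · rw [mem_closedBall_iff_norm, show y + t • h - h - y = (t - 1) • h by rw [sub_smul, one_smul]; abel,
          norm_smul]
        refine mul_le_of_le_one_left (norm_nonneg _) ?_
        rw [Real.norm_eq_abs, abs_le]; constructor <;> linarith [ht.1, ht.2]
    -- The second difference is the increment over [0,1] of t ↦ ψ(y+th) - ψ(y+th-h). Its derivative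
    -- is a difference of first derivatives at distance |h|, applied to h, which gives the factor
    -- |h|².
    have hg : ∀ t ∈ Icc (0 : ℝ) 1, HasDerivWithinAt (fun t : ℝ => ψ (y + t • h) - ψ (y + t • h - h))
        ((ψ' (y + t • h) - ψ' (y + t • h - h)) h) (Icc 0 1) t := by
      intro t _
      have hl : HasDerivAt (fun t : ℝ => y + t • h) h t := by
        simpa using ((hasDerivAt_id t).smul_const h).const_add y
      exact (((hd1 _).comp_hasDerivAt t hl).sub
        ((hd1 _).comp_hasDerivAt t (hl.sub_const h))).hasDerivWithinAt
    have := norm_image_sub_le_of_norm_deriv_le_segment_01' hg (C := S * ‖h‖ * ‖h‖) (fun t ht => by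
      have ht' : t ∈ Icc (0 : ℝ) 1 := Ico_subset_Icc_self ht
      refine (ContinuousLinearMap.le_opNorm _ _).trans ?_
      gcongr
      refine (hball _ _ (hseg t ht').2 (hseg t ht').1).trans ?_
      rw [sub_sub_cancel])
    refine le_trans (le_of_eq ?_) this
    congr 1
    simp only [one_smul, zero_smul, add_zero, add_sub_cancel_right, secondDiff, two_smul]
    abel
  have hint : Integrable fun y : E n => ((1 + ‖y‖) ^ (n + 1))⁻¹ := by
    have := integrable_one_add_norm (E := E n) (μ := volume) (r := n + 1) (by simp)
    refine this.congr (Eventually.of_forall fun y => ?_)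
    beta_reduce
    rw [Real.rpow_neg (by positivity), ← Nat.cast_succ, Real.rpow_natCast]
  have hψi : Integrable ψ := ψ.integrable
  set I := ∫ y : E n, ((1 + ‖y‖) ^ (n + 1))⁻¹ with hI
  have hI0 : 0 ≤ I := integral_nonneg fun y => by positivity
  set L := ∫ y, ‖ψ y‖ with hL
  have hL0 : 0 ≤ L := integral_nonneg fun y => by positivity
  refine ⟨C * 2 ^ (n + 1) * I + 4 * L, fun h => ?_⟩
  rw [Real.rpow_two]
  rcases le_total ‖h‖ 1 with hh | hh
  · rw [min_eq_right (pow_le_one₀ (norm_nonneg _) hh)]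
    calc _ ≤ ∫ y : E n, C * 2 ^ (n + 1) * ‖h‖ ^ 2 * ((1 + ‖y‖) ^ (n + 1))⁻¹ := by
          refine integral_mono_of_nonneg (Eventually.of_forall fun _ => norm_nonneg _)
            (hint.const_mul _) (Eventually.of_forall fun y => ?_)
          refine (hpt y h hh).trans (le_of_eq ?_)
          ring
      _ = C * 2 ^ (n + 1) * I * ‖h‖ ^ 2 := by rw [integral_const_mul]; ring
      _ ≤ _ := by gcongr; linarith
  · rw [min_eq_left (one_le_pow₀ hh), mul_one]
    have i1 := (hψi.comp_add_right h).norm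
    have i2 := (hψi.comp_sub_right h).norm
    calc _ ≤ ∫ y : E n, (‖ψ (y + h)‖ + ‖ψ (y - h)‖ + 2 * ‖ψ y‖) := by
          refine integral_mono_of_nonneg (Eventually.of_forall fun _ => norm_nonneg _)
            ((i1.add i2).add (hψi.norm.const_mul 2)) (Eventually.of_forall fun y => ?_)
          unfold secondDiff
          refine (norm_sub_le _ _).trans (add_le_add (norm_add_le _ _) ?_)
          rw [norm_smul]; simp
      _ = 4 * L := by
          have e1 : ∫ y, ‖ψ (y + h)‖ = L := integral_add_right_eq_self (fun y => ‖ψ y‖) h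
          have e2 : ∫ y, ‖ψ (y - h)‖ = L := integral_sub_right_eq_self (fun y => ‖ψ y‖) h
          have e3 := integral_add (i1.add i2) (hψi.norm.const_mul 2)
          simp only [Pi.add_apply] at e3
          rw [e3, integral_add i1 i2, integral_const_mul, e1, e2]; ring
      _ ≤ _ := by
          exact le_add_of_nonneg_left (mul_nonneg (mul_nonneg hC0 (by positivity)) hI0)

end

/-! ### Wiener norms -/

section

variable {n : ℕ}

section Wiener

variable {Y : Type*} [MeasurableSpace Y] {μ : Measure Y}

/-- The Fourier transform of the image of `p μ` under `τ`. -/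
def charInt (μ : Measure Y) (p : Y → ℝ) (τ : Y → E n) (ξ : E n) : ℂ :=
  ∫ z, (p z : ℂ) * chr ξ (τ z) ∂μ

lemma measurable_chr_comp {τ : Y → E n} (hτ : Measurable τ) (ξ : E n) :
    Measurable fun z => chr ξ (τ z) :=
  (continuous_chr.comp (by fun_prop : Continuous fun x => (ξ, x))).measurable.comp hτ

lemma integrable_mul_chr_comp {p : Y → ℝ} {τ : Y → E n} (hτ : Measurable τ) (hp : Integrable p μ)
    (ξ : E n) : Integrable (fun z => (p z : ℂ) * chr ξ (τ z)) μ :=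
  hp.ofReal.mul_bdd (c := 1) (measurable_chr_comp hτ ξ).aestronglyMeasurable
    (Eventually.of_forall fun _ => (norm_chr _ _).le)

lemma continuous_charInt {p : Y → ℝ} {τ : Y → E n} (hτ : Measurable τ) (hp : Integrable p μ) :
    Continuous (charInt μ p τ) := by
  refine continuous_of_dominated (bound := fun z => ‖p z‖)
    (fun ξ => (integrable_mul_chr_comp hτ hp ξ).aestronglyMeasurable) ?_ hp.norm ?_
  · exact fun ξ => Eventually.of_forall fun z => by rw [norm_mul, norm_chr, mul_one, Complex.norm_real]
  · exact Eventually.of_forall fun z => continuous_const.mul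
      (continuous_chr.comp (by fun_prop : Continuous fun ξ => (ξ, τ z)))

lemma norm_charInt_le {p : Y → ℝ} {τ : Y → E n} (hp0 : ∀ z, 0 ≤ p z) (ξ : E n) :
    ‖charInt μ p τ ξ‖ ≤ ∫ z, p z ∂μ := by
  refine (norm_integral_le_integral_norm _).trans (le_of_eq ?_)
  congr 1; ext z
  rw [norm_mul, norm_chr, mul_one, Complex.norm_real, Real.norm_of_nonneg (hp0 z)]

lemma continuous_fourierInv {H : E n → ℂ} (hH : Integrable H) : Continuous (𝓕⁻ H) := by
  have e : 𝓕⁻ H = fun z => ∫ ξ, H ξ * chr ξ z := funext (fourierInv_eq_integral_chr H)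
  rw [e]
  refine continuous_of_dominated (bound := fun ξ => ‖H ξ‖)
    (fun x => (integrable_mul_chr hH x).aestronglyMeasurable) ?_ hH.norm ?_
  · exact fun ξ => Eventually.of_forall fun z => by rw [norm_mul, norm_chr, mul_one]
  · exact Eventually.of_forall fun z => continuous_const.mul
      (continuous_chr.comp (by fun_prop : Continuous fun ξ => (z, ξ)))

lemma integrable_charInt_mul {p : Y → ℝ} {τ : Y → E n} (hτ : Measurable τ) (hp : Integrable p μ)
    (hp0 : ∀ z, 0 ≤ p z) {H : E n → ℂ} (hH : Integrable H) :
    Integrable fun ξ => charInt μ p τ ξ * H ξ :=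
  hH.bdd_mul (continuous_charInt hτ hp).aestronglyMeasurable
    (Eventually.of_forall (norm_charInt_le hp0))

/-- Multiplication by the Fourier transform of a measure becomes an average of translates, by Fubini
and multiplicativity of the characters. -/
lemma fourierInv_charInt_mul [SFinite μ] {p : Y → ℝ} {τ : Y → E n} (hτ : Measurable τ)
    (hp : Integrable p μ) {H : E n → ℂ} (hH : Integrable H) (x : E n) :
    𝓕⁻ (fun ξ => charInt μ p τ ξ * H ξ) x = ∫ z, (p z : ℂ) * 𝓕⁻ H (x + τ z) ∂μ := by
  simp_rw [fourierInv_eq_integral_chr, charInt, ← integral_mul_const, ← integral_const_mul]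
  rw [integral_integral_swap]
  · congr 1; ext z; congr 1; ext ξ; rw [chr_add]; ring
  · have h1 : Integrable (fun z : E n × Y => H z.1 * (p z.2 : ℂ)) (volume.prod μ) :=
      hH.mul_prod hp.ofReal
    have hc1 : Measurable fun z : E n × Y => chr z.1 (τ z.2) :=
      continuous_chr.measurable.comp (f := fun z : E n × Y => (z.1, τ z.2)) (by fun_prop)
    have hc2 : Measurable fun z : E n × Y => chr z.1 x :=
      continuous_chr.measurable.comp (f := fun z : E n × Y => (z.1, x)) (by fun_prop)
    have h2 := h1.mul_bdd (c := 1) (g := fun z : E n × Y => chr z.1 (τ z.2) * chr z.1 x)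
      (hc1.mul hc2).aestronglyMeasurable ?_
    · refine h2.congr (Eventually.of_forall fun z => ?_)
      simp only [Function.uncurry]; ring
    · exact Eventually.of_forall fun z => by rw [norm_mul, norm_chr, norm_chr, mul_one]

/-- Each translate has the same L¹ norm, so the average costs only the total mass. Integrals in
[0,∞] make integrability of `𝓕⁻ H` unnecessary at this stage. -/
lemma lintegral_fourierInv_charInt_mul_le [SFinite μ] {p : Y → ℝ} {τ : Y → E n} (hτ : Measurable τ)
    (hp : Integrable p μ) (hp0 : ∀ z, 0 ≤ p z) {H : E n → ℂ} (hH : Integrable H) :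
    ∫⁻ x, ‖𝓕⁻ (fun ξ => charInt μ p τ ξ * H ξ) x‖ₑ ≤
      ENNReal.ofReal (∫ z, p z ∂μ) * ∫⁻ x, ‖𝓕⁻ H x‖ₑ := by
  have hc := continuous_fourierInv hH
  calc _ ≤ ∫⁻ x, ∫⁻ z, ENNReal.ofReal (p z) * ‖𝓕⁻ H (x + τ z)‖ₑ ∂μ := by
        refine lintegral_mono fun x => ?_
        rw [fourierInv_charInt_mul hτ hp hH]
        refine (enorm_integral_le_lintegral_enorm _).trans (le_of_eq ?_)
        congr 1; ext z
        rw [enorm_mul, ← ofReal_norm (p z : ℂ), Complex.norm_real, Real.norm_of_nonneg (hp0 z)]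
    _ = ∫⁻ z, (∫⁻ x, ENNReal.ofReal (p z) * ‖𝓕⁻ H (x + τ z)‖ₑ) ∂μ := by
        rw [lintegral_lintegral_swap]
        have h1 : AEMeasurable (fun w : E n × Y => ENNReal.ofReal (p w.2)) (volume.prod μ) :=
          (hp.aemeasurable.ennreal_ofReal).comp_snd
        have h2 : Measurable fun w : E n × Y => ‖𝓕⁻ H (w.1 + τ w.2)‖ₑ :=
          (hc.measurable.comp (measurable_fst.add (hτ.comp measurable_snd))).enorm
        exact h1.mul h2.aemeasurable
    _ = ∫⁻ z, ENNReal.ofReal (p z) * (∫⁻ x, ‖𝓕⁻ H x‖ₑ) ∂μ := by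
        congr 1; ext z
        rw [lintegral_const_mul' _ _ ENNReal.ofReal_ne_top,
          lintegral_add_right_eq_self (fun x => ‖𝓕⁻ H x‖ₑ)]
    _ = _ := by
        rw [lintegral_mul_const'' _ hp.aemeasurable.ennreal_ofReal,
          ofReal_integral_eq_lintegral_ofReal hp (Eventually.of_forall hp0)]

lemma lintegral_fourierInv_charInt_pow_mul_le [SFinite μ] {p : Y → ℝ} {τ : Y → E n}
    (hτ : Measurable τ) (hp : Integrable p μ) (hp0 : ∀ z, 0 ≤ p z) {H : E n → ℂ}
    (hH : Integrable H) (j : ℕ) :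
    Integrable (fun ξ => charInt μ p τ ξ ^ j * H ξ) ∧
    ∫⁻ x, ‖𝓕⁻ (fun ξ => charInt μ p τ ξ ^ j * H ξ) x‖ₑ ≤
      ENNReal.ofReal ((∫ z, p z ∂μ) ^ j) * ∫⁻ x, ‖𝓕⁻ H x‖ₑ := by
  induction j with
  | zero => simpa using hH
  | succ j ih =>
    have e : (fun ξ => charInt μ p τ ξ ^ (j + 1) * H ξ) =
        fun ξ => charInt μ p τ ξ * (charInt μ p τ ξ ^ j * H ξ) := by ext ξ; ring
    rw [e]
    refine ⟨integrable_charInt_mul hτ hp hp0 ih.1,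
      (lintegral_fourierInv_charInt_mul_le hτ hp hp0 ih.1).trans ?_⟩
    have h0 : 0 ≤ ∫ z, p z ∂μ := integral_nonneg hp0
    rw [pow_succ', ENNReal.ofReal_mul h0, mul_assoc]
    gcongr
    exact ih.2

/-- Expand the exponential: the j-th power of the transform costs m^j, where m is the total mass,
and the series of m^j/j! sums to e^m. This is the Banach algebra bound for exponentials of measures
under convolution. -/
lemma lintegral_fourierInv_exp_charInt_mul_le [SFinite μ] {p : Y → ℝ} {τ : Y → E n}
    (hτ : Measurable τ) (hp : Integrable p μ) (hp0 : ∀ z, 0 ≤ p z) {H : E n → ℂ}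
    (hH : Integrable H) :
    ∫⁻ x, ‖𝓕⁻ (fun ξ => Complex.exp (charInt μ p τ ξ) * H ξ) x‖ₑ ≤
      ENNReal.ofReal (Real.exp (∫ z, p z ∂μ)) * ∫⁻ x, ‖𝓕⁻ H x‖ₑ := by
  set m := ∫ z, p z ∂μ with hm
  have h0 : 0 ≤ m := integral_nonneg hp0
  set G : ℕ → E n → ℂ := fun j ξ => charInt μ p τ ξ ^ j * H ξ with hG
  have hGj := lintegral_fourierInv_charInt_pow_mul_le hτ hp hp0 hH
  have hsum : ∀ x, 𝓕⁻ (fun ξ => Complex.exp (charInt μ p τ ξ) * H ξ) x =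
      ∑' j : ℕ, ((j.factorial : ℝ)⁻¹ : ℂ) * 𝓕⁻ (G j) x := by
    intro x
    have hs := hasSum_integral_of_summable_integral_norm (μ := volume)
      (F := fun (j : ℕ) (ξ : E n) => ((j.factorial : ℝ)⁻¹ : ℂ) * (G j ξ * chr ξ x)) ?_ ?_
    · rw [fourierInv_eq_integral_chr]
      simp_rw [fourierInv_eq_integral_chr, ← integral_const_mul]
      rw [hs.tsum_eq]
      congr 1; ext ξ
      have := (NormedSpace.expSeries_div_hasSum_exp (charInt μ p τ ξ)).mul_right (H ξ * chr ξ x)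
      rw [← Complex.exp_eq_exp_ℂ] at this
      rw [mul_assoc, ← this.tsum_eq]
      congr 1; ext j
      simp only [hG]; push_cast; ring
    · exact fun j => (integrable_mul_chr (hGj j).1 x).const_mul _
    · refine Summable.of_nonneg_of_le (fun j => integral_nonneg fun _ => norm_nonneg _) (fun j => ?_)
        ((Real.summable_pow_div_factorial m).mul_right (∫ ξ, ‖H ξ‖))
      rw [← integral_const_mul]
      refine integral_mono_of_nonneg (Eventually.of_forall fun _ => norm_nonneg _)
        (hH.norm.const_mul _) (Eventually.of_forall fun ξ => ?_)
      simp only [hG, norm_mul, norm_pow, norm_chr, mul_one, norm_inv, Complex.norm_real]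
      rw [← mul_assoc, div_eq_inv_mul]
      rw [Real.norm_natCast]
      gcongr
      exact norm_charInt_le hp0 ξ
  calc _ ≤ ∫⁻ x, ∑' j : ℕ, ENNReal.ofReal (j.factorial : ℝ)⁻¹ * ‖𝓕⁻ (G j) x‖ₑ := by
        refine lintegral_mono fun x => ?_
        rw [hsum x]
        refine enorm_tsum_le_tsum_enorm.trans (le_of_eq ?_)
        congr 1; ext j
        rw [enorm_mul, ← ofReal_norm ((j.factorial : ℝ)⁻¹ : ℂ)]
        simp
    _ = ∑' j : ℕ, ENNReal.ofReal (j.factorial : ℝ)⁻¹ * ∫⁻ x, ‖𝓕⁻ (G j) x‖ₑ := by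
        rw [lintegral_tsum]
        · congr 1; ext j; rw [lintegral_const_mul' _ _ ENNReal.ofReal_ne_top]
        · intro j
          exact ((continuous_fourierInv (hGj j).1).measurable.enorm.const_mul _).aemeasurable
    _ ≤ ∑' j : ℕ, ENNReal.ofReal (m ^ j / j.factorial) * ∫⁻ x, ‖𝓕⁻ H x‖ₑ := by
        refine ENNReal.tsum_le_tsum fun j => ?_
        calc _ ≤ ENNReal.ofReal (j.factorial : ℝ)⁻¹ * (ENNReal.ofReal (m ^ j) * ∫⁻ x, ‖𝓕⁻ H x‖ₑ) := by
              gcongr; exact (hGj j).2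
          _ = _ := by
              rw [← mul_assoc, ← ENNReal.ofReal_mul (by positivity), div_eq_inv_mul]
    _ = _ := by
        rw [ENNReal.tsum_mul_right, ← ENNReal.ofReal_tsum_of_nonneg (fun j => by positivity)
          (Real.summable_pow_div_factorial m), Real.exp_eq_exp_ℝ, NormedSpace.exp_eq_tsum_div]

end Wiener

/-- The heat kernel `(4πσ)^{-n/2} exp(-|y|²/(4σ))`, weighted by `C σ^{-1-s}`. -/
def gaussDens (s : ℝ) (z : ℝ × E n) : ℝ :=
  subConst s * z.1 ^ (-1 - s) * ((4 * Real.pi * z.1) ^ (-((n : ℝ) / 2)) * Real.exp (-(4 * z.1)⁻¹ * ‖z.2‖ ^ 2))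

lemma integral_gauss {σ : ℝ} (hσ : 0 < σ) (ξ : E n) :
    ∫ y : E n, (((4 * Real.pi * σ) ^ (-((n : ℝ) / 2)) * Real.exp (-(4 * σ)⁻¹ * ‖y‖ ^ 2) : ℝ) : ℂ) * chr ξ y =
      (Real.exp (-((2 * Real.pi * ‖ξ‖) ^ 2 * σ)) : ℂ) := by
  have h := integral_exp_neg_mul_sq_mul_chr (r := (4 * σ)⁻¹) (by positivity) ξ
  have e : Real.pi / (4 * σ)⁻¹ = 4 * Real.pi * σ := by rw [div_inv_eq_mul]; ring
  rw [e] at h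
  simp_rw [Complex.ofReal_mul, mul_assoc] at h ⊢
  rw [integral_const_mul, h, ← mul_assoc, ← Complex.ofReal_mul, ← Real.rpow_add (by positivity)]
  rw [neg_add_cancel, Real.rpow_zero, Complex.ofReal_one, one_mul]
  congr 3
  rw [div_inv_eq_mul]; ring

lemma integrable_gaussDens {s : ℝ} (hs₀ : 0 < s) (hs₁ : s < 1) :
    Integrable (gaussDens s : ℝ × E n → ℝ) ((volume.restrict (Ioi 1)).prod volume) := by
  have hm : Measurable (gaussDens s : ℝ × E n → ℝ) := by unfold gaussDens; fun_prop
  have hC := subConst_pos hs₀ hs₁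
  rw [integrable_prod_iff hm.aestronglyMeasurable]
  constructor
  · refine (ae_restrict_iff' measurableSet_Ioi).2 (Eventually.of_forall fun σ hσ => ?_)
    have hσ : (0 : ℝ) < σ := one_pos.trans hσ
    unfold gaussDens
    exact ((integrable_exp_neg_mul_sq (n := n) (r := (4 * σ)⁻¹) (by positivity)).const_mul
      ((4 * Real.pi * σ) ^ (-((n : ℝ) / 2)))).const_mul (subConst s * σ ^ (-1 - s))
  · refine ((integrableOn_Ioi_rpow_of_lt (a := -1 - s) (by linarith) one_pos).const_mul
      (subConst s)).congr ((ae_restrict_iff' measurableSet_Ioi).2 (Eventually.of_forall fun σ hσ => ?_))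
    have hσ : (0 : ℝ) < σ := one_pos.trans hσ
    have h := congrArg Complex.re (integral_gauss hσ (0 : E n))
    simp only [chr, inner_zero_left, mul_zero, Complex.ofReal_zero, zero_mul, Complex.exp_zero, mul_one,
      integral_complex_ofReal, norm_zero, zero_pow two_ne_zero, neg_zero, Real.exp_zero,
      Complex.ofReal_re] at h
    have e : ∀ y : E n, ‖gaussDens s (σ, y)‖ = subConst s * σ ^ (-1 - s) *
        ((4 * Real.pi * σ) ^ (-((n : ℝ) / 2)) * Real.exp (-(4 * σ)⁻¹ * ‖y‖ ^ 2)) := fun y => by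
      rw [gaussDens, Real.norm_of_nonneg (by positivity)]
    simp_rw [e]
    rw [integral_const_mul, h, mul_one]

/-- This identifies the tail σ > 1 in the splitting of x^s, at x = (2π|ξ|)², as the transform of a
finite positive measure: heat kernels integrated against σ^{-1-s}dσ. -/
lemma charInt_gaussDens {s : ℝ} (hs₀ : 0 < s) (hs₁ : s < 1) (ξ : E n) :
    charInt ((volume.restrict (Ioi 1)).prod volume) (gaussDens s) Prod.snd ξ =
      ((subConst s * ∫ σ in Ioi (1 : ℝ), Real.exp (-((2 * Real.pi * ‖ξ‖) ^ 2 * σ)) * σ ^ (-1 - s) : ℝ) : ℂ) := by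
  unfold charInt
  rw [integral_prod _ (integrable_mul_chr_comp measurable_snd (integrable_gaussDens hs₀ hs₁) ξ),
    ← integral_const_mul, ← integral_complex_ofReal]
  refine setIntegral_congr_fun measurableSet_Ioi fun σ hσ => ?_
  have hσ : (0 : ℝ) < σ := one_pos.trans hσ
  simp only [gaussDens]
  have := integral_gauss hσ ξ
  simp_rw [Complex.ofReal_mul _ (_ * _), mul_assoc] at this ⊢
  rw [integral_const_mul, this]
  push_cast; ring

end

/-! ### The heat kernel of the fractional Laplacian -/

section

variable {n : ℕ}

/-- The symbol `exp(-t(2π|ξ|)^{2s})`. -/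
def symb (s t : ℝ) (ξ : E n) : ℝ := Real.exp (-(t * (2 * Real.pi * ‖ξ‖) ^ (2 * s)))

/-- The kernel of `exp(-t(-Δ)^s)`. -/
def hk (s t : ℝ) (x : E n) : ℝ := ∫ ξ, symb s t ξ * Real.cos (2 * Real.pi * inner ℝ ξ x)

/-- The kernel of `(-Δ)^s exp(-t(-Δ)^s)`. -/
def hka (s t : ℝ) (x : E n) : ℝ :=
  ∫ ξ, (2 * Real.pi * ‖ξ‖) ^ (2 * s) * symb s t ξ * Real.cos (2 * Real.pi * inner ℝ ξ x)

lemma symb_pos (s t : ℝ) (ξ : E n) : 0 < symb s t ξ := Real.exp_pos _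

lemma continuous_norm_rpow {s : ℝ} (hs₀ : 0 < s) :
    Continuous fun ξ : E n => (2 * Real.pi * ‖ξ‖) ^ (2 * s) :=
  Continuous.rpow_const (by fun_prop) fun _ => Or.inr (by positivity)

lemma continuous_symb {s : ℝ} (hs₀ : 0 < s) (t : ℝ) : Continuous (symb s t : E n → ℝ) := by
  unfold symb
  exact Real.continuous_exp.comp (continuous_const.mul (continuous_norm_rpow hs₀)).neg

lemma norm_smul_rpow_scale {s t : ℝ} (hs₀ : 0 < s) (ht : 0 < t) (ξ : E n) :
    (2 * Real.pi * ‖t ^ (1 / (2 * s)) • ξ‖) ^ (2 * s) = t * (2 * Real.pi * ‖ξ‖) ^ (2 * s) := by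
  rw [norm_smul, Real.norm_of_nonneg (by positivity), mul_left_comm,
    Real.mul_rpow (by positivity) (by positivity), ← Real.rpow_mul ht.le,
    one_div_mul_cancel (by positivity), Real.rpow_one]

lemma symb_scale {s t : ℝ} (hs₀ : 0 < s) (ht : 0 < t) (ξ : E n) :
    symb s t ξ = symb s 1 (t ^ (1 / (2 * s)) • ξ) := by
  unfold symb
  rw [one_mul, norm_smul_rpow_scale hs₀ ht]

lemma integrable_pow_mul_symb_one {s : ℝ} (hs₀ : 0 < s) (p : ℕ) :
    Integrable fun ξ : E n => ‖ξ‖ ^ p * symb s 1 ξ := by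
  obtain ⟨K, hK⟩ := exists_one_add_pow_mul_exp_neg_rpow_le hs₀ (p + (n + 1))
  have := (integrable_one_add_norm (E := E n) (μ := volume) (r := n + 1) (by simp)).const_mul K
  refine this.mono' (by have := continuous_symb (n := n) hs₀ 1; fun_prop)
    (Eventually.of_forall fun ξ => ?_)
  rw [Real.norm_of_nonneg (mul_nonneg (by positivity) (symb_pos _ _ _).le),
    Real.rpow_neg (by positivity), ← Nat.cast_succ, Real.rpow_natCast, ← div_eq_mul_inv,
    le_div_iff₀ (by positivity)]
  refine le_trans ?_ (hK ‖ξ‖ (norm_nonneg _))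
  have h1 : symb s 1 ξ ≤ Real.exp (-(‖ξ‖ ^ (2 * s))) := by
    unfold symb
    rw [one_mul]
    exact Real.exp_le_exp.2 (neg_le_neg (norm_rpow_le hs₀ ξ))
  calc _ ≤ (1 + ‖ξ‖) ^ p * Real.exp (-(‖ξ‖ ^ (2 * s))) * (1 + ‖ξ‖) ^ (n + 1) := by
        have := (symb_pos s 1 ξ).le
        gcongr
        linarith
    _ = _ := by rw [pow_add]; ring

lemma integrable_pow_mul_symb {s t : ℝ} (hs₀ : 0 < s) (ht : 0 < t) (p : ℕ) :
    Integrable fun ξ : E n => ‖ξ‖ ^ p * symb s t ξ := by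
  set c := t ^ (1 / (2 * s)) with hc
  have hc0 : 0 < c := by positivity
  have h := ((integrable_pow_mul_symb_one (n := n) hs₀ p).comp_smul hc0.ne').const_mul (c ^ p)⁻¹
  refine h.congr (Eventually.of_forall fun ξ => ?_)
  beta_reduce
  rw [symb_scale hs₀ ht, ← hc, norm_smul, Real.norm_of_nonneg hc0.le, mul_pow]
  field_simp

lemma integrable_symb {s t : ℝ} (hs₀ : 0 < s) (ht : 0 < t) : Integrable (symb s t : E n → ℝ) := by
  simpa using integrable_pow_mul_symb (n := n) hs₀ ht 0

lemma norm_rpow_le_one_add_sq {s : ℝ} (hs₀ : 0 < s) (hs₁ : s < 1) (ξ : E n) :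
    (2 * Real.pi * ‖ξ‖) ^ (2 * s) ≤ 1 + (2 * Real.pi) ^ 2 * ‖ξ‖ ^ 2 := by
  rw [← mul_pow]
  set a := 2 * Real.pi * ‖ξ‖
  have ha : 0 ≤ a := by positivity
  rcases le_total a 1 with h | h
  · have := Real.rpow_le_one ha h (show 0 ≤ 2 * s by positivity)
    nlinarith
  · have := Real.rpow_le_rpow_of_exponent_le h (show 2 * s ≤ 2 by linarith)
    rw [Real.rpow_two] at this
    linarith

lemma integrable_rpow_mul_symb {s t : ℝ} (hs₀ : 0 < s) (hs₁ : s < 1) (ht : 0 < t) :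
    Integrable fun ξ : E n => (2 * Real.pi * ‖ξ‖) ^ (2 * s) * symb s t ξ := by
  have h := (integrable_symb (n := n) hs₀ ht).add
    ((integrable_pow_mul_symb (n := n) hs₀ ht 2).const_mul ((2 * Real.pi) ^ 2))
  refine h.mono' ((continuous_norm_rpow hs₀).mul (continuous_symb hs₀ t)).aestronglyMeasurable
    (Eventually.of_forall fun ξ => ?_)
  rw [Real.norm_of_nonneg (mul_nonneg (by positivity) (symb_pos _ _ _).le)]
  refine (mul_le_mul_of_nonneg_right (norm_rpow_le_one_add_sq hs₀ hs₁ ξ) (symb_pos _ _ _).le).trans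
    (le_of_eq ?_)
  simp only [Pi.add_apply]; ring

/-- The sine part of the integrand is odd and integrates to zero, so the inverse transform is real.
-/
lemma fourierInv_of_even {H : E n → ℝ} (hH : Integrable H) (he : ∀ ξ, H (-ξ) = H ξ) (x : E n) :
    𝓕⁻ (fun ξ => (H ξ : ℂ)) x = ((∫ ξ, H ξ * Real.cos (2 * Real.pi * inner ℝ ξ x) : ℝ) : ℂ) := by
  have hI : Integrable fun ξ : E n => (H ξ : ℂ) * chr ξ x := integrable_mul_chr hH.ofReal x
  rw [fourierInv_eq_integral_chr]
  apply Complex.ext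
  · rw [Complex.ofReal_re, ← RCLike.re_eq_complex_re, ← integral_re hI]
    congr 1; ext ξ
    rw [RCLike.re_eq_complex_re, Complex.re_ofReal_mul, chr_re]
  · rw [Complex.ofReal_im, ← RCLike.im_eq_complex_im, ← integral_im hI]
    have e : ∀ ξ, RCLike.im ((H ξ : ℂ) * chr ξ x) = H ξ * Real.sin (2 * Real.pi * inner ℝ ξ x) := fun ξ => by
      rw [RCLike.im_eq_complex_im, Complex.im_ofReal_mul, chr, Complex.exp_ofReal_mul_I_im]
    simp_rw [e]
    have h := integral_neg_eq_self (fun ξ => H ξ * Real.sin (2 * Real.pi * inner ℝ ξ x)) volume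
    simp only [he, inner_neg_left, mul_neg, Real.sin_neg, integral_neg] at h
    linarith

lemma fourierInv_symb {s t : ℝ} (hs₀ : 0 < s) (ht : 0 < t) :
    𝓕⁻ (fun ξ : E n => (symb s t ξ : ℂ)) = fun x => (hk s t x : ℂ) := by
  ext x; exact fourierInv_of_even (integrable_symb hs₀ ht) (fun ξ => by simp [symb]) x

lemma fourierInv_rpow_mul_symb {s t : ℝ} (hs₀ : 0 < s) (hs₁ : s < 1) (ht : 0 < t) :
    𝓕⁻ (fun ξ : E n => (((2 * Real.pi * ‖ξ‖) ^ (2 * s) * symb s t ξ : ℝ) : ℂ)) =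
      fun x => (hka s t x : ℂ) := by
  ext x
  exact fourierInv_of_even (integrable_rpow_mul_symb hs₀ hs₁ ht) (fun ξ => by simp [symb]) x

lemma continuous_hk {s t : ℝ} (hs₀ : 0 < s) (ht : 0 < t) : Continuous (hk s t : E n → ℝ) := by
  have := continuous_fourierInv (H := fun ξ : E n => (symb s t ξ : ℂ)) (integrable_symb hs₀ ht).ofReal
  rw [fourierInv_symb hs₀ ht] at this
  exact (Complex.continuous_re.comp this)

lemma continuous_hka {s t : ℝ} (hs₀ : 0 < s) (hs₁ : s < 1) (ht : 0 < t) :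
    Continuous (hka s t : E n → ℝ) := by
  have := continuous_fourierInv
    (H := fun ξ : E n => (((2 * Real.pi * ‖ξ‖) ^ (2 * s) * symb s t ξ : ℝ) : ℂ))
    (integrable_rpow_mul_symb hs₀ hs₁ ht).ofReal
  rw [fourierInv_rpow_mul_symb hs₀ hs₁ ht] at this
  exact (Complex.continuous_re.comp this)

lemma fracOp_hk (hn : 0 < n) {s t : ℝ} (hs₀ : 0 < s) (hs₁ : s < 1) (ht : 0 < t) (x : E n) :
    fracOp s (hk s t) x = hka s t x := by
  have h := fracOp_fourierInv hn hs₀ hs₁ (H := fun ξ : E n => (symb s t ξ : ℂ))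
    (Complex.continuous_ofReal.comp (continuous_symb hs₀ t)) (integrable_symb hs₀ ht).ofReal
    (by simpa [abs_of_pos (symb_pos s t _)] using integrable_pow_mul_symb (n := n) hs₀ ht 2) x
  simp_rw [← Complex.ofReal_mul] at h
  rw [fourierInv_symb hs₀ ht, fourierInv_rpow_mul_symb hs₀ hs₁ ht, fracOp_ofReal] at h
  exact Complex.ofReal_injective h

lemma cos_integral_scale {c : ℝ} (hc : 0 < c) (H : E n → ℝ) (x : E n) :
    ∫ ξ : E n, H (c • ξ) * Real.cos (2 * Real.pi * inner ℝ ξ x) =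
      (c ^ n)⁻¹ * ∫ ξ, H ξ * Real.cos (2 * Real.pi * inner ℝ ξ (c⁻¹ • x)) := by
  have h := Measure.integral_comp_smul_of_nonneg volume
    (fun ξ : E n => H ξ * Real.cos (2 * Real.pi * inner ℝ ξ (c⁻¹ • x))) c (hR := hc.le)
  rw [finrank_euclideanSpace_fin, smul_eq_mul] at h
  rw [← h]
  congr 1; ext ξ
  rw [real_inner_smul_left, real_inner_smul_right, ← mul_assoc c, mul_inv_cancel₀ hc.ne', one_mul]

lemma hk_scale {s t : ℝ} (hs₀ : 0 < s) (ht : 0 < t) (x : E n) :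
    hk s t x = ((t ^ (1 / (2 * s))) ^ n)⁻¹ * hk s 1 ((t ^ (1 / (2 * s)))⁻¹ • x) := by
  unfold hk
  rw [← cos_integral_scale (by positivity)]
  simp_rw [← symb_scale hs₀ ht]

lemma hka_scale {s t : ℝ} (hs₀ : 0 < s) (ht : 0 < t) (x : E n) :
    hka s t x = t⁻¹ * (((t ^ (1 / (2 * s))) ^ n)⁻¹ * hka s 1 ((t ^ (1 / (2 * s)))⁻¹ • x)) := by
  unfold hka
  rw [← cos_integral_scale (by positivity)
    (fun ξ : E n => (2 * Real.pi * ‖ξ‖) ^ (2 * s) * symb s 1 ξ), ← integral_const_mul]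
  congr 1; ext ξ
  rw [← symb_scale hs₀ ht, norm_smul_rpow_scale hs₀ ht]
  field_simp

lemma hasDerivAt_hk {s t : ℝ} (hs₀ : 0 < s) (hs₁ : s < 1) (ht : 0 < t) (x : E n) :
    HasDerivAt (fun t => hk s t x) (-hka s t x) t := by
  have hcos : Continuous fun ξ : E n => Real.cos (2 * Real.pi * inner ℝ ξ x) := by fun_prop
  have hm : ∀ t, AEStronglyMeasurable (fun ξ : E n => symb s t ξ * Real.cos (2 * Real.pi * inner ℝ ξ x))
      volume := fun t => ((continuous_symb hs₀ t).mul hcos).aestronglyMeasurable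
  -- The symbol decreases in time, so on (t/2, ∞) the time derivatives of the integrand are
  -- dominated by the integrable value at t/2.
  have key := hasDerivAt_integral_of_dominated_loc_of_deriv_le (μ := (volume : Measure (E n)))
    (F := fun t ξ => symb s t ξ * Real.cos (2 * Real.pi * inner ℝ ξ x))
    (F' := fun t ξ => -((2 * Real.pi * ‖ξ‖) ^ (2 * s) * symb s t ξ * Real.cos (2 * Real.pi * inner ℝ ξ x)))
    (x₀ := t) (s := Ioi (t / 2)) (bound := fun ξ => (2 * Real.pi * ‖ξ‖) ^ (2 * s) * symb s (t / 2) ξ)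
    (Ioi_mem_nhds (by linarith)) (Eventually.of_forall hm) ?_ ?_ ?_
    (integrable_rpow_mul_symb hs₀ hs₁ (by linarith)) ?_
  · have := key.2
    rw [integral_neg] at this
    exact this
  · exact (integrable_symb hs₀ ht).mul_bdd (c := 1) hcos.aestronglyMeasurable
      (Eventually.of_forall fun _ => Real.abs_cos_le_one _)
  · exact (((continuous_norm_rpow hs₀).mul (continuous_symb hs₀ t)).mul hcos).neg.aestronglyMeasurable
  · refine Eventually.of_forall fun ξ r hr => ?_
    rw [norm_neg, norm_mul, Real.norm_of_nonneg (mul_nonneg (by positivity) (symb_pos _ _ _).le)]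
    refine (mul_le_of_le_one_right (mul_nonneg (by positivity) (symb_pos _ _ _).le)
      (Real.abs_cos_le_one _)).trans ?_
    have hr : t / 2 < r := hr
    unfold symb
    gcongr
  · refine Eventually.of_forall fun ξ r hr => ?_
    have h1 := ((hasDerivAt_id r).mul_const ((2 * Real.pi * ‖ξ‖) ^ (2 * s))).neg.exp.mul_const
      (Real.cos (2 * Real.pi * inner ℝ ξ x))
    convert! h1 using 1
    simp only [id, Pi.neg_apply, symb]; ring

/-- The factorisation behind all L¹ bounds. The singularity of the symbol at ξ = 0 sits entirely in
the first factor, the exponential of the transform of a finite measure; the last factor is Schwartz.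
-/
lemma symb_one_eq {s : ℝ} (hs₀ : 0 < s) (hs₁ : s < 1) (ξ : E n) :
    (symb s 1 ξ : ℂ) = Complex.exp (charInt ((volume.restrict (Ioi 1)).prod volume) (gaussDens s) Prod.snd ξ) *
      ((Real.exp (-(subConst s * ∫ σ in Ioi (1 : ℝ), σ ^ (-1 - s))) : ℂ) *
        (Real.exp (-lowExp s ((2 * Real.pi * ‖ξ‖) ^ 2)) : ℂ)) := by
  rw [charInt_gaussDens hs₀ hs₁, ← Complex.ofReal_exp, ← Complex.ofReal_mul, ← Complex.ofReal_mul,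
    ← Real.exp_add, ← Real.exp_add, symb, one_mul, rpow_two_mul (by positivity),
    rpow_eq_lowExp_add hs₀ hs₁ (by positivity)]
  congr 2; ring

/-- Multiplication by the low frequency factor does not enlarge `L¹` norms by more than a factor. -/
lemma exists_lintegral_fourierInv_symb_mul_le {s : ℝ} (hs₀ : 0 < s) (hs₁ : s < 1) (Θ : 𝓢(E n, ℂ))
    (hΘ : ∀ ξ, Θ ξ = (Real.exp (-lowExp s ((2 * Real.pi * ‖ξ‖) ^ 2)) : ℂ)) :
    ∃ C : ℝ, ∀ d : E n → ℂ, Continuous d → (∃ D, ∀ ξ, ‖d ξ‖ ≤ D) →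
      ∫⁻ x, ‖𝓕⁻ (fun ξ => (symb s 1 ξ : ℂ) * d ξ) x‖ₑ ≤
        ENNReal.ofReal C * ∫⁻ x, ‖𝓕⁻ (fun ξ => Θ ξ * d ξ) x‖ₑ := by
  set m := subConst s * ∫ σ in Ioi (1 : ℝ), σ ^ (-1 - s) with hm
  refine ⟨Real.exp (∫ z, gaussDens s z ∂((volume.restrict (Ioi 1)).prod (volume : Measure (E n)))) *
    Real.exp (-m), fun d hd ⟨D, hD⟩ => ?_⟩
  have hi : Integrable fun ξ : E n => Θ ξ * d ξ :=
    Θ.integrable.mul_bdd hd.aestronglyMeasurable (Eventually.of_forall hD)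
  -- The density is nonnegative only where the time parameter is positive, hence almost everywhere
  -- for this measure. Its absolute value is nonnegative everywhere, as the exponential estimate
  -- requires, and gives the same transform.
  set p : ℝ × E n → ℝ := fun z => |gaussDens s z| with hp
  have hpi : Integrable p ((volume.restrict (Ioi 1)).prod volume) := (integrable_gaussDens hs₀ hs₁).abs
  have hae : p =ᵐ[(volume.restrict (Ioi 1)).prod volume] gaussDens s := by
    have : ∀ᵐ z : ℝ × E n ∂((volume.restrict (Ioi 1)).prod volume), (1 : ℝ) < z.1 :=
      Measure.quasiMeasurePreserving_fst.ae (ae_restrict_mem measurableSet_Ioi)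
    filter_upwards [this] with z hz
    have : (0 : ℝ) < z.1 := one_pos.trans hz
    have := subConst_pos hs₀ hs₁
    exact abs_of_nonneg (by unfold gaussDens; positivity)
  have hch : charInt ((volume.restrict (Ioi 1)).prod volume) p Prod.snd =
      charInt ((volume.restrict (Ioi 1)).prod volume) (gaussDens s : ℝ × E n → ℝ) Prod.snd := by
    ext ξ
    exact integral_congr_ae (hae.mono fun z hz => by simp only [hz])
  have h := lintegral_fourierInv_exp_charInt_mul_le measurable_snd hpi (fun z => abs_nonneg _)
    (hi.const_mul (Real.exp (-m) : ℂ))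
  rw [hch, integral_congr_ae hae] at h
  have e1 : (fun ξ => (symb s 1 ξ : ℂ) * d ξ) = fun ξ =>
      Complex.exp (charInt ((volume.restrict (Ioi 1)).prod volume) (gaussDens s) Prod.snd ξ) *
        ((Real.exp (-m) : ℂ) * (Θ ξ * d ξ)) := by
    ext ξ; rw [symb_one_eq hs₀ hs₁, hΘ]; ring
  rw [e1]
  refine h.trans (le_of_eq ?_)
  rw [ENNReal.ofReal_mul (Real.exp_pos _).le, mul_assoc]
  congr 1
  rw [← lintegral_const_mul' _ _ ENNReal.ofReal_ne_top]
  congr 1; ext x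
  simp_rw [fourierInv_eq_integral_chr, mul_assoc, integral_const_mul, enorm_mul]
  congr 1
  rw [← ofReal_norm, Complex.norm_real, Real.norm_of_nonneg (Real.exp_pos _).le]

lemma secondDiff_fourierInv {H : E n → ℂ} (hH : Integrable H) (x h : E n) :
    secondDiff (𝓕⁻ H) x h =
      𝓕⁻ (fun ξ => H ξ * ((-2 * (1 - Real.cos (2 * Real.pi * inner ℝ ξ h)) : ℝ) : ℂ)) x := by
  have e : 𝓕⁻ H = fun z => ∫ ξ, H ξ * chr ξ z := funext (fourierInv_eq_integral_chr H)
  rw [e, secondDiff_integral (integrable_mul_chr hH), fourierInv_eq_integral_chr]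
  congr 1; ext ξ
  rw [secondDiff_mul_chr, secondDiff_chr]; ring

lemma secondDiff_ofReal (u : E n → ℝ) (x h : E n) :
    secondDiff (fun y => (u y : ℂ)) x h = ((secondDiff u x h : ℝ) : ℂ) := by
  unfold secondDiff; push_cast [Complex.real_smul]; simp

/-- The case d = 1 of the multiplier estimate: the L¹ norm of the kernel is controlled by that of
the inverse transform of the Schwartz factor. -/
theorem integrable_hk_one {s : ℝ} (hs₀ : 0 < s) (hs₁ : s < 1) : Integrable (hk s 1 : E n → ℝ) := by
  obtain ⟨Θ, hΘ⟩ := exists_schwartz_lowSymbol (n := n) hs₀ hs₁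
  obtain ⟨C, hC⟩ := exists_lintegral_fourierInv_symb_mul_le hs₀ hs₁ Θ hΘ
  have h := hC (fun _ => 1) continuous_const ⟨1, by simp⟩
  simp only [mul_one] at h
  rw [fourierInv_symb hs₀ one_pos, ← SchwartzMap.fourierInv_coe] at h
  refine ⟨(continuous_hk hs₀ one_pos).aestronglyMeasurable, ?_⟩
  have h2 : ∫⁻ x, ‖hk s 1 (x : E n)‖ₑ = ∫⁻ x, ‖((hk s 1 (x : E n) : ℝ) : ℂ)‖ₑ := by
    congr 1; ext x; rw [← ofReal_norm, ← ofReal_norm, Complex.norm_real]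
  rw [HasFiniteIntegral, h2]
  exact h.trans_lt (ENNReal.mul_lt_top ENNReal.ofReal_lt_top (𝓕⁻ Θ).integrable.2)

/-- A second difference multiplies the symbol by -2(1 - cos(2π⟨ξ,h⟩)). Carrying this bounded factor
as d through the multiplier estimate reduces the claim to a Schwartz function. -/
theorem exists_integral_secondDiff_hk_one_le {s : ℝ} (hs₀ : 0 < s) (hs₁ : s < 1) :
    ∃ C, 0 ≤ C ∧ ∀ h : E n, ∫ y, |secondDiff (hk s 1) y h| ≤ C * min 1 (‖h‖ ^ (2 : ℝ)) := by
  obtain ⟨Θ, hΘ⟩ := exists_schwartz_lowSymbol (n := n) hs₀ hs₁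
  obtain ⟨C, hC⟩ := exists_lintegral_fourierInv_symb_mul_le hs₀ hs₁ Θ hΘ
  obtain ⟨C', hC'⟩ := exists_integral_secondDiff_schwartz_le (𝓕⁻ Θ)
  refine ⟨|C| * |C'|, by positivity, fun h => ?_⟩
  have hmin : 0 ≤ min 1 (‖h‖ ^ (2 : ℝ)) := le_min zero_le_one (by positivity)
  have h1 := hC (fun ξ => ((-2 * (1 - Real.cos (2 * Real.pi * inner ℝ ξ h)) : ℝ) : ℂ)) (by fun_prop)
    ⟨4, fun ξ => by
      rw [Complex.norm_real, norm_mul, norm_neg, Real.norm_ofNat, Real.norm_of_nonneg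
        (by linarith [Real.cos_le_one (2 * Real.pi * inner ℝ ξ h)])]
      linarith [Real.neg_one_le_cos (2 * Real.pi * inner ℝ ξ h)]⟩
  simp_rw [← secondDiff_fourierInv (H := fun ξ : E n => (symb s 1 ξ : ℂ))
    (integrable_symb hs₀ one_pos).ofReal, ← secondDiff_fourierInv Θ.integrable] at h1
  have e1 : ∀ x : E n, secondDiff (𝓕⁻ fun ξ : E n => (symb s 1 ξ : ℂ)) x h =
      ((secondDiff (hk s 1) x h : ℝ) : ℂ) := fun x => by
    rw [fourierInv_symb hs₀ one_pos, secondDiff_ofReal]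
  have hi : Integrable fun y => secondDiff (𝓕⁻ Θ : 𝓢(E n, ℂ)) y h := by
    unfold secondDiff
    exact (((𝓕⁻ Θ).integrable.comp_add_right h).add ((𝓕⁻ Θ).integrable.comp_sub_right h)).sub
      ((𝓕⁻ Θ).integrable.smul (2 : ℝ))
  have h3 : ∫⁻ x, ‖secondDiff (𝓕⁻ (Θ : E n → ℂ)) x h‖ₑ =
      ENNReal.ofReal (∫ y, ‖secondDiff (𝓕⁻ Θ : 𝓢(E n, ℂ)) y h‖) := by
    rw [← SchwartzMap.fourierInv_coe, ofReal_integral_norm_eq_lintegral_enorm hi]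
  have h4 : ∫⁻ x, ‖secondDiff (hk s 1) (x : E n) h‖ₑ ≤ ENNReal.ofReal (|C| * |C'| * min 1 (‖h‖ ^ (2 : ℝ))) := by
    calc _ = ∫⁻ x : E n, ‖((secondDiff (hk s 1) x h : ℝ) : ℂ)‖ₑ := by
          congr 1; ext x; rw [← ofReal_norm, ← ofReal_norm, Complex.norm_real]
      _ ≤ _ := by
          simp_rw [← e1]
          refine h1.trans ?_
          rw [h3, mul_assoc, ENNReal.ofReal_mul (abs_nonneg C)]
          gcongr
          · exact le_abs_self C
          · exact (hC' h).trans (mul_le_mul_of_nonneg_right (le_abs_self _) hmin)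
  have hi2 := integrable_secondDiff (integrable_hk_one (n := n) hs₀ hs₁) h
  rw [← ofReal_integral_norm_eq_lintegral_enorm hi2] at h4
  exact (ENNReal.ofReal_le_ofReal_iff (by positivity)).1 h4

/-- Fourier inversion at ξ = 0, where the symbol equals 1; it is available because the kernel is
integrable. -/
theorem integral_hk_one {s : ℝ} (hs₀ : 0 < s) (hs₁ : s < 1) : ∫ x : E n, hk s 1 x = 1 := by
  have hi := (integrable_symb (n := n) hs₀ one_pos).ofReal (𝕜 := ℂ)
  have h2 : Integrable (𝓕 (fun ξ : E n => (symb s 1 ξ : ℂ))) := by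
    have : 𝓕 (fun ξ : E n => (symb s 1 ξ : ℂ)) = fun x => (hk s 1 (-x) : ℂ) := by
      ext x
      rw [← neg_neg x, ← Real.fourierInv_eq_fourier_neg, fourierInv_symb hs₀ one_pos, neg_neg]
    rw [this]
    exact (integrable_hk_one hs₀ hs₁).comp_neg.ofReal
  have h := Integrable.fourier_fourierInv_eq (f := fun ξ : E n => (symb s 1 ξ : ℂ)) hi h2 (v := 0)
    (Complex.continuous_ofReal.comp (continuous_symb hs₀ 1)).continuousAt
  have h0 : symb s 1 (0 : E n) = 1 := by
    simp [symb, Real.zero_rpow (show 2 * s ≠ 0 by positivity)]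
  have e := fourierInv_symb (n := n) hs₀ one_pos
  rw [e] at h
  simp only [h0, Complex.ofReal_one] at h
  rw [Real.fourier_eq'] at h
  simp only [inner_zero_right, mul_zero, Complex.ofReal_zero, zero_mul, Complex.exp_zero, one_smul,
    integral_complex_ofReal] at h
  exact Complex.ofReal_injective (h.trans Complex.ofReal_one.symm)

end

/-! ### The heat semigroup -/

section

variable {n : ℕ}

/-- The length scale `|t|^{1/(2s)}`. -/
def scl (s t : ℝ) : ℝ := |t| ^ (1 / (2 * s))

/-- `exp(-t(-Δ)^s) u`. -/
def heat (s t : ℝ) (u : E n → ℝ) (x : E n) : ℝ := ∫ y, hk s 1 y * u (x + scl s t • y)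

/-- `(-Δ)^s exp(-t(-Δ)^s) u`. -/
def heatA (s t : ℝ) (u : E n → ℝ) (x : E n) : ℝ := t⁻¹ * ∫ y, hka s 1 y * u (x + scl s t • y)

lemma continuous_scl {s : ℝ} (hs₀ : 0 < s) : Continuous (scl s) :=
  continuous_abs.rpow_const fun _ => Or.inr (by positivity)

lemma scl_pos {t : ℝ} (s : ℝ) (ht : 0 < t) : 0 < scl s t := by unfold scl; positivity

lemma scl_of_pos {s t : ℝ} (ht : 0 < t) : scl s t = t ^ (1 / (2 * s)) := by
  rw [scl, abs_of_pos ht]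

lemma continuous_integral_mul {X : Type*} [TopologicalSpace X] [FirstCountableTopology X]
    {κ : E n → ℝ} (hκ : Integrable κ) {G : X → E n → ℝ} (hG : Continuous fun z : X × E n => G z.1 z.2)
    {M : ℝ} (hM : ∀ x y, |G x y| ≤ M) : Continuous fun x => ∫ y, κ y * G x y := by
  have hc : ∀ x, Continuous (G x) := fun x => hG.comp (Continuous.prodMk_right x)
  refine continuous_of_dominated (bound := fun y => ‖κ y‖ * M)
    (fun x => hκ.aestronglyMeasurable.mul (hc x).aestronglyMeasurable) ?_ (hκ.norm.mul_const M) ?_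
  · exact fun x => Eventually.of_forall fun y => by
      rw [norm_mul]; exact mul_le_mul_of_nonneg_left (hM x y) (norm_nonneg _)
  · exact Eventually.of_forall fun y => continuous_const.mul
      (hG.comp (Continuous.prodMk_left y))

lemma abs_integral_mul_le {κ u : E n → ℝ} (hκ : Integrable κ) {M : ℝ} (hM : ∀ y, |u y| ≤ M) :
    |∫ y, κ y * u y| ≤ (∫ y, |κ y|) * M := by
  rw [← integral_mul_const, ← Real.norm_eq_abs]
  refine norm_integral_le_of_norm_le (hκ.abs.mul_const M) (Eventually.of_forall fun y => ?_)
  rw [norm_mul]; exact mul_le_mul_of_nonneg_left (hM y) (norm_nonneg _)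

section

variable {s : ℝ}

lemma integrable_hka_one (hn : 0 < n) (hs₀ : 0 < s) (hs₁ : s < 1) :
    Integrable (hka s 1 : E n → ℝ) := by
  obtain ⟨C, -, hC⟩ := exists_integral_secondDiff_hk_one_le (n := n) hs₀ hs₁
  refine (integrable_fracOp hn hs₀ (γ := 2) (by linarith) (integrable_hk_one hs₀ hs₁)
    (continuous_hk hs₀ one_pos) hC).congr (Eventually.of_forall fun x => ?_)
  exact fracOp_hk hn hs₀ hs₁ one_pos x

lemma heat_zero (hs₀ : 0 < s) (hs₁ : s < 1) (u : E n → ℝ) (x : E n) : heat s 0 u x = u x := by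
  have : scl s 0 = 0 := by
    rw [scl, abs_zero, Real.zero_rpow (by positivity)]
  simp [heat, this, integral_mul_const, integral_hk_one hs₀ hs₁]

lemma abs_heat_le (hs₀ : 0 < s) (hs₁ : s < 1) {u : E n → ℝ} {M : ℝ} (hM : ∀ y, |u y| ≤ M) (t : ℝ)
    (x : E n) : |heat s t u x| ≤ (∫ y : E n, |hk s 1 y|) * M :=
  abs_integral_mul_le (u := fun y => u (x + scl s t • y)) (integrable_hk_one hs₀ hs₁) fun _ => hM _

/-- In the rescaled form the kernel does not depend on time, so dominated convergence gives
continuity up to t = 0. The absolute value in `scl` extends the family to negative times, and so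
continuity holds on the whole space. -/
lemma continuous_heat_family (hs₀ : 0 < s) (hs₁ : s < 1) {F : E n → ℝ → ℝ}
    (hF : Continuous fun z : E n × ℝ => F z.1 z.2) {M : ℝ} (hM : ∀ x t, |F x t| ≤ M) :
    Continuous fun z : (E n × ℝ) × ℝ => heat s z.2 (fun x => F x z.1.2) z.1.1 := by
  have := continuous_scl hs₀
  refine continuous_integral_mul (X := (E n × ℝ) × ℝ) (integrable_hk_one hs₀ hs₁)
    (G := fun z y => F (z.1.1 + scl s z.2 • y) z.1.2) ?_ (M := M) (fun _ _ => hM _ _)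
  exact hF.comp (by fun_prop : Continuous fun w : ((E n × ℝ) × ℝ) × E n =>
    (w.1.1.1 + scl s w.1.2 • w.2, w.1.1.2))

lemma continuousOn_heatA_family (hn : 0 < n) (hs₀ : 0 < s) (hs₁ : s < 1) {F : E n → ℝ → ℝ}
    (hF : Continuous fun z : E n × ℝ => F z.1 z.2) {M : ℝ} (hM : ∀ x t, |F x t| ≤ M) :
    ContinuousOn (fun z : (E n × ℝ) × ℝ => heatA s z.2 (fun x => F x z.1.2) z.1.1) {z | 0 < z.2} := by
  have := continuous_scl hs₀
  have h : Continuous fun z : (E n × ℝ) × ℝ =>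
      ∫ y, hka s 1 y * F (z.1.1 + scl s z.2 • y) z.1.2 := by
    refine continuous_integral_mul (X := (E n × ℝ) × ℝ) (integrable_hka_one hn hs₀ hs₁)
      (G := fun z y => F (z.1.1 + scl s z.2 • y) z.1.2) ?_ (M := M) (fun _ _ => hM _ _)
    exact hF.comp (by fun_prop : Continuous fun w : ((E n × ℝ) × ℝ) × E n =>
      (w.1.1.1 + scl s w.1.2 • w.2, w.1.1.2))
  exact (continuousOn_snd.inv₀ fun z hz => ne_of_gt hz).mul h.continuousOn

lemma continuous_heat (hs₀ : 0 < s) (hs₁ : s < 1) {u : E n → ℝ} (hu : Continuous u) {M : ℝ}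
    (hM : ∀ x, |u x| ≤ M) : Continuous fun z : E n × ℝ => heat s z.2 u z.1 :=
  (continuous_heat_family hs₀ hs₁ (F := fun x _ => u x) (by fun_prop) (fun x _ => hM x)).comp
    (by fun_prop : Continuous fun z : E n × ℝ => ((z.1, (0 : ℝ)), z.2))

lemma continuousOn_heatA (hn : 0 < n) (hs₀ : 0 < s) (hs₁ : s < 1) {u : E n → ℝ} (hu : Continuous u)
    {M : ℝ} (hM : ∀ x, |u x| ≤ M) :
    ContinuousOn (fun z : E n × ℝ => heatA s z.2 u z.1) {z | 0 < z.2} :=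
  (continuousOn_heatA_family hn hs₀ hs₁ (F := fun x _ => u x) (by fun_prop) (fun x _ => hM x)).comp
    (by fun_prop : Continuous fun z : E n × ℝ => ((z.1, (0 : ℝ)), z.2)).continuousOn
    fun z hz => hz

lemma integral_scale {R : ℝ} (hR : 0 < R) (κ g : E n → ℝ) :
    ∫ y, (R ^ n)⁻¹ * κ (R⁻¹ • y) * g y = ∫ y, κ y * g (R • y) := by
  have h := Measure.integral_comp_smul_of_nonneg volume (fun y : E n => κ (R⁻¹ • y) * g y) R (hR := hR.le)
  simp only [smul_smul, inv_mul_cancel₀ hR.ne', one_smul, finrank_euclideanSpace_fin, smul_eq_mul] at h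
  rw [h, ← integral_const_mul]
  simp_rw [mul_assoc]

lemma heat_eq (hs₀ : 0 < s) {t : ℝ} (ht : 0 < t) (u : E n → ℝ) (x : E n) :
    heat s t u x = ∫ y, hk s t y * u (x + y) := by
  simp_rw [hk_scale hs₀ ht, ← scl_of_pos ht]
  rw [integral_scale (scl_pos s ht) (hk s 1) (fun y => u (x + y))]
  rfl

lemma heatA_eq (hs₀ : 0 < s) {t : ℝ} (ht : 0 < t) (u : E n → ℝ) (x : E n) :
    heatA s t u x = ∫ y, hka s t y * u (x + y) := by
  simp_rw [hka_scale hs₀ ht, ← scl_of_pos ht, mul_assoc t⁻¹]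
  rw [integral_const_mul, integral_scale (scl_pos s ht) (hka s 1) (fun y => u (x + y))]
  rfl

lemma integrable_hk (hs₀ : 0 < s) (hs₁ : s < 1) {t : ℝ} (ht : 0 < t) :
    Integrable (hk s t : E n → ℝ) := by
  have h := ((integrable_hk_one (n := n) hs₀ hs₁).comp_smul
    (inv_ne_zero (show t ^ (1 / (2 * s)) ≠ 0 by positivity))).const_mul ((t ^ (1 / (2 * s))) ^ n)⁻¹
  exact h.congr (Eventually.of_forall fun x => (hk_scale hs₀ ht x).symm)

lemma integrable_hka (hn : 0 < n) (hs₀ : 0 < s) (hs₁ : s < 1) {t : ℝ} (ht : 0 < t) :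
    Integrable (hka s t : E n → ℝ) := by
  have h := (((integrable_hka_one (n := n) hn hs₀ hs₁).comp_smul
    (inv_ne_zero (show t ^ (1 / (2 * s)) ≠ 0 by positivity))).const_mul
      ((t ^ (1 / (2 * s))) ^ n)⁻¹).const_mul t⁻¹
  exact h.congr (Eventually.of_forall fun x => (hka_scale hs₀ ht x).symm)

lemma integral_abs_hka (hs₀ : 0 < s) {t : ℝ} (ht : 0 < t) :
    ∫ y : E n, |hka s t y| = t⁻¹ * ∫ y : E n, |hka s 1 y| := by
  have h := integral_scale (scl_pos s ht) (fun y : E n => |hka s 1 y|) (fun _ => 1)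
  simp only [mul_one] at h
  rw [← h, ← integral_const_mul]
  congr 1; ext y
  have := scl_pos s ht
  rw [hka_scale hs₀ ht, ← scl_of_pos ht, abs_mul, abs_mul, abs_of_pos (by positivity : 0 < t⁻¹),
    abs_of_pos (by positivity : 0 < (scl s t ^ n)⁻¹)]

lemma integral_abs_secondDiff_hk (hs₀ : 0 < s) {t : ℝ} (ht : 0 < t) (h : E n) :
    ∫ y : E n, |secondDiff (hk s t) y h| = ∫ y : E n, |secondDiff (hk s 1) y ((scl s t)⁻¹ • h)| := by
  have hR := scl_pos s ht
  have e := integral_scale hR (fun y : E n => |secondDiff (hk s 1) y ((scl s t)⁻¹ • h)|) (fun _ => 1)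
  simp only [mul_one] at e
  rw [← e]
  congr 1; ext y
  rw [← abs_of_pos (by positivity : 0 < (scl s t ^ n)⁻¹), ← abs_mul]
  congr 1
  unfold secondDiff
  simp_rw [hk_scale hs₀ ht, ← scl_of_pos ht, smul_add, smul_sub, smul_eq_mul]
  ring

end

lemma min_one_mul_le {a b : ℝ} (ha : 0 ≤ a) (hb : 0 ≤ b) : min 1 (a * b) ≤ (1 + a) * min 1 b := by
  rcases le_total 1 b with h | h
  · rw [min_eq_left h]; exact (min_le_left _ _).trans (by linarith)
  · rw [min_eq_right h]; exact (min_le_right _ _).trans (by nlinarith)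

lemma exists_integral_secondDiff_hk_le {s : ℝ} (hs₀ : 0 < s) (hs₁ : s < 1) {t : ℝ} (ht : 0 < t) :
    ∃ C, ∀ h : E n, ∫ y, |secondDiff (hk s t) y h| ≤ C * min 1 (‖h‖ ^ (2 : ℝ)) := by
  obtain ⟨C, hC0, hC⟩ := exists_integral_secondDiff_hk_one_le (n := n) hs₀ hs₁
  have hR := scl_pos s ht
  refine ⟨C * (1 + (scl s t)⁻¹ ^ (2 : ℝ)), fun h => ?_⟩
  rw [integral_abs_secondDiff_hk hs₀ ht]
  refine (hC _).trans ?_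
  rw [norm_smul, Real.norm_of_nonneg (by positivity), Real.mul_rpow (by positivity) (norm_nonneg _),
    mul_assoc]
  gcongr
  exact min_one_mul_le (by positivity) (by positivity)

lemma fracOp_heat (hn : 0 < n) {s : ℝ} (hs₀ : 0 < s) (hs₁ : s < 1) {u : E n → ℝ} (hu : Continuous u)
    {M : ℝ} (hM : ∀ x, |u x| ≤ M) {t : ℝ} (ht : 0 < t) (x : E n) :
    fracOp s (heat s t u) x = heatA s t u x := by
  obtain ⟨C, hC⟩ := exists_integral_secondDiff_hk_le (n := n) hs₀ hs₁ ht
  have e : heat s t u = fun x => ∫ y, hk s t y * u (x + y) := funext (heat_eq hs₀ ht u)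
  rw [e, fracOp_correlation hn hs₀ (γ := 2) (by linarith) (integrable_hk hs₀ hs₁ ht)
    (continuous_hk hs₀ ht) hC hu hM, heatA_eq hs₀ ht]
  simp_rw [fracOp_hk hn hs₀ hs₁ ht]

/-- Second differences of `exp(-t(-Δ)^s)u`. -/
lemma exists_secondDiff_heat_le {s : ℝ} (hs₀ : 0 < s) (hs₁ : s < 1) :
    ∃ C, 0 ≤ C ∧ ∀ {u : E n → ℝ} {M : ℝ}, Continuous u → (∀ x, |u x| ≤ M) → ∀ {t : ℝ}, 0 < t →
      ∀ x h : E n, ‖secondDiff (heat s t u) x h‖ ≤ M * (C * min 1 ((‖h‖ / scl s t) ^ (2 : ℝ))) := by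
  obtain ⟨C, hC0, hC⟩ := exists_integral_secondDiff_hk_one_le (n := n) hs₀ hs₁
  refine ⟨C, hC0, fun {u M} hu hM {t} ht x h => ?_⟩
  have e : heat s t u = fun x => ∫ y, hk s t y * u (x + y) := funext (heat_eq hs₀ ht u)
  have hR := scl_pos s ht
  have hM0 : 0 ≤ M := (abs_nonneg _).trans (hM 0)
  rw [e]
  refine (abs_secondDiff_correlation_le (integrable_hk hs₀ hs₁ ht) hu hM x h).trans ?_
  rw [integral_abs_secondDiff_hk hs₀ ht]
  gcongr
  refine (hC _).trans (le_of_eq ?_)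
  rw [norm_smul, norm_inv, Real.norm_of_nonneg hR.le, div_eq_inv_mul]

lemma secondDiff_heat {s : ℝ} (hs₀ : 0 < s) (hs₁ : s < 1) {u : E n → ℝ} (hu : Continuous u) {M : ℝ}
    (hM : ∀ x, |u x| ≤ M) (t : ℝ) (x h : E n) :
    secondDiff (heat s t u) x h = ∫ y, hk s 1 y * secondDiff u (x + scl s t • y) h := by
  have hi : ∀ z, Integrable fun y => hk s 1 y * u (z + scl s t • y) := fun z =>
    (integrable_hk_one hs₀ hs₁).mul_bdd (c := M) (by fun_prop) (Eventually.of_forall fun _ => hM _)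
  have := secondDiff_integral (μ := volume) (W := fun y z => hk s 1 y * u (z + scl s t • y)) hi x h
  refine this.trans ?_
  congr 1; ext y
  simp only [secondDiff, smul_eq_mul]
  rw [show x + h + scl s t • y = x + scl s t • y + h by abel,
    show x - h + scl s t • y = x + scl s t • y - h by abel]
  ring

lemma hk_sub_hk {s : ℝ} (hs₀ : 0 < s) (hs₁ : s < 1) {a b : ℝ} (ha : 0 < a) (hab : a ≤ b) (y : E n) :
    hk s b y - hk s a y = -∫ r in a..b, hka s r y := by
  have hpos : ∀ r ∈ uIcc a b, 0 < r := fun r hr => by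
    rw [uIcc_of_le hab] at hr; exact ha.trans_le hr.1
  have hc : ContinuousOn (fun r => hka s r y) (uIcc a b) := by
    have hp : ContinuousOn (fun r : ℝ => r ^ (1 / (2 * s))) (uIcc a b) :=
      ContinuousOn.rpow_const continuousOn_id fun r hr => Or.inl (hpos r hr).ne'
    have hp0 : ∀ r ∈ uIcc a b, r ^ (1 / (2 * s)) ≠ 0 := fun r hr =>
      (Real.rpow_pos_of_pos (hpos r hr) _).ne'
    have : ContinuousOn (fun t : ℝ => t⁻¹ * (((t ^ (1 / (2 * s))) ^ n)⁻¹ *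
        hka s 1 ((t ^ (1 / (2 * s)))⁻¹ • y))) (uIcc a b) := by
      refine (continuousOn_id.inv₀ fun r hr => (hpos r hr).ne').mul
        (((hp.pow n).inv₀ fun r hr => pow_ne_zero _ (hp0 r hr)).mul ?_)
      exact (continuous_hka hs₀ hs₁ one_pos).comp_continuousOn
        ((hp.inv₀ hp0).smul continuousOn_const)
    exact this.congr fun r hr => hka_scale hs₀ (hpos r hr) y
  have h := intervalIntegral.integral_eq_sub_of_hasDerivAt
    (fun r hr => hasDerivAt_hk hs₀ hs₁ (hpos r hr) y) hc.neg.intervalIntegrable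
  rw [← h]
  simp

/-- The kernel identity integrated against u, with Fubini justified by the L¹ norm of (-Δ)^s of the
kernel, a constant over r and hence bounded on [a,b]. Working with increments avoids a spatial
majorant uniform in time, which differentiation under the integral would require. -/
lemma heat_sub_heat (hn : 0 < n) {s : ℝ} (hs₀ : 0 < s) (hs₁ : s < 1) {u : E n → ℝ} (hu : Continuous u)
    {M : ℝ} (hM : ∀ x, |u x| ≤ M) {a b : ℝ} (ha : 0 < a) (hab : a ≤ b) (x : E n) :
    heat s b u x - heat s a u x = -∫ r in a..b, heatA s r u x := by
  have hb : 0 < b := ha.trans_le hab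
  have hbd : ∀ y, ‖u (x + y)‖ ≤ M := fun y => hM _
  have hum : AEStronglyMeasurable (fun y => u (x + y)) volume := (by fun_prop : Continuous _).aestronglyMeasurable
  rw [heat_eq hs₀ hb, heat_eq hs₀ ha, ← integral_sub ((integrable_hk hs₀ hs₁ hb).mul_bdd hum
    (Eventually.of_forall hbd)) ((integrable_hk hs₀ hs₁ ha).mul_bdd hum (Eventually.of_forall hbd))]
  simp_rw [← sub_mul, hk_sub_hk hs₀ hs₁ ha hab, neg_mul]
  rw [integral_neg]
  congr 1
  simp_rw [intervalIntegral.integral_of_le hab, ← integral_mul_const]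
  rw [integral_integral_swap]
  · exact setIntegral_congr_fun measurableSet_Ioc fun r hr => (heatA_eq hs₀ (ha.trans hr.1) u x).symm
  have hm : AEStronglyMeasurable (fun z : ℝ × E n => hka s z.1 z.2 * u (x + z.2))
      ((volume.restrict (Ioc a b)).prod volume) := by
    have h1 : Measurable fun z : ℝ × E n => z.1⁻¹ * (((z.1 ^ (1 / (2 * s))) ^ n)⁻¹ *
        hka s 1 ((z.1 ^ (1 / (2 * s)))⁻¹ • z.2)) * u (x + z.2) := by
      have := (continuous_hka (n := n) hs₀ hs₁ one_pos).measurable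
      have := hu.measurable
      fun_prop
    refine h1.aestronglyMeasurable.congr ?_
    have : ∀ᵐ z : ℝ × E n ∂((volume.restrict (Ioc a b)).prod volume), z.1 ∈ Ioc a b :=
      Measure.quasiMeasurePreserving_fst.ae (ae_restrict_mem measurableSet_Ioc)
    filter_upwards [this] with z hz
    rw [← hka_scale hs₀ (ha.trans hz.1)]
  have hint : Integrable (fun z : ℝ × E n => hka s z.1 z.2 * u (x + z.2))
      ((volume.restrict (Ioc a b)).prod volume) := by
    rw [integrable_prod_iff hm]
    constructor
    · refine (ae_restrict_iff' measurableSet_Ioc).2 (Eventually.of_forall fun r hr => ?_)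
      exact (integrable_hka hn hs₀ hs₁ (ha.trans hr.1)).mul_bdd hum (Eventually.of_forall hbd)
    · refine Integrable.mono' (g := fun _ => a⁻¹ * (∫ y : E n, |hka s 1 y|) * M)
        (integrable_const _) hm.norm.integral_prod_right' ?_
      refine (ae_restrict_iff' measurableSet_Ioc).2 (Eventually.of_forall fun r hr => ?_)
      have hr0 := ha.trans hr.1
      have hM0 : 0 ≤ M := (abs_nonneg _).trans (hM 0)
      rw [Real.norm_of_nonneg (integral_nonneg fun _ => norm_nonneg _)]
      calc _ ≤ ∫ y : E n, |hka s r y| * M := by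
            refine integral_mono_of_nonneg (Eventually.of_forall fun _ => norm_nonneg _)
              ((integrable_hka hn hs₀ hs₁ hr0).abs.mul_const M) (Eventually.of_forall fun y => ?_)
            beta_reduce
            rw [norm_mul]
            exact mul_le_mul_of_nonneg_left (hbd y) (norm_nonneg _)
        _ = r⁻¹ * (∫ y : E n, |hka s 1 y|) * M := by rw [integral_mul_const, integral_abs_hka hs₀ hr0]
        _ ≤ _ := by
            have : 0 ≤ ∫ y : E n, |hka s 1 y| := integral_nonneg fun _ => abs_nonneg _
            gcongr
            exact hr.1.le
  exact hint.swap

lemma hasDerivAt_heat (hn : 0 < n) {s : ℝ} (hs₀ : 0 < s) (hs₁ : s < 1) {u : E n → ℝ} (hu : Continuous u)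
    {M : ℝ} (hM : ∀ x, |u x| ≤ M) {t : ℝ} (ht : 0 < t) (x : E n) :
    HasDerivAt (fun t => heat s t u x) (-heatA s t u x) t := by
  have hc : ContinuousOn (fun r => heatA s r u x) (Ioi 0) :=
    (continuousOn_heatA hn hs₀ hs₁ hu hM).comp
      (by fun_prop : Continuous fun r : ℝ => (x, r)).continuousOn fun r hr => hr
  have hsub : uIcc (t / 2) t ⊆ Ioi 0 := by
    rw [uIcc_of_le (by linarith)]; intro r hr; exact lt_of_lt_of_le (by linarith) hr.1
  have h1 : HasDerivAt (fun b => ∫ r in (t / 2)..b, heatA s r u x) (heatA s t u x) t :=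
    intervalIntegral.integral_hasDerivAt_right (hc.mono hsub).intervalIntegrable
      (hc.stronglyMeasurableAtFilter isOpen_Ioi t ht) (hc.continuousAt (Ioi_mem_nhds ht))
  refine (h1.neg.const_add (heat s (t / 2) u x)).congr_of_eventuallyEq ?_
  filter_upwards [Ioi_mem_nhds (show t / 2 < t by linarith)] with b hb
  have := heat_sub_heat hn hs₀ hs₁ hu hM (show 0 < t / 2 by linarith) (le_of_lt hb) x
  simp only [Pi.neg_apply]
  linarith

end

/-! ### Mollification and regularity -/

section

variable {n : ℕ}

/-- The mollification `∫ ρ(y) u(x+y) dy`. -/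
def mollify (ρ u : E n → ℝ) (x : E n) : ℝ := ∫ y, ρ y * u (x + y)

lemma exists_mollifier {δ : ℝ} (hδ : 0 < δ) :
    ∃ ρ : 𝓢(E n, ℝ), (∀ y, 0 ≤ ρ y) ∧ ∫ y, ρ y = 1 ∧ ∀ y, δ ≤ ‖y‖ → ρ y = 0 := by
  let b : ContDiffBump (0 : E n) := ⟨δ / 2, δ, by positivity, by linarith⟩
  refine ⟨(b.hasCompactSupport_normed (μ := volume)).toSchwartzMap (b.contDiff_normed (n := ⊤)), ?_, ?_, ?_⟩
  · exact fun y => b.nonneg_normed y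
  · exact b.integral_normed
  · intro y hy
    have : y ∉ Function.support (b.normed volume) := by
      rw [b.support_normed_eq, mem_ball_zero_iff, not_lt]; exact hy
    simpa using this

/-- The complexification of a real Schwartz function. -/
def complexify (ρ : 𝓢(E n, ℝ)) : 𝓢(E n, ℂ) := SchwartzMap.postcompCLM Complex.ofRealCLM ρ

lemma complexify_apply (ρ : 𝓢(E n, ℝ)) (y : E n) : complexify ρ y = (ρ y : ℂ) := rfl

lemma abs_mollify_le {ρ u : E n → ℝ} (hρ0 : ∀ y, 0 ≤ ρ y) (hρ1 : ∫ y, ρ y = 1) {G : ℝ}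
    (hG : ∀ᵐ y, |u y| ≤ G) (x : E n) : |mollify ρ u x| ≤ G := by
  have hρ : Integrable ρ := by
    by_contra h
    rw [integral_undef h] at hρ1
    exact zero_ne_one hρ1
  have hG' : ∀ᵐ y, |u (x + y)| ≤ G :=
    (measurePreserving_add_left volume x).quasiMeasurePreserving.ae hG
  rw [mollify, ← Real.norm_eq_abs]
  refine (norm_integral_le_of_norm_le (hρ.mul_const G) ?_).trans (le_of_eq ?_)
  · filter_upwards [hG'] with y hy
    rw [norm_mul, Real.norm_of_nonneg (hρ0 y)]
    exact mul_le_mul_of_nonneg_left hy (hρ0 y)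
  · rw [integral_mul_const, hρ1, one_mul]

lemma continuous_mollify {ρ u : E n → ℝ} (hρ : Integrable ρ) (hu : Continuous u) {M : ℝ}
    (hM : ∀ x, |u x| ≤ M) : Continuous (mollify ρ u) :=
  continuous_integral_mul (X := E n) hρ (G := fun x y => u (x + y)) (by fun_prop) (fun _ _ => hM _)

/-- A sequence of mollifiers. -/
def moll (k : ℕ) : 𝓢(E n, ℝ) :=
  (exists_mollifier (n := n) (δ := 1 / ((k : ℝ) + 1)) (by positivity)).choose

lemma moll_nonneg (k : ℕ) (y : E n) : 0 ≤ moll k y :=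
  (exists_mollifier (n := n) (δ := 1 / ((k : ℝ) + 1)) (by positivity)).choose_spec.1 y

lemma integral_moll (k : ℕ) : ∫ y : E n, moll k y = 1 :=
  (exists_mollifier (n := n) (δ := 1 / ((k : ℝ) + 1)) (by positivity)).choose_spec.2.1

lemma moll_eq_zero (k : ℕ) {y : E n} (hy : 1 / ((k : ℝ) + 1) ≤ ‖y‖) : moll k y = 0 :=
  (exists_mollifier (n := n) (δ := 1 / ((k : ℝ) + 1)) (by positivity)).choose_spec.2.2 y hy

lemma tendsto_mollify {u : E n → ℝ} (hu : Continuous u) {M : ℝ} (hM : ∀ x, |u x| ≤ M)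
    (x : E n) : Tendsto (fun k => mollify (moll k) u x) atTop (𝓝 (u x)) := by
  rw [Metric.tendsto_atTop]
  intro ε hε
  obtain ⟨δ, hδ, hδ'⟩ := Metric.continuous_iff.1 hu x (ε / 2) (by positivity)
  obtain ⟨N, hN⟩ := exists_nat_one_div_lt hδ
  refine ⟨N, fun k hk => ?_⟩
  have hi : Integrable fun y => moll k y * u (x + y) :=
    (moll k).integrable.mul_bdd (c := M) (by fun_prop) (Eventually.of_forall fun _ => hM _)
  have e : mollify (moll k) u x - u x = ∫ y, moll k y * (u (x + y) - u x) := by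
    simp_rw [mul_sub]
    rw [integral_sub hi ((moll k).integrable.mul_const _), integral_mul_const, integral_moll, one_mul]
    rfl
  rw [Real.dist_eq, e]
  refine lt_of_le_of_lt (b := ε / 2) ?_ (by linarith)
  rw [← Real.norm_eq_abs]
  refine (norm_integral_le_of_norm_le ((moll k).integrable.mul_const (ε / 2)) ?_).trans (le_of_eq ?_)
  · refine Eventually.of_forall fun y => ?_
    rw [norm_mul, Real.norm_of_nonneg (moll_nonneg k y)]
    by_cases hy : 1 / ((k : ℝ) + 1) ≤ ‖y‖
    · rw [moll_eq_zero k hy, zero_mul, zero_mul]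
    · refine mul_le_mul_of_nonneg_left ?_ (moll_nonneg k y)
      rw [Real.norm_eq_abs, ← Real.dist_eq]
      refine (hδ' _ ?_).le
      rw [dist_self_add_left]
      push Not at hy
      refine (hy.trans_le ?_).trans hN
      have : (N : ℝ) ≤ k := by exact_mod_cast hk
      gcongr
  · rw [integral_mul_const, integral_moll, one_mul]

lemma tendsto_integral_mul_of_bounded {κ : E n → ℝ} (hκ : Integrable κ) {v : ℕ → E n → ℝ} {u : E n → ℝ}
    (hv : ∀ k, Continuous (v k)) {M : ℝ} (hM : ∀ k x, |v k x| ≤ M)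
    (hlim : ∀ x, Tendsto (fun k => v k x) atTop (𝓝 (u x))) {ψ : E n → E n} (hψ : Continuous ψ) :
    Tendsto (fun k => ∫ y, κ y * v k (ψ y)) atTop (𝓝 (∫ y, κ y * u (ψ y))) := by
  refine tendsto_integral_of_dominated_convergence (fun y => ‖κ y‖ * M) (fun k => ?_)
    (hκ.norm.mul_const M) (fun k => Eventually.of_forall fun y => ?_)
    (Eventually.of_forall fun y => (hlim _).const_mul _)
  · exact hκ.aestronglyMeasurable.mul ((hv k).comp hψ).aestronglyMeasurable
  · rw [norm_mul]; exact mul_le_mul_of_nonneg_left (hM k _) (norm_nonneg _)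

lemma integrable_rpow_mul_schwartz {s : ℝ} (hs₀ : 0 < s) (hs₁ : s < 1) (H : 𝓢(E n, ℂ)) (p : ℕ) :
    Integrable fun ξ : E n => ‖ξ‖ ^ p * ‖(((2 * Real.pi * ‖ξ‖) ^ (2 * s) : ℝ) : ℂ) * H ξ‖ := by
  have h := (H.integrable_pow_mul volume p).add
    ((H.integrable_pow_mul volume (p + 2)).const_mul ((2 * Real.pi) ^ 2))
  have hc : Continuous fun ξ : E n => ‖ξ‖ ^ p * ‖(((2 * Real.pi * ‖ξ‖) ^ (2 * s) : ℝ) : ℂ) * H ξ‖ := by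
    have := continuous_norm_rpow (n := n) hs₀
    have := H.continuous
    fun_prop
  refine h.mono' hc.aestronglyMeasurable (Eventually.of_forall fun ξ => ?_)
  rw [Real.norm_of_nonneg (by positivity), norm_mul, Complex.norm_real, Real.norm_of_nonneg (by positivity)]
  calc _ ≤ ‖ξ‖ ^ p * ((1 + (2 * Real.pi) ^ 2 * ‖ξ‖ ^ 2) * ‖H ξ‖) := by
        gcongr; exact norm_rpow_le_one_add_sq hs₀ hs₁ ξ
    _ = _ := by simp only [Pi.add_apply]; ring

lemma fourierInv_fourier_schwartz (η : 𝓢(E n, ℂ)) : 𝓕⁻ (fun ξ => 𝓕 (η : E n → ℂ) ξ) = η := by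
  have h := η.continuous.fourierInv_fourier_eq η.integrable (by
    rw [← SchwartzMap.fourier_coe]; exact (𝓕 η).integrable)
  exact h

lemma fracLapSchwartz_eq_fracOp (hn : 0 < n) {s : ℝ} (hs₀ : 0 < s) (hs₁ : s < 1) (η : 𝓢(E n, ℂ)) :
    fracLapSchwartz s η = fracOp s η := by
  ext x
  have h := fracOp_fourierInv hn hs₀ hs₁ (H := fun ξ => 𝓕 (η : E n → ℂ) ξ)
    (by rw [← SchwartzMap.fourier_coe]; exact (𝓕 η).continuous)
    (by rw [← SchwartzMap.fourier_coe]; exact (𝓕 η).integrable)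
    (by rw [← SchwartzMap.fourier_coe]; exact (𝓕 η).integrable_pow_mul volume 2) x
  rw [fourierInv_fourier_schwartz] at h
  rw [h]
  rfl

lemma norm_secondDiff_fracLapSchwartz_le {s : ℝ} (hs₀ : 0 < s) (hs₁ : s < 1) (η : 𝓢(E n, ℂ)) :
    ∃ C, ∀ x h : E n, ‖secondDiff (fracLapSchwartz s η) x h‖ ≤ C * min 1 (‖h‖ ^ (2 : ℝ)) := by
  refine ⟨_, fun x h => norm_secondDiff_fourierInv_le ?_ ?_ x h⟩
  · have h0 := integrable_rpow_mul_schwartz hs₀ hs₁ (𝓕 η) 0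
    simp only [pow_zero, one_mul] at h0
    rw [← SchwartzMap.fourier_coe]
    refine (integrable_norm_iff ?_).1 h0
    have := continuous_norm_rpow (n := n) hs₀
    have := (𝓕 η).continuous
    exact (by fun_prop : Continuous _).aestronglyMeasurable
  · rw [← SchwartzMap.fourier_coe]
    exact integrable_rpow_mul_schwartz hs₀ hs₁ (𝓕 η) 2

/-- The inner function is no longer Schwartz, but its transform |ξ|^{2s} times a Schwartz function
is continuous and has two integrable moments. That is enough to apply the symbol rule a second time.
-/
lemma fracLapSchwartz_two_mul (hn : 0 < n) {s : ℝ} (hs₀ : 0 < s) (hs₁ : s < 1) (η : 𝓢(E n, ℂ)) :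
    fracLapSchwartz (2 * s) η = fracOp s (fracLapSchwartz s η) := by
  ext x
  have hc : Continuous fun ξ => (((2 * Real.pi * ‖ξ‖) ^ (2 * s) : ℝ) : ℂ) * 𝓕 (η : E n → ℂ) ξ := by
    have := continuous_norm_rpow (n := n) hs₀
    have : Continuous (𝓕 (η : E n → ℂ)) := by rw [← SchwartzMap.fourier_coe]; exact (𝓕 η).continuous
    fun_prop
  have h := fracOp_fourierInv hn hs₀ hs₁
    (H := fun ξ => (((2 * Real.pi * ‖ξ‖) ^ (2 * s) : ℝ) : ℂ) * 𝓕 (η : E n → ℂ) ξ) hc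
    (by
      have h0 := integrable_rpow_mul_schwartz hs₀ hs₁ (𝓕 η) 0
      simp only [pow_zero, one_mul] at h0
      exact (integrable_norm_iff hc.aestronglyMeasurable).1 h0)
    (integrable_rpow_mul_schwartz hs₀ hs₁ (𝓕 η) 2) x
  have e : (fun ξ : E n => (((2 * Real.pi * ‖ξ‖) ^ (2 * (2 * s)) : ℝ) : ℂ) * 𝓕 (η : E n → ℂ) ξ) =
      fun ξ => (((2 * Real.pi * ‖ξ‖) ^ (2 * s) : ℝ) : ℂ) *
        ((((2 * Real.pi * ‖ξ‖) ^ (2 * s) : ℝ) : ℂ) * 𝓕 (η : E n → ℂ) ξ) := by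
    ext ξ
    rw [two_mul (2 * s), Real.rpow_add_of_nonneg (by positivity) (by positivity) (by positivity),
      Complex.ofReal_mul, mul_assoc]
  unfold fracLapSchwartz
  rw [h, e]

lemma secondDiff_comp_sub {V : Type*} [NormedAddCommGroup V] [NormedSpace ℝ V] (u : E n → V)
    (a x h : E n) : secondDiff (fun y => u (y - a)) x h = secondDiff u (x - a) h := by
  unfold secondDiff
  beta_reduce
  rw [show x + h - a = x - a + h by abel, show x - h - a = x - a - h by abel]

lemma fracOp_comp_sub {V : Type*} [NormedAddCommGroup V] [NormedSpace ℝ V] (s : ℝ) (u : E n → V)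
    (a x : E n) : fracOp s (fun y => u (y - a)) x = fracOp s u (x - a) := by
  unfold fracOp; simp_rw [secondDiff_comp_sub]

lemma secondDiff_comp_sub_left {V : Type*} [NormedAddCommGroup V] [NormedSpace ℝ V] (u : E n → V)
    (a x h : E n) : secondDiff (fun y => u (a - y)) x h = secondDiff u (a - x) h := by
  unfold secondDiff
  beta_reduce
  rw [show a - (x + h) = a - x - h by abel, show a - (x - h) = a - x + h by abel]
  abel

lemma mollify_ofReal (ρ : 𝓢(E n, ℝ)) (g : E n → ℝ) (x : E n) :
    ((mollify ρ g x : ℝ) : ℂ) =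
      ∫ y, (g y : ℂ) * SchwartzMap.compSubConstCLM ℝ x (complexify ρ) y := by
  have h : mollify ρ g x = ∫ y, ρ (y - x) * g y := by
    rw [mollify, ← integral_sub_right_eq_self (fun y => ρ y * g (x + y)) x]
    simp
  rw [h, ← integral_complex_ofReal]
  congr 1; ext y
  rw [SchwartzMap.compSubConstCLM_apply, complexify_apply]; push_cast; ring

/-- Mollification at x is pairing with ρ translated by x. The duality relation for this test
function, together with translation invariance of the operator, turns the weak fractional Laplacian
into a pointwise one. -/
lemma fracOp_mollify (hn : 0 < n) {s : ℝ} (hs₀ : 0 < s) (hs₁ : s < 1) {u g : E n → ℝ}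
    (hu : Continuous u) {M : ℝ} (hM : ∀ x, |u x| ≤ M) (hug : IsFracLaplacian s u g)
    (ρ : 𝓢(E n, ℝ)) (x : E n) : fracOp s (mollify ρ u) x = mollify ρ g x := by
  obtain ⟨C, hC⟩ := exists_integral_secondDiff_schwartz_le ρ
  have h1 : fracOp s (mollify ρ u) x = ∫ y, fracOp s ρ y * u (x + y) :=
    fracOp_correlation hn hs₀ (γ := 2) (by linarith) ρ.integrable ρ.continuous hC hu hM x
  have h2 : ∫ y, fracOp s ρ y * u (x + y) = ∫ y, u y * fracOp s ρ (y - x) := by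
    rw [← integral_sub_right_eq_self (fun y => fracOp s ρ y * u (x + y)) x]
    simp [mul_comm]
  have h3 := (hug (SchwartzMap.compSubConstCLM ℝ x (complexify ρ))).2.2
  have h4 : ∀ y, fracLapSchwartz s (SchwartzMap.compSubConstCLM ℝ x (complexify ρ)) y =
      ((fracOp s ρ (y - x) : ℝ) : ℂ) := by
    intro y
    rw [fracLapSchwartz_eq_fracOp hn hs₀ hs₁, ← fracOp_ofReal]
    exact fracOp_comp_sub s (complexify ρ) x y
  simp_rw [h4, ← Complex.ofReal_mul, integral_complex_ofReal] at h3
  rw [← mollify_ofReal] at h3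
  rw [h1, h2]
  exact Complex.ofReal_injective h3

lemma exists_secondDiff_mollify_le {u : E n → ℝ}
    (hu : Continuous u) {M : ℝ} (hM : ∀ x, |u x| ≤ M) (ρ : 𝓢(E n, ℝ)) :
    ∃ C, ∀ x h, ‖secondDiff (mollify ρ u) x h‖ ≤ C * min 1 (‖h‖ ^ (2 : ℝ)) := by
  obtain ⟨C, hC⟩ := exists_integral_secondDiff_schwartz_le ρ
  have hM0 : 0 ≤ M := (abs_nonneg _).trans (hM 0)
  refine ⟨M * C, fun x h => (abs_secondDiff_correlation_le ρ.integrable hu hM x h).trans ?_⟩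
  rw [mul_assoc]
  exact mul_le_mul_of_nonneg_left (hC h) hM0

/-- The iterated operator, for an integrable function. -/
lemma fracOp_mollify_of_two_mul (hn : 0 < n) {s : ℝ} (hs₀ : 0 < s) (hs₁ : s < 1) {f fs f2s : E n → ℝ}
    (hf : Continuous f) (hfi : Integrable f)
    (h1 : IsFracLaplacian s f fs) (h2 : IsFracLaplacian (2 * s) f f2s)
    (ρ : 𝓢(E n, ℝ)) (x : E n) : fracOp s (mollify ρ fs) x = mollify ρ f2s x := by
  set W := fracLapSchwartz s (complexify ρ) with hW
  have hWc : Continuous W := by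
    rw [hW, fracLapSchwartz]
    refine continuous_fourierInv ?_
    have h0 := integrable_rpow_mul_schwartz hs₀ hs₁ (𝓕 (complexify ρ)) 0
    simp only [pow_zero, one_mul] at h0
    rw [← SchwartzMap.fourier_coe]
    refine (integrable_norm_iff ?_).1 h0
    have := continuous_norm_rpow (n := n) hs₀
    have := (𝓕 (complexify ρ)).continuous
    exact (by fun_prop : Continuous _).aestronglyMeasurable
  have htr : ∀ z y, fracLapSchwartz s (SchwartzMap.compSubConstCLM ℝ z (complexify ρ)) y = W (y - z) := by
    intro z y
    rw [hW, fracLapSchwartz_eq_fracOp hn hs₀ hs₁, fracLapSchwartz_eq_fracOp hn hs₀ hs₁]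
    exact fracOp_comp_sub s (complexify ρ) z y
  obtain ⟨C, hC⟩ := norm_secondDiff_fracLapSchwartz_le hs₀ hs₁ (complexify ρ)
  -- Duality puts the first operator on the test function, so the mollified fs is a superposition of
  -- translates of W with density f. The second differences of W are bounded only uniformly in
  -- space; integrability of f is what lets the second operator pass under the integral.
  have e1 : (fun z => ((mollify ρ fs z : ℝ) : ℂ)) = fun z => ∫ y, (f y : ℂ) * W (y - z) := by
    ext z
    rw [mollify_ofReal, ← (h1 _).2.2]
    simp_rw [htr]
  have hsd : ∀ y z h, secondDiff (fun z => (f y : ℂ) * W (y - z)) z h = (f y : ℂ) * secondDiff W (y - z) h := by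
    intro y z h
    rw [← secondDiff_comp_sub_left]
    unfold secondDiff; simp only [Complex.real_smul]; ring
  apply Complex.ofReal_injective
  rw [← fracOp_ofReal, e1, fracOp_integral hn hs₀ (γ := 2) (by linarith) (B := fun y => ‖f y‖ * C)]
  · have e2 : ∀ y, fracOp s (fun z => (f y : ℂ) * W (y - z)) x = (f y : ℂ) *
        fracLapSchwartz (2 * s) (SchwartzMap.compSubConstCLM ℝ x (complexify ρ)) y := by
      intro y
      have e3 : fracLapSchwartz s (SchwartzMap.compSubConstCLM ℝ x (complexify ρ)) = fun y => W (y - x) :=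
        funext (htr x)
      rw [fracLapSchwartz_two_mul hn hs₀ hs₁, e3, fracOp_comp_sub]
      unfold fracOp
      simp_rw [hsd, Complex.real_smul, mul_left_comm _ (f y : ℂ), integral_const_mul]
      ring
    simp_rw [e2]
    rw [(h2 _).2.2, mollify_ofReal]
  · exact ((Complex.continuous_ofReal.comp (hf.comp continuous_fst)).mul
      (hWc.comp (continuous_fst.sub continuous_snd))).stronglyMeasurable
  · exact hfi.norm.mul_const C
  · intro z
    have := (h1 (SchwartzMap.compSubConstCLM ℝ z (complexify ρ))).1
    simpa only [htr] using this
  · refine Eventually.of_forall fun y h => ?_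
    rw [hsd, norm_mul, Complex.norm_real, mul_assoc]
    exact mul_le_mul_of_nonneg_left (hC _ _) (norm_nonneg _)

/-- Once the second differences of w are O(min(1,|h|²)) uniformly, the operator may act on the
translates of w inside the heat average instead of on the kernel. -/
lemma heatA_eq_heat_fracOp (hn : 0 < n) {s : ℝ} (hs₀ : 0 < s) (hs₁ : s < 1) {w : E n → ℝ}
    (hw : Continuous w) {M C : ℝ} (hM : ∀ x, |w x| ≤ M)
    (hC : ∀ x h, ‖secondDiff w x h‖ ≤ C * min 1 (‖h‖ ^ (2 : ℝ))) {t : ℝ} (ht : 0 < t) (x : E n) :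
    heatA s t w x = heat s t (fracOp s w) x := by
  rw [← fracOp_heat hn hs₀ hs₁ hw hM ht]
  have hsd : ∀ y z h, secondDiff (fun z => hk s 1 y * w (z + scl s t • y)) z h =
      hk s 1 y * secondDiff w (z + scl s t • y) h := by
    intro y z h
    have := secondDiff_comp_sub w (-(scl s t • y)) z h
    simp only [sub_neg_eq_add] at this
    rw [← this]
    unfold secondDiff; simp only [smul_eq_mul]; ring
  have h := fracOp_integral hn hs₀ (γ := 2) (by linarith) (μ := volume) (x := x)
    (W := fun y z => hk s 1 y * w (z + scl s t • y)) (B := fun y : E n => ‖hk s 1 y‖ * C) ?_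
    ((integrable_hk_one hs₀ hs₁).norm.mul_const C) ?_ ?_
  · refine h.trans ?_
    unfold heat
    congr 1; ext y
    unfold fracOp
    simp_rw [hsd, smul_eq_mul, mul_left_comm _ (hk s 1 y), integral_const_mul]
    ring
  · have := continuous_hk (n := n) hs₀ one_pos
    exact (by fun_prop : Continuous fun z : E n × E n => hk s 1 z.1 * w (z.2 + scl s t • z.1)).stronglyMeasurable
  · exact fun z => (integrable_hk_one hs₀ hs₁).mul_bdd (c := M) (by fun_prop)
      (Eventually.of_forall fun _ => hM _)
  · refine Eventually.of_forall fun y h => ?_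
    rw [hsd, norm_mul, mul_assoc]
    exact mul_le_mul_of_nonneg_left (hC _ _) (norm_nonneg _)

lemma tendsto_heat_mollify {s : ℝ} (hs₀ : 0 < s) (hs₁ : s < 1) {u : E n → ℝ}
    (hu : Continuous u) {M : ℝ} (hM : ∀ x, |u x| ≤ M) (t : ℝ) (x : E n) :
    Tendsto (fun k => heat s t (mollify (moll k) u) x) atTop (𝓝 (heat s t u x)) :=
  tendsto_integral_mul_of_bounded (integrable_hk_one hs₀ hs₁)
    (fun k => continuous_mollify (moll k).integrable hu hM)
    (fun k => abs_mollify_le (moll_nonneg k) (integral_moll k) (Eventually.of_forall hM))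
    (tendsto_mollify hu hM) (ψ := fun y => x + scl s t • y) (by fun_prop)

lemma tendsto_heatA_mollify (hn : 0 < n) {s : ℝ} (hs₀ : 0 < s) (hs₁ : s < 1) {u : E n → ℝ}
    (hu : Continuous u) {M : ℝ} (hM : ∀ x, |u x| ≤ M) (t : ℝ) (x : E n) :
    Tendsto (fun k => heatA s t (mollify (moll k) u) x) atTop (𝓝 (heatA s t u x)) :=
  (tendsto_integral_mul_of_bounded (integrable_hka_one hn hs₀ hs₁)
    (fun k => continuous_mollify (moll k).integrable hu hM)
    (fun k => abs_mollify_le (moll_nonneg k) (integral_moll k) (Eventually.of_forall hM))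
    (tendsto_mollify hu hM) (ψ := fun y => x + scl s t • y) (by fun_prop)).const_mul _

/-- `(-Δ)^s exp(-t(-Δ)^s) u = exp(-t(-Δ)^s) g` if `(-Δ)^s u = g`. -/
theorem heatA_eq_heat_of_isFracLaplacian (hn : 0 < n) {s : ℝ} (hs₀ : 0 < s) (hs₁ : s < 1)
    {u g : E n → ℝ} (hu : Continuous u) {M : ℝ} (hM : ∀ x, |u x| ≤ M)
    (hg : Continuous g) {G : ℝ} (hG : ∀ x, |g x| ≤ G)
    (hug : IsFracLaplacian s u g) {t : ℝ} (ht : 0 < t) (x : E n) :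
    heatA s t u x = heat s t g x := by
  -- The function u itself is too rough for the exchange. It is carried out for the mollifications,
  -- and both sides pass to the limit because the kernels at time one are integrable.
  refine tendsto_nhds_unique (tendsto_heatA_mollify hn hs₀ hs₁ hu hM t x)
    ((tendsto_heat_mollify hs₀ hs₁ hg hG t x).congr fun k => ?_)
  obtain ⟨C, hC⟩ := exists_secondDiff_mollify_le hu hM (moll k)
  rw [heatA_eq_heat_fracOp hn hs₀ hs₁ (continuous_mollify (moll k).integrable hu hM)
    (abs_mollify_le (moll_nonneg k) (integral_moll k) (Eventually.of_forall hM)) hC ht]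
  congr 1
  ext z
  exact (fracOp_mollify hn hs₀ hs₁ hu hM hug _ z).symm

/-- Meant for u = (-Δ)^s f, whose fractional Laplacian is known only as an L^∞ function: only its
mollifications are controlled at every point. -/
lemma abs_heatA_le_of_fracOp_mollify (hn : 0 < n) {s : ℝ} (hs₀ : 0 < s) (hs₁ : s < 1)
    {u : E n → ℝ} (hu : Continuous u) {M : ℝ} (hM : ∀ x, |u x| ≤ M) {G : ℝ}
    (hG : ∀ k x, |fracOp s (mollify (moll k) u) x| ≤ G) {t : ℝ} (ht : 0 < t) (x : E n) :
    |heatA s t u x| ≤ (∫ y : E n, |hk s 1 y|) * G := by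
  refine le_of_tendsto (tendsto_heatA_mollify hn hs₀ hs₁ hu hM t x).abs (Eventually.of_forall fun k => ?_)
  obtain ⟨C, hC⟩ := exists_secondDiff_mollify_le hu hM (moll k)
  rw [heatA_eq_heat_fracOp hn hs₀ hs₁ (continuous_mollify (moll k).integrable hu hM)
    (abs_mollify_le (moll_nonneg k) (integral_moll k) (Eventually.of_forall hM)) hC ht]
  exact abs_heat_le hs₀ hs₁ (hG k) t x

/-- The time derivative of the heat evolution is bounded by K. Integrate it from a to t and let a →
0, using continuity at time zero. -/
lemma abs_heat_sub_le (hn : 0 < n) {s : ℝ} (hs₀ : 0 < s) (hs₁ : s < 1) {u : E n → ℝ} (hu : Continuous u)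
    {M K : ℝ} (hM : ∀ x, |u x| ≤ M) (hK : ∀ t, 0 < t → ∀ x, |heatA s t u x| ≤ K) {t : ℝ} (ht : 0 < t)
    (x : E n) : |heat s t u x - u x| ≤ K * t := by
  have hK0 : 0 ≤ K := (abs_nonneg _).trans (hK t ht x)
  have hc : Continuous fun r => heat s r u x :=
    (continuous_heat hs₀ hs₁ hu hM).comp (by fun_prop : Continuous fun r : ℝ => (x, r))
  have h0 : Tendsto (fun a => |heat s t u x - heat s a u x|) (𝓝[>] 0) (𝓝 |heat s t u x - u x|) := by
    have hc' : Continuous fun a => |heat s t u x - heat s a u x| := (continuous_const.sub hc).abs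
    have := hc'.tendsto 0
    rw [heat_zero hs₀ hs₁] at this
    exact this.mono_left nhdsWithin_le_nhds
  refine le_of_tendsto h0 ?_
  filter_upwards [Ioo_mem_nhdsGT ht] with a ha
  rw [heat_sub_heat hn hs₀ hs₁ hu hM ha.1 ha.2.le, abs_neg, ← Real.norm_eq_abs]
  refine (intervalIntegral.norm_integral_le_of_norm_le_const (C := K) fun r hr => ?_).trans ?_
  · rw [uIoc_of_le ha.2.le] at hr
    exact hK r (ha.1.trans hr.1) x
  · rw [abs_of_pos (by linarith [ha.2])]
    gcongr
    linarith [ha.1]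

/-- Hölder type regularity of bounded functions with bounded fractional Laplacian. -/
theorem exists_secondDiff_le_of_heatA (hn : 0 < n) {s : ℝ} (hs₀ : 0 < s) (hs₁ : s < 1) (M K : ℝ) :
    ∃ C, ∀ u : E n → ℝ, Continuous u → (∀ x, |u x| ≤ M) → (∀ t, 0 < t → ∀ x, |heatA s t u x| ≤ K) →
      ∀ x h, ‖secondDiff u x h‖ ≤ C * min 1 (‖h‖ ^ s) := by
  obtain ⟨C, hC0, hC⟩ := exists_secondDiff_heat_le (n := n) hs₀ hs₁
  refine ⟨M * C + 4 * K + 4 * M, fun u hu hM hK x h => ?_⟩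
  have hM0 : 0 ≤ M := (abs_nonneg _).trans (hM 0)
  have hK0 : 0 ≤ K := (abs_nonneg _).trans (hK 1 one_pos 0)
  rcases le_total 1 ‖h‖ with hh | hh
  · rw [min_eq_left (Real.one_le_rpow hh hs₀.le), mul_one]
    refine (norm_secondDiff_le hM x h).trans ?_
    have := mul_nonneg hM0 hC0
    linarith
  · rw [min_eq_right (Real.rpow_le_one (norm_nonneg _) hh hs₀.le)]
    rcases eq_or_ne h 0 with rfl | h0
    · simp [secondDiff, Real.zero_rpow hs₀.ne', two_mul]
    have hp : 0 < ‖h‖ := norm_pos_iff.2 h0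
    -- Split u into S(t)u and the remainder u - S(t)u. With t = |h|^s the length scale is |h|^{1/2},
    -- so the smooth part contributes |h|²/|h| = |h| ≤ |h|^s, while the remainder contributes 4Kt =
    -- 4K|h|^s.
    set t := ‖h‖ ^ s with ht
    have htp : 0 < t := by positivity
    have e : secondDiff u x h = secondDiff (heat s t u) x h - secondDiff (fun z => heat s t u z - u z) x h := by
      simp only [secondDiff, smul_eq_mul]; ring
    have h1 := hC hu hM htp x h
    have h2 := norm_secondDiff_le (u := fun z => heat s t u z - u z)
      (abs_heat_sub_le hn hs₀ hs₁ hu hM hK htp) x h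
    have h3 : (‖h‖ / scl s t) ^ (2 : ℝ) ≤ t := by
      have e1 : scl s t = ‖h‖ ^ (1 / 2 : ℝ) := by
        rw [scl_of_pos htp, ht, ← Real.rpow_mul hp.le]; congr 1; field_simp
      rw [e1, Real.div_rpow hp.le (by positivity), ← Real.rpow_mul hp.le,
        show (1 / 2 : ℝ) * 2 = 1 by norm_num, Real.rpow_one, Real.rpow_two, sq,
        mul_div_assoc, div_self hp.ne', mul_one]
      calc ‖h‖ = ‖h‖ ^ (1 : ℝ) := (Real.rpow_one _).symm
        _ ≤ _ := Real.rpow_le_rpow_of_exponent_ge hp hh hs₁.le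
    rw [e]
    refine (norm_sub_le _ _).trans ((add_le_add h1 h2).trans ?_)
    have h4 : M * (C * min 1 ((‖h‖ / scl s t) ^ (2 : ℝ))) ≤ M * (C * t) := by
      gcongr; exact (min_le_right _ _).trans h3
    nlinarith

end

/-! ### Mild solutions -/

section

variable {n : ℕ}

/-- The singularity `1 + τ^{-(3+s)/4}` of `(-Δ)^s exp(-τ(-Δ)^s)` on Hölder type functions. -/
def sing (s τ : ℝ) : ℝ := 1 + τ ^ (-((3 + s) / 4))

/-- The order of smoothness gained by interpolation. -/
def smoothExp (s : ℝ) : ℝ := s * (1 + (3 + s) / 4 * (2 - s))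

/-- The exponent α = (3+s)/4 has to satisfy α < 1, for integrability in time, and α(2-s) > 1, for
smoothness beyond order 2s. The second condition amounts to s² + s < 2, which holds for s < 1. -/
lemma two_mul_lt_smoothExp {s : ℝ} (hs₀ : 0 < s) (hs₁ : s < 1) : 2 * s < smoothExp s := by
  unfold smoothExp
  have : 1 < (3 + s) / 4 * (2 - s) := by nlinarith
  nlinarith

lemma sing_nonneg {s τ : ℝ} (hτ : 0 ≤ τ) : 0 ≤ sing s τ := by unfold sing; positivity

lemma sing_anti {s a b : ℝ} (hs₀ : 0 < s) (ha : 0 < a) (hab : a ≤ b) : sing s b ≤ sing s a := by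
  unfold sing
  gcongr 1 + ?_
  exact Real.rpow_le_rpow_of_nonpos ha hab (by linarith)

lemma intervalIntegrable_sing {s : ℝ} (hs₁ : s < 1) (a b : ℝ) :
    IntervalIntegrable (sing s) volume a b :=
  intervalIntegrable_const.add (intervalIntegral.intervalIntegrable_rpow' (by linarith))

/-- Interpolation between two bounds for second differences of S(τ)u: τ^{-1/s}|h|² from smoothing,
and |h|^s from the regularity of u. The geometric mean with weight θ = sα on the first has time
factor τ^{-α} and order 2θ + s(1-θ) = `smoothExp s`. -/
lemma exists_secondDiff_heat_le_sing {s : ℝ} (hs₀ : 0 < s) (hs₁ : s < 1) (M K : ℝ) :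
    ∃ C, 0 ≤ C ∧ ∀ u : E n → ℝ, Continuous u → (∀ x, |u x| ≤ M) →
      (∀ x h, ‖secondDiff u x h‖ ≤ K * min 1 (‖h‖ ^ s)) → ∀ τ, 0 < τ → ∀ x h,
      ‖secondDiff (heat s τ u) x h‖ ≤ C * sing s τ * min 1 (‖h‖ ^ smoothExp s) := by
  obtain ⟨C, hC0, hC⟩ := exists_secondDiff_heat_le (n := n) hs₀ hs₁
  set L := ∫ y : E n, |hk s 1 y| with hL
  have hL0 : 0 ≤ L := integral_nonneg fun _ => abs_nonneg _
  refine ⟨|M| * C + L * |K|, by positivity, fun u hu hM hK τ hτ x h => ?_⟩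
  set A := |M| * C + L * |K| with hA
  have hA0 : 0 ≤ A := by positivity
  set a := ‖secondDiff (heat s τ u) x h‖ with ha
  have ha0 : 0 ≤ a := norm_nonneg _
  have hM' : M ≤ |M| := le_abs_self M
  have hX0 := hC hu hM hτ x h
  have hX : a ≤ A * min 1 ((‖h‖ / scl s τ) ^ (2 : ℝ)) := by
    refine hX0.trans ?_
    rw [← mul_assoc]
    have : 0 ≤ min 1 ((‖h‖ / scl s τ) ^ (2 : ℝ)) := by
      have := scl_pos s hτ
      positivity
    gcongr
    calc M * C ≤ |M| * C := by gcongr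
      _ ≤ A := by rw [hA]; exact le_add_of_nonneg_right (by positivity)
  have hY : a ≤ A * ‖h‖ ^ s := by
    rw [ha, secondDiff_heat hs₀ hs₁ hu hM, Real.norm_eq_abs]
    refine (abs_integral_mul_le (u := fun y => secondDiff u (x + scl s τ • y) h)
      (integrable_hk_one hs₀ hs₁) (M := |K| * ‖h‖ ^ s) fun y => ?_).trans ?_
    · refine (hK _ h).trans ?_
      have : 0 ≤ min 1 (‖h‖ ^ s) := by positivity
      gcongr
      · exact le_abs_self K
      · exact min_le_right _ _
    · rw [← mul_assoc]
      gcongr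
      rw [hA]; exact le_add_of_nonneg_left (by positivity)
  have hA1 : a ≤ A := hX.trans (mul_le_of_le_one_right hA0 (min_le_left _ _))
  set α := (3 + s) / 4 with hα
  set θ := s * α with hθ
  have hα0 : 0 < α := by rw [hα]; linarith
  have hα1 : α < 1 := by rw [hα]; linarith
  have hθ0 : 0 < θ := by positivity
  have hθ1 : θ < 1 := by rw [hθ]; nlinarith
  have hXY : a ≤ A * (τ ^ (-α) * ‖h‖ ^ smoothExp s) := by
    have hX' : a ≤ A * (‖h‖ / scl s τ) ^ (2 : ℝ) := hX.trans (by gcongr; exact min_le_right _ _)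
    have hp := scl_pos s hτ
    calc a = a ^ θ * a ^ (1 - θ) := by
          rw [← Real.rpow_add_of_nonneg ha0 hθ0.le (by linarith)]; simp
      _ ≤ (A * (‖h‖ / scl s τ) ^ (2 : ℝ)) ^ θ * (A * ‖h‖ ^ s) ^ (1 - θ) := by
          gcongr
      _ = A ^ θ * A ^ (1 - θ) * ((‖h‖ / scl s τ) ^ (2 : ℝ)) ^ θ * (‖h‖ ^ s) ^ (1 - θ) := by
          rw [Real.mul_rpow hA0 (by positivity), Real.mul_rpow hA0 (by positivity)]; ring
      _ = A * ((‖h‖ / scl s τ) ^ (2 : ℝ)) ^ θ * (‖h‖ ^ s) ^ (1 - θ) := by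
          rw [← Real.rpow_add_of_nonneg hA0 hθ0.le (by linarith)]; simp
      _ = A * (τ ^ (-α) * (‖h‖ ^ (2 * θ) * ‖h‖ ^ (s * (1 - θ)))) := by
          rw [← Real.rpow_mul (by positivity), ← Real.rpow_mul (norm_nonneg _),
            Real.div_rpow (norm_nonneg _) hp.le, scl_of_pos hτ, ← Real.rpow_mul hτ.le,
            show 1 / (2 * s) * (2 * θ) = α by rw [hθ]; field_simp, Real.rpow_neg hτ.le]
          ring
      _ = _ := by
          rw [← Real.rpow_add_of_nonneg (norm_nonneg _) (by positivity)
            (mul_nonneg hs₀.le (by linarith))]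
          congr 3
          rw [smoothExp, hθ, ← hα]; ring
  have h1 : a ≤ A * min 1 (τ ^ (-α) * ‖h‖ ^ smoothExp s) := by
    rcases min_choice 1 (τ ^ (-α) * ‖h‖ ^ smoothExp s) with e | e <;> rw [e]
    · simpa using hA1
    · exact hXY
  refine h1.trans ?_
  rw [mul_assoc]
  gcongr
  exact min_one_mul_le (by positivity) (by positivity)

lemma exists_heatA_le_sing (hn : 0 < n) {s : ℝ} (hs₀ : 0 < s) (hs₁ : s < 1) (M K : ℝ) :
    ∃ C, 0 ≤ C ∧ ∀ u : E n → ℝ, Continuous u → (∀ x, |u x| ≤ M) →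
      (∀ x h, ‖secondDiff u x h‖ ≤ K * min 1 (‖h‖ ^ s)) → ∀ τ, 0 < τ → ∀ x,
      |heatA s τ u x| ≤ C * sing s τ := by
  obtain ⟨C, hC0, hC⟩ := exists_secondDiff_heat_le_sing (n := n) hs₀ hs₁ M K
  have hw : 0 ≤ ∫ h : E n, weight s (smoothExp s) h := integral_nonneg fun _ => weight_nonneg _ _ _
  refine ⟨|fracConst n s / 2| * (C * ∫ h : E n, weight s (smoothExp s) h), by positivity,
    fun u hu hM hK τ hτ x => ?_⟩
  rw [← fracOp_heat hn hs₀ hs₁ hu hM hτ]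
  refine (norm_fracOp_le hn hs₀ (two_mul_lt_smoothExp hs₀ hs₁) (hC u hu hM hK τ hτ x)).trans (le_of_eq ?_)
  ring

/-- The mild solution of `∂ₜz + (-Δ)^s z = F`, `z(·,0) = φ`. -/
def mild (s : ℝ) (φ : E n → ℝ) (F : E n → ℝ → ℝ) (x : E n) (t : ℝ) : ℝ :=
  heat s t φ x + ∫ r in 0..t, heat s (t - r) (fun y => F y r) x

/-- The fractional Laplacian of the mild solution. -/
def mildA (s : ℝ) (φ : E n → ℝ) (F : E n → ℝ → ℝ) (x : E n) (t : ℝ) : ℝ :=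
  heatA s t φ x + ∫ r in 0..t, heatA s (t - r) (fun y => F y r) x

/-- Bounded continuous sources with uniformly Hölder type slices. -/
structure GoodSource (s M K : ℝ) (F : E n → ℝ → ℝ) : Prop where
  cont : Continuous fun z : E n × ℝ => F z.1 z.2
  bdd : ∀ x t, |F x t| ≤ M
  holder : ∀ t x h, ‖secondDiff (fun y => F y t) x h‖ ≤ K * min 1 (‖h‖ ^ s)

section

variable {s : ℝ} {φ : E n → ℝ} {F : E n → ℝ → ℝ} {M K : ℝ}

lemma GoodSource.slice (hF : GoodSource s M K F) (t : ℝ) : Continuous fun y => F y t :=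
  hF.cont.comp (by fun_prop : Continuous fun y : E n => (y, t))

lemma GoodSource.continuous_heat_sub (hs₀ : 0 < s) (hs₁ : s < 1) (hF : GoodSource s M K F) :
    Continuous fun w : (E n × ℝ) × ℝ => heat s (w.1.2 - w.2) (fun y => F y w.2) w.1.1 :=
  (continuous_heat_family hs₀ hs₁ hF.cont hF.bdd).comp
    (by fun_prop : Continuous fun w : (E n × ℝ) × ℝ => ((w.1.1, w.2), w.1.2 - w.2))

lemma continuous_mild (hs₀ : 0 < s) (hs₁ : s < 1) (hφ : Continuous φ) (hφM : ∀ x, |φ x| ≤ M)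
    (hF : GoodSource s M K F) : Continuous fun z : E n × ℝ => mild s φ F z.1 z.2 := by
  refine (continuous_heat hs₀ hs₁ hφ hφM).add ?_
  exact intervalIntegral.continuous_parametric_intervalIntegral_of_continuous
    (f := fun (z : E n × ℝ) r => heat s (z.2 - r) (fun y => F y r) z.1)
    (hF.continuous_heat_sub hs₀ hs₁) continuous_snd

lemma mild_zero (hs₀ : 0 < s) (hs₁ : s < 1) (x : E n) : mild s φ F x 0 = φ x := by
  simp [mild, heat_zero hs₀ hs₁]

lemma abs_mild_le (hs₀ : 0 < s) (hs₁ : s < 1) (hφM : ∀ x, |φ x| ≤ M)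
    (hF : GoodSource s M K F) {t : ℝ} (ht : 0 ≤ t) (x : E n) :
    |mild s φ F x t| ≤ (∫ y : E n, |hk s 1 y|) * M * (1 + t) := by
  refine (abs_add_le _ _).trans ?_
  have h2 := intervalIntegral.norm_integral_le_of_norm_le_const (a := 0) (b := t)
    (f := fun r => heat s (t - r) (fun y => F y r) x) (C := (∫ y : E n, |hk s 1 y|) * M)
    fun r _ => abs_heat_le hs₀ hs₁ (fun y => hF.bdd y r) _ x
  rw [sub_zero, abs_of_nonneg ht] at h2
  have h1 := abs_heat_le hs₀ hs₁ hφM t x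
  rw [Real.norm_eq_abs] at h2
  linarith

lemma GoodSource.stronglyMeasurable_heatA (hn : 0 < n) (hs₀ : 0 < s) (hs₁ : s < 1)
    (hF : GoodSource s M K F) (x : E n) (t : ℝ) : AEStronglyMeasurable
      (fun r => heatA s (t - r) (fun y => F y r) x) (volume.restrict (Ioo 0 t)) := by
  refine ContinuousOn.aestronglyMeasurable ?_ measurableSet_Ioo
  exact (continuousOn_heatA_family hn hs₀ hs₁ hF.cont hF.bdd).comp
    (by fun_prop : Continuous fun r : ℝ => ((x, r), t - r)).continuousOn
    fun r hr => sub_pos.2 hr.2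

lemma intervalIntegrable_sing_sub (hs₁ : s < 1) (t : ℝ) :
    IntervalIntegrable (fun r => sing s (t - r)) volume 0 t := by
  have := (intervalIntegrable_sing hs₁ t 0).comp_sub_left t
  simpa using this

lemma GoodSource.intervalIntegrable_heatA (hn : 0 < n) (hs₀ : 0 < s) (hs₁ : s < 1)
    (hF : GoodSource s M K F) (x : E n) {t : ℝ} (ht : 0 ≤ t) :
    IntervalIntegrable (fun r => heatA s (t - r) (fun y => F y r) x) volume 0 t := by
  obtain ⟨C, hC0, hC⟩ := exists_heatA_le_sing hn hs₀ hs₁ M K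
  have hi := (intervalIntegrable_sing_sub hs₁ t).const_mul C
  rw [intervalIntegrable_iff_integrableOn_Ioo_of_le ht] at hi ⊢
  refine hi.mono' (hF.stronglyMeasurable_heatA hn hs₀ hs₁ x t) ?_
  refine (ae_restrict_iff' measurableSet_Ioo).2 (Eventually.of_forall fun r hr => ?_)
  exact hC _ (hF.slice r) (fun y => hF.bdd y r) (hF.holder r) _ (sub_pos.2 hr.2) x

lemma intervalIntegrable_heatA (hn : 0 < n) (hs₀ : 0 < s) (hs₁ : s < 1) {u : E n → ℝ}
    (hu : Continuous u) (hM : ∀ x, |u x| ≤ M) (hK : ∀ x h, ‖secondDiff u x h‖ ≤ K * min 1 (‖h‖ ^ s))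
    (x : E n) {t : ℝ} (ht : 0 ≤ t) : IntervalIntegrable (fun τ => heatA s τ u x) volume 0 t := by
  have hF : GoodSource s M K (fun y (_ : ℝ) => u y) := ⟨by fun_prop, fun x _ => hM x, fun _ => hK⟩
  have := ((hF.intervalIntegrable_heatA hn hs₀ hs₁ x ht).comp_sub_left t).symm
  simpa using this

lemma heat_eq_sub_integral (hn : 0 < n) (hs₀ : 0 < s) (hs₁ : s < 1) {u : E n → ℝ}
    (hu : Continuous u) (hM : ∀ x, |u x| ≤ M) (hK : ∀ x h, ‖secondDiff u x h‖ ≤ K * min 1 (‖h‖ ^ s))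
    (x : E n) {t : ℝ} (ht : 0 ≤ t) : heat s t u x = u x - ∫ τ in 0..t, heatA s τ u x := by
  have hc : Continuous fun r => heat s r u x :=
    (continuous_heat hs₀ hs₁ hu hM).comp (by fun_prop : Continuous fun r : ℝ => (x, r))
  have h := intervalIntegral.integral_eq_sub_of_hasDerivAt_of_le ht hc.continuousOn
    (fun r hr => hasDerivAt_heat hn hs₀ hs₁ hu hM hr.1 x)
    (intervalIntegrable_heatA hn hs₀ hs₁ hu hM hK x ht).neg
  rw [intervalIntegral.integral_neg, heat_zero hs₀ hs₁] at h
  linarith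

lemma tendsto_integral_sing (hs₁ : s < 1) :
    Tendsto (fun ε => ∫ τ in 0..ε, sing s τ) (𝓝 0) (𝓝 0) := by
  have := (intervalIntegral.continuous_primitive (intervalIntegrable_sing hs₁) 0).tendsto 0
  simpa using this

/-- Replacing t - r by max(t - r, ε) gives a jointly continuous integral. As `sing` is decreasing,
the error is at most 2C∫₀^ε `sing`, which tends to zero uniformly in space and time. -/
lemma continuousOn_duhamelA (hn : 0 < n) (hs₀ : 0 < s) (hs₁ : s < 1) (hF : GoodSource s M K F) :
    ContinuousOn (fun z : E n × ℝ => ∫ r in 0..z.2, heatA s (z.2 - r) (fun y => F y r) z.1)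
      {z | 0 ≤ z.2} := by
  obtain ⟨C, hC0, hC⟩ := exists_heatA_le_sing hn hs₀ hs₁ M K
  have hH : ∀ r τ (x : E n), 0 < τ → |heatA s τ (fun y => F y r) x| ≤ C * sing s τ :=
    fun r τ x hτ => hC _ (hF.slice r) (fun y => hF.bdd y r) (hF.holder r) _ hτ x
  refine continuousOn_of_uniform_approx_of_continuousOn fun U hU => ?_
  obtain ⟨δ, hδ, hU⟩ := Metric.mem_uniformity_dist.1 hU
  have hlim : Tendsto (fun ε => 2 * C * ∫ τ in 0..ε, sing s τ) (𝓝[>] 0) (𝓝 0) := by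
    simpa using ((tendsto_integral_sing hs₁).const_mul (2 * C)).mono_left nhdsWithin_le_nhds
  obtain ⟨ε, hεδ, hε⟩ := ((hlim.eventually_lt_const hδ).and self_mem_nhdsWithin).exists
  have hcont : Continuous fun w : (E n × ℝ) × ℝ =>
      heatA s (max (w.1.2 - w.2) ε) (fun y => F y w.2) w.1.1 :=
    (continuousOn_heatA_family hn hs₀ hs₁ hF.cont hF.bdd).comp_continuous
      (by fun_prop : Continuous fun w : (E n × ℝ) × ℝ => ((w.1.1, w.2), max (w.1.2 - w.2) ε))
      fun w => lt_of_lt_of_le hε (le_max_right _ _)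
  refine ⟨fun z => ∫ r in 0..z.2, heatA s (max (z.2 - r) ε) (fun y => F y r) z.1,
    (intervalIntegral.continuous_parametric_intervalIntegral_of_continuous
      (f := fun (z : E n × ℝ) r => heatA s (max (z.2 - r) ε) (fun y => F y r) z.1)
      hcont continuous_snd).continuousOn, fun z hz => hU ?_⟩
  obtain ⟨x, t⟩ := z
  have ht : 0 ≤ t := hz
  simp only
  have hci : IntervalIntegrable (fun r => heatA s (max (t - r) ε) (fun y => F y r) x) volume 0 t :=
    (hcont.comp (by fun_prop : Continuous fun r : ℝ => ((x, t), r))).intervalIntegrable _ _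
  rw [Real.dist_eq, ← intervalIntegral.integral_sub (hF.intervalIntegrable_heatA hn hs₀ hs₁ x ht) hci]
  refine lt_of_le_of_lt ?_ hεδ
  set B : ℝ → ℝ := indicator (Ioc 0 ε) fun τ => 2 * C * sing s τ with hB
  have hB0 : ∀ τ, 0 ≤ B τ := indicator_nonneg fun τ hτ => by
    have := sing_nonneg (s := s) hτ.1.le
    positivity
  have hBi : Integrable B :=
    (((intervalIntegrable_sing hs₁ 0 ε).const_mul (2 * C)).1).integrable_indicator measurableSet_Ioc
  have hb : ∀ r ∈ Ioo 0 t, ‖heatA s (t - r) (fun y => F y r) x -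
      heatA s (max (t - r) ε) (fun y => F y r) x‖ ≤ B (t - r) := by
    intro r hr
    have hp : 0 < t - r := sub_pos.2 hr.2
    rcases le_or_gt (t - r) ε with h | h
    · rw [hB, indicator_of_mem (by exact ⟨hp, h⟩), max_eq_right h]
      have h1 := hH r (t - r) x hp
      have h2 := hH r ε x hε
      have h3 := sing_anti (s := s) hs₀ hp h
      have h4 : C * sing s ε ≤ C * sing s (t - r) := by gcongr
      refine (norm_sub_le _ _).trans ?_
      rw [Real.norm_eq_abs, Real.norm_eq_abs]
      linarith
    · rw [max_eq_left h.le, sub_self, norm_zero]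
      exact hB0 _
  rw [intervalIntegral.integral_of_le ht, integral_Ioc_eq_integral_Ioo, ← Real.norm_eq_abs]
  calc _ ≤ ∫ r in Ioo 0 t, B (t - r) :=
        norm_integral_le_of_norm_le (hBi.comp_sub_left t).integrableOn
          ((ae_restrict_iff' measurableSet_Ioo).2 (Eventually.of_forall hb))
    _ ≤ ∫ r, B (t - r) :=
        setIntegral_le_integral (hBi.comp_sub_left t) (Eventually.of_forall fun r => hB0 _)
    _ = ∫ r, B r := integral_sub_left_eq_self B volume t
    _ = _ := by
        rw [hB, integral_indicator measurableSet_Ioc, integral_const_mul,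
          intervalIntegral.integral_of_le hε.le]

lemma continuousOn_mildA (hn : 0 < n) (hs₀ : 0 < s) (hs₁ : s < 1) (hφ : Continuous φ)
    (hφM : ∀ x, |φ x| ≤ M) (hF : GoodSource s M K F) :
    ContinuousOn (fun z : E n × ℝ => mildA s φ F z.1 z.2) {z | 0 < z.2} :=
  (continuousOn_heatA hn hs₀ hs₁ hφ hφM).add
    ((continuousOn_duhamelA hn hs₀ hs₁ hF).mono fun z (hz : 0 < z.2) => hz.le)

/-- Insert S(τ)u = u - ∫₀^τ (-Δ)^s S u into Duhamel's integral and exchange the order over the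
triangle r < ρ < t. Every dependence on t is then in an upper limit, and the inner integral is
continuous in ρ, so the fundamental theorem of calculus yields the time derivative. -/
lemma integral_heat_sub_eq (hn : 0 < n) (hs₀ : 0 < s) (hs₁ : s < 1) (hF : GoodSource s M K F)
    (x : E n) {t : ℝ} (ht : 0 ≤ t) :
    ∫ r in 0..t, heat s (t - r) (fun y => F y r) x =
      (∫ r in 0..t, F x r) - ∫ ρ in 0..t, ∫ r in 0..ρ, heatA s (ρ - r) (fun y => F y r) x := by
  obtain ⟨C, hC0, hC⟩ := exists_heatA_le_sing hn hs₀ hs₁ M K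
  have hH : ∀ r τ (x : E n), 0 < τ → |heatA s τ (fun y => F y r) x| ≤ C * sing s τ :=
    fun r τ x hτ => hC _ (hF.slice r) (fun y => hF.bdd y r) (hF.holder r) _ hτ x
  set k : ℝ × ℝ → ℝ := indicator {p | p.2 < p.1}
    fun p => heatA s (p.1 - p.2) (fun y => F y p.2) x with hk
  have hms : MeasurableSet {p : ℝ × ℝ | p.2 < p.1} := measurableSet_lt measurable_snd measurable_fst
  set μ := volume.restrict (Ioc 0 t) with hμ
  have hkm : AEStronglyMeasurable k (μ.prod μ) := by
    refine (aestronglyMeasurable_indicator_iff hms).2 (ContinuousOn.aestronglyMeasurable ?_ hms)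
    exact (continuousOn_heatA_family hn hs₀ hs₁ hF.cont hF.bdd).comp
      (by fun_prop : Continuous fun p : ℝ × ℝ => ((x, p.2), p.1 - p.2)).continuousOn
      fun p (hp : p.2 < p.1) => show 0 < p.1 - p.2 from sub_pos.2 hp
  set g : ℝ → ℝ := indicator (Ioc 0 t) fun τ => C * sing s τ with hg
  have hg0 : ∀ τ, 0 ≤ g τ := indicator_nonneg fun τ hτ => by
    have := sing_nonneg (s := s) hτ.1.le
    positivity
  have hgi : Integrable g :=
    (((intervalIntegrable_sing hs₁ 0 t).const_mul C).1).integrable_indicator measurableSet_Ioc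
  have hki : Integrable k (μ.prod μ) := by
    -- The majorant g(ρ - r) is a convolution integrand of two integrable functions, hence
    -- integrable on the square.
    have h1 : Integrable (fun _ : ℝ => (1 : ℝ)) μ := integrable_const _
    have h2 := h1.convolution_integrand (ContinuousLinearMap.mul ℝ ℝ) hgi
    have h3 : Integrable (fun p : ℝ × ℝ => g (p.1 - p.2)) (μ.prod μ) := by
      simp only [ContinuousLinearMap.mul_apply', one_mul] at h2
      exact h2.mono_measure (Measure.prod_mono Measure.restrict_le_self le_rfl)
    refine h3.mono' hkm ?_
    have e : μ.prod μ = (volume.prod volume).restrict (Ioc 0 t ×ˢ Ioc 0 t) := Measure.prod_restrict _ _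
    rw [e]
    refine (ae_restrict_iff' (measurableSet_Ioc.prod measurableSet_Ioc)).2
      (Eventually.of_forall fun p hp => ?_)
    by_cases h : p.2 < p.1
    · rw [hk, indicator_of_mem (by exact h), hg, indicator_of_mem]
      · exact hH _ _ _ (sub_pos.2 h)
      · exact ⟨sub_pos.2 h, by linarith [hp.1.2, hp.2.1]⟩
    · rw [hk, indicator_of_notMem (by exact h), norm_zero]
      exact hg0 _
  have hswap := integral_integral_swap (f := fun ρ r => k (ρ, r)) hki
  have e1 : ∀ ρ ∈ Ioc 0 t, ∫ r, k (ρ, r) ∂μ = ∫ r in 0..ρ, heatA s (ρ - r) (fun y => F y r) x := by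
    intro ρ hρ
    have : (fun r => k (ρ, r)) = indicator (Iio ρ) fun r => heatA s (ρ - r) (fun y => F y r) x := by
      ext r; simp only [hk, indicator]; rfl
    rw [this, integral_indicator measurableSet_Iio, Measure.restrict_restrict measurableSet_Iio,
      intervalIntegral.integral_of_le hρ.1.le, integral_Ioc_eq_integral_Ioo]
    congr 2
    ext r; simp only [mem_inter_iff, mem_Iio, mem_Ioc, mem_Ioo]
    constructor
    · rintro ⟨a, b, -⟩; exact ⟨b, a⟩
    · rintro ⟨a, b⟩; exact ⟨b, a, b.le.trans hρ.2⟩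
  have e2 : ∀ r ∈ Ioc 0 t, ∫ ρ, k (ρ, r) ∂μ = F x r - heat s (t - r) (fun y => F y r) x := by
    intro r hr
    have : (fun ρ => k (ρ, r)) = indicator (Ioi r) fun ρ => heatA s (ρ - r) (fun y => F y r) x := by
      ext ρ; simp only [hk, indicator]; rfl
    rw [heat_eq_sub_integral hn hs₀ hs₁ (hF.slice r) (fun y => hF.bdd y r) (hF.holder r) x
      (sub_nonneg.2 hr.2), this, integral_indicator measurableSet_Ioi,
      Measure.restrict_restrict measurableSet_Ioi]
    have hs : Ioi r ∩ Ioc 0 t = Ioc r t := by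
      ext ρ; simp only [mem_inter_iff, mem_Ioi, mem_Ioc]
      constructor
      · rintro ⟨a, -, b⟩; exact ⟨a, b⟩
      · rintro ⟨a, b⟩; exact ⟨a, hr.1.trans a, b⟩
    rw [hs, ← intervalIntegral.integral_of_le hr.2,
      intervalIntegral.integral_comp_sub_right (fun τ => heatA s τ (fun y => F y r) x) r, sub_self]
    ring
  have hFi : IntervalIntegrable (fun r => F x r) volume 0 t :=
    (hF.cont.comp (by fun_prop : Continuous fun r : ℝ => (x, r))).intervalIntegrable _ _
  have hGi : IntervalIntegrable (fun r => heat s (t - r) (fun y => F y r) x) volume 0 t :=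
    ((hF.continuous_heat_sub hs₀ hs₁).comp
      (by fun_prop : Continuous fun r : ℝ => ((x, t), r))).intervalIntegrable _ _
  have e3 : ∫ ρ in 0..t, ∫ r in 0..ρ, heatA s (ρ - r) (fun y => F y r) x =
      ∫ r in 0..t, (F x r - heat s (t - r) (fun y => F y r) x) := by
    rw [intervalIntegral.integral_of_le ht, intervalIntegral.integral_of_le ht,
      ← setIntegral_congr_fun measurableSet_Ioc e1, ← setIntegral_congr_fun measurableSet_Ioc e2]
    exact hswap
  rw [e3, intervalIntegral.integral_sub hFi hGi]
  ring

lemma hasDerivAt_mild (hn : 0 < n) (hs₀ : 0 < s) (hs₁ : s < 1) (hφ : Continuous φ)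
    (hφM : ∀ x, |φ x| ≤ M) (hF : GoodSource s M K F) {t : ℝ} (ht : 0 < t) (x : E n) :
    HasDerivAt (mild s φ F x) (F x t - mildA s φ F x t) t := by
  have hcF : Continuous fun r => F x r := hF.cont.comp (by fun_prop : Continuous fun r : ℝ => (x, r))
  have hcJ : ContinuousOn (fun ρ => ∫ r in 0..ρ, heatA s (ρ - r) (fun y => F y r) x) (Ici 0) :=
    (continuousOn_duhamelA hn hs₀ hs₁ hF).comp
      (by fun_prop : Continuous fun r : ℝ => (x, r)).continuousOn fun r hr => hr
  have h1 : HasDerivAt (fun t => ∫ r in 0..t, F x r) (F x t) t :=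
    intervalIntegral.integral_hasDerivAt_right (hcF.intervalIntegrable _ _)
      hcF.stronglyMeasurable.stronglyMeasurableAtFilter hcF.continuousAt
  have h2 : HasDerivAt (fun t => ∫ ρ in 0..t, ∫ r in 0..ρ, heatA s (ρ - r) (fun y => F y r) x)
      (∫ r in 0..t, heatA s (t - r) (fun y => F y r) x) t :=
    intervalIntegral.integral_hasDerivAt_right
      (hcJ.mono (by rw [uIcc_of_le ht.le]; exact Icc_subset_Ici_self)).intervalIntegrable
      ((hcJ.mono Ioi_subset_Ici_self).stronglyMeasurableAtFilter isOpen_Ioi t ht)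
      (hcJ.continuousAt (Ici_mem_nhds ht))
  have h3 := (hasDerivAt_heat hn hs₀ hs₁ hφ hφM ht x).add (h1.sub h2)
  have e : F x t - mildA s φ F x t = -heatA s t φ x +
      (F x t - ∫ r in 0..t, heatA s (t - r) (fun y => F y r) x) := by
    rw [mildA]; ring
  rw [e]
  refine h3.congr_of_eventuallyEq ?_
  filter_upwards [Ioi_mem_nhds ht] with b hb
  have := integral_heat_sub_eq hn hs₀ hs₁ hF x (le_of_lt hb)
  rw [mild, this]
  rfl

/-- Both summands have second differences O(|h|^γ) with γ = `smoothExp s` > 2s: the free part by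
smoothing at the fixed time t, the Duhamel part because the constant C `sing`(t-r) is integrable in
r. The principal value exists, and the operator passes under the time integral. -/
lemma hasFracLaplacianAt_mild (hn : 0 < n) (hs₀ : 0 < s) (hs₁ : s < 1) (hφ : Continuous φ)
    (hφM : ∀ x, |φ x| ≤ M) (hF : GoodSource s M K F) {t : ℝ} (ht : 0 < t) (x : E n) :
    HasFracLaplacianAt s (fun y => mild s φ F y t) x (mildA s φ F x t) := by
  obtain ⟨C₁, hC₁0, hC₁⟩ := exists_secondDiff_heat_le (n := n) hs₀ hs₁
  obtain ⟨C, hC0, hC⟩ := exists_secondDiff_heat_le_sing (n := n) hs₀ hs₁ M K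
  have hM0 : 0 ≤ M := (abs_nonneg _).trans (hφM 0)
  have hp := scl_pos s ht
  set γ := smoothExp s with hγ
  have hγs := two_mul_lt_smoothExp hs₀ hs₁
  have hγ0 : 0 < γ := by linarith
  -- Needed to weaken the order 2 bound of the free part to order γ for |h| ≤ 1.
  have hγ2 : γ ≤ 2 := by
    rw [hγ, smoothExp]
    have h1 : (3 + s) / 4 * (2 - s) ≤ 2 - s := by nlinarith
    have h2 : 0 ≤ (1 - s) * (2 - s) := mul_nonneg (by linarith) (by linarith)
    nlinarith
  set μ := volume.restrict (Ioo 0 t) with hμ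
  set W : ℝ → E n → ℝ := fun r z => heat s (t - r) (fun y => F y r) z with hW
  have hWc : Continuous fun p : ℝ × E n => W p.1 p.2 :=
    (hF.continuous_heat_sub hs₀ hs₁).comp (by fun_prop : Continuous fun p : ℝ × E n => ((p.2, t), p.1))
  have hWi : ∀ z, Integrable (fun r => W r z) μ := fun z =>
    (((hWc.comp (by fun_prop : Continuous fun r : ℝ => (r, z))).continuousOn).integrableOn_Icc).mono_set
      Ioo_subset_Icc_self
  have hB : Integrable (fun r => C * sing s (t - r)) μ := by
    have := (intervalIntegrable_sing_sub hs₁ t).const_mul C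
    rwa [intervalIntegrable_iff_integrableOn_Ioo_of_le ht.le] at this
  have hCW : ∀ᵐ r ∂μ, ∀ h, ‖secondDiff (W r) x h‖ ≤ C * sing s (t - r) * min 1 (‖h‖ ^ γ) :=
    (ae_restrict_iff' measurableSet_Ioo).2 (Eventually.of_forall fun r hr h =>
      hC _ (hF.slice r) (fun y => hF.bdd y r) (hF.holder r) _ (sub_pos.2 hr.2) x h)
  have hsplit : (fun y => mild s φ F y t) = fun y => heat s t φ y + ∫ r, W r y ∂μ := by
    ext y
    rw [mild, intervalIntegral.integral_of_le ht.le, integral_Ioc_eq_integral_Ioo]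
  have hd1 : ∀ h, ‖secondDiff (heat s t φ) x h‖ ≤
      M * C₁ * (1 + (scl s t)⁻¹ ^ (2 : ℝ)) * min 1 (‖h‖ ^ γ) := by
    intro h
    refine (hC₁ hφ hφM ht x h).trans ?_
    rw [div_eq_inv_mul, Real.mul_rpow (by positivity) (norm_nonneg _), mul_assoc, mul_assoc]
    gcongr
    refine (min_one_mul_le (by positivity) (by positivity)).trans ?_
    gcongr (1 + (scl s t)⁻¹ ^ (2 : ℝ)) * ?_
    rcases le_total 1 ‖h‖ with hh | hh
    · rw [min_eq_left (Real.one_le_rpow hh hγ0.le)]; exact min_le_left _ _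
    · rw [min_eq_right (Real.rpow_le_one (norm_nonneg _) hh hγ0.le)]
      refine (min_le_right _ _).trans ?_
      rcases (norm_nonneg h).eq_or_lt with h0 | h0
      · rw [← h0, Real.zero_rpow two_ne_zero, Real.zero_rpow hγ0.ne']
      · exact Real.rpow_le_rpow_of_exponent_ge h0 hh hγ2
  have hd2 := norm_secondDiff_integral_le hB hWi hCW
  have hsd : ∀ h, secondDiff (fun y => mild s φ F y t) x h =
      secondDiff (heat s t φ) x h + secondDiff (fun z => ∫ r, W r z ∂μ) x h := by
    intro h; rw [hsplit]; simp only [secondDiff, smul_eq_mul]; ring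
  have hcm : Continuous fun y => mild s φ F y t :=
    (continuous_mild hs₀ hs₁ hφ hφM hF).comp (by fun_prop : Continuous fun y : E n => (y, t))
  have hch : Continuous (heat s t φ) :=
    (continuous_heat hs₀ hs₁ hφ hφM).comp (by fun_prop : Continuous fun y : E n => (y, t))
  have hcW : Continuous fun z => ∫ r, W r z ∂μ := by
    have : (fun z => ∫ r, W r z ∂μ) = fun y => mild s φ F y t - heat s t φ y := by
      ext y
      rw [show mild s φ F y t = _ from congrFun hsplit y]; ring
    rw [this]; exact hcm.sub hch
  have h := hasFracLaplacianAt_of_secondDiff hn hs₀ hγs hcm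
    (abs_mild_le hs₀ hs₁ hφM hF ht.le) (x := x)
    (C := M * C₁ * (1 + (scl s t)⁻¹ ^ (2 : ℝ)) + ∫ r, C * sing s (t - r) ∂μ) fun h => by
      rw [hsd, add_mul]
      exact (norm_add_le _ _).trans (add_le_add (hd1 h) (hd2 h))
  have e : fracOp s (fun y => mild s φ F y t) x = mildA s φ F x t := by
    have e1 : fracOp s (fun z => ∫ r, W r z ∂μ) x = ∫ r, fracOp s (W r) x ∂μ :=
      fracOp_integral hn hs₀ hγs hWc.stronglyMeasurable hB hWi hCW
    have e2 : ∫ r, fracOp s (W r) x ∂μ = ∫ r in 0..t, heatA s (t - r) (fun y => F y r) x := by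
      rw [intervalIntegral.integral_of_le ht.le, integral_Ioc_eq_integral_Ioo]
      refine setIntegral_congr_fun measurableSet_Ioo fun r hr => ?_
      exact fracOp_heat hn hs₀ hs₁ (hF.slice r) (fun y => hF.bdd y r) (sub_pos.2 hr.2) x
    rw [mildA, ← e2, ← e1, ← fracOp_heat hn hs₀ hs₁ hφ hφM ht]
    unfold fracOp
    simp_rw [hsd, smul_add]
    rw [integral_add (integrable_kerW_smul_secondDiff hn hs₀ hγs hch hd1)
      (integrable_kerW_smul_secondDiff hn hs₀ hγs hcW hd2), smul_add]
  rwa [e] at h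

end

end

/-! ### The maximum principle and uniqueness -/

section

variable {n : ℕ}

section

variable {s : ℝ} {u v : E n → ℝ} {x : E n} {ℓ m : ℝ}

lemma HasFracLaplacianAt.const_mul (h : HasFracLaplacianAt s u x ℓ) (c : ℝ) :
    HasFracLaplacianAt s (fun y => c * u y) x (c * ℓ) := by
  have e : ∀ y, (c * u x - c * u y) / ‖x - y‖ ^ ((n : ℝ) + 2 * s) =
      c * ((u x - u y) / ‖x - y‖ ^ ((n : ℝ) + 2 * s)) := fun y => by ring
  unfold HasFracLaplacianAt
  simp_rw [e]
  refine ⟨fun ε hε => (h.1 ε hε).const_mul c, ?_⟩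
  refine (h.2.const_mul c).congr fun ε => ?_
  rw [integral_const_mul]; ring

lemma HasFracLaplacianAt.add (h : HasFracLaplacianAt s u x ℓ) (h' : HasFracLaplacianAt s v x m) :
    HasFracLaplacianAt s (fun y => u y + v y) x (ℓ + m) := by
  have e : ∀ y, (u x + v x - (u y + v y)) / ‖x - y‖ ^ ((n : ℝ) + 2 * s) =
      (u x - u y) / ‖x - y‖ ^ ((n : ℝ) + 2 * s) + (v x - v y) / ‖x - y‖ ^ ((n : ℝ) + 2 * s) :=
    fun y => by ring
  unfold HasFracLaplacianAt
  simp_rw [e]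
  refine ⟨fun ε hε => (h.1 ε hε).add (h'.1 ε hε), ?_⟩
  refine (h.2.add h'.2).congr' ?_
  filter_upwards [self_mem_nhdsWithin] with ε hε
  rw [integral_add (h.1 ε hε) (h'.1 ε hε)]; ring

lemma HasFracLaplacianAt.nonneg_of_isMax (hs₀ : 0 < s) (hs₁ : s < 1)
    (h : HasFracLaplacianAt s u x ℓ) (hmax : ∀ y, u y ≤ u x) : 0 ≤ ℓ := by
  refine ge_of_tendsto' h.2 fun ε => mul_nonneg (fracConst_pos hs₀ hs₁).le ?_
  exact integral_nonneg fun y => div_nonneg (sub_nonneg.2 (hmax y)) (by positivity)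

end

/-- A cut-off function whose translates have uniformly bounded fractional Laplacians. -/
lemma exists_bump (hn : 0 < n) {s : ℝ} (hs₀ : 0 < s) (hs₁ : s < 1) :
    ∃ (χ : E n → ℝ) (C : ℝ), Continuous χ ∧ (∀ x, 0 ≤ χ x) ∧ (∀ x, χ x ≤ 1) ∧ χ 0 = 1 ∧
      (∀ x, 1 ≤ ‖x‖ → χ x = 0) ∧ 0 ≤ C ∧
      ∀ a x, ∃ ℓ, HasFracLaplacianAt s (fun y => χ (y - a)) x ℓ ∧ |ℓ| ≤ C := by
  let b : ContDiffBump (0 : E n) := ⟨1 / 2, 1, by norm_num, by norm_num⟩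
  let χ : 𝓢(E n, ℝ) := b.hasCompactSupport.toSchwartzMap b.contDiff
  have hχ : ∀ x, χ x = b x := fun x => rfl
  have h0 : ∀ x, 0 ≤ χ x := fun x => b.nonneg
  have h1 : ∀ x, χ x ≤ 1 := fun x => b.le_one
  have hsd : ∃ C, ∀ x h : E n, ‖secondDiff χ x h‖ ≤ C * min 1 (‖h‖ ^ (2 : ℝ)) := by
    refine ⟨∫ ξ, ‖𝓕 (complexify χ : E n → ℂ) ξ‖ * (4 + (2 * Real.pi * ‖ξ‖) ^ 2), fun x h => ?_⟩
    have := norm_secondDiff_fourierInv_le (H := fun ξ => 𝓕 (complexify χ : E n → ℂ) ξ)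
      (by rw [← SchwartzMap.fourier_coe]; exact (𝓕 (complexify χ)).integrable)
      (by rw [← SchwartzMap.fourier_coe]; exact (𝓕 (complexify χ)).integrable_pow_mul volume 2) x h
    rw [fourierInv_fourier_schwartz] at this
    refine le_trans (le_of_eq ?_) this
    rw [← Complex.norm_real, ← secondDiff_ofReal]
    rfl
  obtain ⟨C, hC⟩ := hsd
  refine ⟨χ, |fracConst n s / 2| * (|C| * ∫ h : E n, weight s 2 h), χ.continuous, h0, h1, ?_, ?_, ?_, ?_⟩
  · rw [hχ]; exact b.one_of_mem_closedBall (by simp [b])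
  · intro x hx
    rw [hχ]; exact b.zero_of_le_dist (by simpa [b] using hx)
  · have : 0 ≤ ∫ h : E n, weight s 2 h := integral_nonneg fun _ => weight_nonneg _ _ _
    positivity
  · intro a x
    have hC' : ∀ h, ‖secondDiff (fun y => χ (y - a)) x h‖ ≤ |C| * min 1 (‖h‖ ^ (2 : ℝ)) := fun h => by
      rw [secondDiff_comp_sub]
      refine (hC _ h).trans ?_
      gcongr
      exact le_abs_self C
    have hc : Continuous fun y => χ (y - a) := χ.continuous.comp (continuous_id.sub continuous_const)
    exact ⟨_, hasFracLaplacianAt_of_secondDiff hn hs₀ (γ := 2) (by linarith) hc (M := 1)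
      (fun y => by rw [abs_of_nonneg (h0 _)]; exact h1 _) hC',
      norm_fracOp_le hn hs₀ (by linarith) hC'⟩

lemma deriv_nonneg_of_isMaxOn_left {g : ℝ → ℝ} {a t : ℝ} (hat : a < t) (hd : DifferentiableAt ℝ g t)
    (hmax : ∀ r ∈ Icc a t, g r ≤ g t) : 0 ≤ deriv g t := by
  have h := hd.hasDerivAt.hasDerivWithinAt (s := Iio t)
  rw [hasDerivWithinAt_iff_tendsto_slope' (by simp)] at h
  refine ge_of_tendsto h ?_
  filter_upwards [Ioo_mem_nhdsLT hat] with r hr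
  rw [slope_def_field]
  exact div_nonneg_of_nonpos (sub_nonpos.2 (hmax r ⟨hr.1.le, hr.2.le⟩)) (sub_nonpos.2 hr.2.le)

/-- The maximum principle, with a strict inequality and up to a time where the equation holds. -/
lemma nonpos_of_strict_subsolution (hn : 0 < n) {s : ℝ} (hs₀ : 0 < s) (hs₁ : s < 1) {a b ε B : ℝ}
    (hε : 0 < ε) {v : E n → ℝ → ℝ}
    (hc : ContinuousOn (fun z : E n × ℝ => v z.1 z.2) (univ ×ˢ Icc a b))
    (hB : ∀ x, ∀ t ∈ Icc a b, v x t ≤ B)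
    (hd : ∀ x, ∀ t ∈ Ioc a b, DifferentiableAt ℝ (v x) t)
    (heq : ∀ x, ∀ t ∈ Ioc a b, ∃ ℓ, HasFracLaplacianAt s (fun y => v y t) x ℓ ∧
      deriv (v x) t + ℓ ≤ -ε)
    (h0 : ∀ x, v x a ≤ 0) : ∀ x, ∀ t ∈ Icc a b, v x t ≤ 0 := by
  by_contra! hcon
  obtain ⟨x₀, t₀, ht₀, hpos⟩ := hcon
  obtain ⟨χ, C, hχc, hχ0, hχ1, hχz, hχs, hC0, hχL⟩ := exists_bump (n := n) hn hs₀ hs₁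
  set R : Set ℝ := (fun z : E n × ℝ => v z.1 z.2) '' (univ ×ˢ Icc a b) with hR
  have hRb : BddAbove R := ⟨B, by rintro _ ⟨z, hz, rfl⟩; exact hB _ _ hz.2⟩
  have hle : ∀ x, ∀ t ∈ Icc a b, v x t ≤ sSup R := fun x t ht =>
    le_csSup hRb ⟨(x, t), ⟨mem_univ _, ht⟩, rfl⟩
  set S := sSup R with hS
  have hS0 : 0 < S := hpos.trans_le (hle x₀ t₀ ht₀)
  -- A supremum over the unbounded slab need not be attained, so 2κ times a bump is added at a point
  -- where v > S - κ. The sum exceeds S + κ there but is at most S off the bump, so it has a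
  -- maximum. Since κ < S this maximum is not at the initial time, and 2κC < ε keeps the inequality
  -- strict after the bump is added.
  obtain ⟨κ, hκ, hκS, hκε⟩ : ∃ κ > 0, κ < S ∧ 2 * κ * C < ε := by
    refine ⟨min (S / 2) (ε / (4 * (C + 1))), by positivity, ?_, ?_⟩
    · exact (min_le_left _ _).trans_lt (by linarith)
    · calc 2 * min (S / 2) (ε / (4 * (C + 1))) * C ≤ 2 * (ε / (4 * (C + 1))) * C := by
            gcongr; exact min_le_right _ _
        _ = ε / 2 * (C / (C + 1)) := by field_simp; ring
        _ ≤ ε / 2 * 1 := by gcongr; rw [div_le_one (by positivity)]; linarith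
        _ < ε := by linarith
  obtain ⟨_, ⟨⟨x₁, t₁⟩, hz₁, rfl⟩, hlt⟩ := exists_lt_of_lt_csSup (s := R)
    ⟨_, (x₀, t₀), ⟨mem_univ _, ht₀⟩, rfl⟩ (show S - κ < sSup R by rw [← hS]; linarith)
  simp only at hlt
  set g : E n × ℝ → ℝ := fun z => v z.1 z.2 + 2 * κ * χ (z.1 - x₁) with hg
  have hgc : ContinuousOn g (univ ×ˢ Icc a b) := hc.add (by fun_prop)
  obtain ⟨⟨x₂, t₂⟩, hz₂, hmax⟩ := ((isCompact_closedBall x₁ 1).prod isCompact_Icc).exists_isMaxOn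
    ⟨(x₁, t₁), by simp, hz₁.2⟩ (hgc.mono (prod_mono_left (subset_univ _)))
  have hg1 : S + κ < g (x₁, t₁) := by simp only [hg, sub_self, hχz]; linarith
  have hg2 : S + κ < g (x₂, t₂) := hg1.trans_le (hmax ⟨by simp, hz₁.2⟩)
  have hmax' : ∀ x, ∀ t ∈ Icc a b, g (x, t) ≤ g (x₂, t₂) := by
    intro x t ht
    by_cases hx : x ∈ Metric.closedBall x₁ 1
    · exact hmax ⟨hx, ht⟩
    · have : χ (x - x₁) = 0 := hχs _ (by
        rw [mem_closedBall_iff_norm, not_le] at hx; exact hx.le)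
      simp only [hg, this] at hg2 ⊢
      linarith [hle x t ht]
  have ht₂ : t₂ ∈ Ioc a b := by
    refine ⟨lt_of_le_of_ne hz₂.2.1 ?_, hz₂.2.2⟩
    rintro rfl
    have := h0 x₂
    have h1 := hχ1 (x₂ - x₁)
    simp only [hg] at hg2
    nlinarith
  obtain ⟨ℓ, hℓ, hle'⟩ := heq x₂ t₂ ht₂
  have hder : 0 ≤ deriv (v x₂) t₂ := by
    refine deriv_nonneg_of_isMaxOn_left ht₂.1 (hd x₂ t₂ ht₂) fun r hr => ?_
    have := hmax' x₂ r ⟨hr.1, hr.2.trans ht₂.2⟩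
    simp only [hg] at this
    linarith
  obtain ⟨m, hm, hmC⟩ := hχL x₁ x₂
  have h3 : 0 ≤ ℓ + 2 * κ * m := (hℓ.add (hm.const_mul (2 * κ))).nonneg_of_isMax hs₀ hs₁
    fun y => hmax' y t₂ hz₂.2
  have h4 : 2 * κ * m ≤ 2 * κ * C := by gcongr; exact (le_abs_self m).trans hmC
  linarith

/-- The maximum principle. -/
theorem le_mul_of_subsolution (hn : 0 < n) {s : ℝ} (hs₀ : 0 < s) (hs₁ : s < 1) {a b M B : ℝ}
    {w : E n → ℝ → ℝ} (hc : ContinuousOn (fun z : E n × ℝ => w z.1 z.2) (univ ×ˢ Icc a b))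
    (hB : ∀ x, ∀ t ∈ Icc a b, |w x t| ≤ B)
    (hd : ∀ x, ∀ t ∈ Ioo a b, DifferentiableAt ℝ (w x) t)
    (heq : ∀ x, ∀ t ∈ Ioo a b, ∃ ℓ, HasFracLaplacianAt s (fun y => w y t) x ℓ ∧
      deriv (w x) t + ℓ ≤ M)
    (h0 : ∀ x, w x a ≤ 0) : ∀ x, ∀ t ∈ Icc a b, w x t ≤ M * (t - a) := by
  -- For t < b the equation holds up to and including time t, so the strict version applies to w -
  -- (M+ε)(r-a) on [a,t]. The end point b is reached by continuity.
  have key : ∀ x, ∀ t ∈ Ico a b, w x t ≤ M * (t - a) := by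
    intro x t ht
    refine le_of_forall_pos_le_add fun δ hδ => ?_
    obtain ⟨ε, hε, hεδ⟩ : ∃ ε > 0, ε * (t - a) ≤ δ := by
      refine ⟨δ / (t - a + 1), div_pos hδ (by linarith [ht.1]), ?_⟩
      rw [div_mul_eq_mul_div, div_le_iff₀ (by linarith [ht.1])]
      nlinarith
    have hsub : Icc a t ⊆ Icc a b := Icc_subset_Icc_right ht.2.le
    have hsub' : Ioc a t ⊆ Ioo a b := fun r hr => ⟨hr.1, hr.2.trans_lt ht.2⟩
    have h := nonpos_of_strict_subsolution hn hs₀ hs₁ (a := a) (b := t) (ε := ε)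
      (B := B + |M + ε| * (t - a)) hε
      (v := fun x r => w x r - (M + ε) * (r - a)) ?_ ?_ ?_ ?_ ?_ x t ⟨ht.1, le_rfl⟩
    · linarith
    · exact (hc.mono (prod_mono_right hsub)).sub (by fun_prop)
    · intro x r hr
      have h1 := (le_abs_self _).trans (hB x r (hsub hr))
      have h2 : -((M + ε) * (r - a)) ≤ |M + ε| * (t - a) := by
        calc _ ≤ |(M + ε) * (r - a)| := neg_le_abs _
          _ = |M + ε| * (r - a) := by rw [abs_mul, abs_of_nonneg (sub_nonneg.2 hr.1)]
          _ ≤ _ := by gcongr; exact hr.2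
      linarith
    · exact fun x r hr => (hd x r (hsub' hr)).sub (by fun_prop)
    · intro x r hr
      obtain ⟨ℓ, hℓ, hle⟩ := heq x r (hsub' hr)
      refine ⟨ℓ, ?_, ?_⟩
      · unfold HasFracLaplacianAt at hℓ ⊢
        simpa only [sub_sub_sub_cancel_right] using hℓ
      · have h1 : HasDerivAt (fun r => w x r - (M + ε) * (r - a)) (deriv (w x) r - (M + ε) * 1) r :=
          (hd x r (hsub' hr)).hasDerivAt.sub (((hasDerivAt_id r).sub_const a).const_mul _)
        rw [h1.deriv]
        linarith
    · intro x; simpa using h0 x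
  intro x t ht
  rcases ht.2.lt_or_eq with h | rfl
  · exact key x t ⟨ht.1, h⟩
  rcases ht.1.eq_or_lt with rfl | hlt
  · simpa using h0 x
  have hcx : ContinuousOn (fun r => w x r) (Icc a t) :=
    hc.comp (by fun_prop : Continuous fun r : ℝ => (x, r)).continuousOn fun r hr => ⟨mem_univ _, hr⟩
  have h1 : Tendsto (fun r => w x r) (𝓝[Ico a t] t) (𝓝 (w x t)) :=
    (hcx t ht).mono_left (nhdsWithin_mono _ Ico_subset_Icc_self)
  have h2 : Tendsto (fun r => M * (r - a)) (𝓝[Ico a t] t) (𝓝 (M * (t - a))) :=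
    ((by fun_prop : Continuous fun r => M * (r - a)).tendsto t).mono_left nhdsWithin_le_nhds
  have : (𝓝[Ico a t] t).NeBot := by
    rw [← mem_closure_iff_nhdsWithin_neBot, closure_Ico hlt.ne]; exact ht
  refine le_of_tendsto_of_tendsto h1 h2 ?_
  filter_upwards [self_mem_nhdsWithin] with r hr using key x r hr

section

variable {s T : ℝ} {p : ℝ → ℝ} {F : E n → ℝ → ℝ} {u₀ : E n → ℝ} {u : E n → ℝ → ℝ}

/-- A function of time alone commutes with (-Δ)^s, so multiplication by e only shifts the
coefficient by its logarithmic derivative r. -/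
lemma IsStrongSolution.mul_time (h : IsStrongSolution s T p F u₀ u) {e r : ℝ → ℝ}
    (he : ∀ t, HasDerivAt e (r t * e t) t) (hr : Continuous r) (he0 : e 0 = 1) :
    IsStrongSolution s T (fun t => p t + r t) (fun x t => e t * F x t) u₀ (fun x t => e t * u x t) := by
  have hec : Continuous e := continuous_iff_continuousAt.2 fun t => (he t).continuousAt
  have hder : ∀ x, ∀ t ∈ Ioo 0 T, HasDerivAt (fun t => e t * u x t)
      (r t * e t * u x t + e t * deriv (u x) t) t := fun x t ht =>
    (he t).mul (h.differentiableAt x t ht).hasDerivAt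
  refine ⟨(hec.comp continuous_snd).continuousOn.mul h.continuousOn, ?_,
    fun x t ht => (hder x t ht).differentiableAt, ?_, ?_, fun x => ?_⟩
  · obtain ⟨C, hC⟩ := h.bounded
    obtain ⟨D, hD⟩ := isCompact_Icc.exists_bound_of_continuousOn (hec.continuousOn (s := Icc 0 T))
    refine ⟨D * C, fun x t ht => ?_⟩
    rw [abs_mul]
    exact mul_le_mul (hD t ht) (hC x t ht) (abs_nonneg _) ((norm_nonneg _).trans (hD t ht))
  · have : ContinuousOn (fun z : E n × ℝ => r z.2 * e z.2 * u z.1 z.2 + e z.2 * deriv (u z.1) z.2)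
        (slab n T) := by
      refine ContinuousOn.add (ContinuousOn.mul (by fun_prop) (h.continuousOn.mono ?_))
        (ContinuousOn.mul (by fun_prop) h.continuousOn_deriv)
      exact prod_mono_right Ioo_subset_Icc_self
    exact this.congr fun z hz => (hder z.1 z.2 hz.2).deriv
  · intro x t ht
    obtain ⟨ℓ, hℓ, heq⟩ := h.equation x t ht
    refine ⟨e t * ℓ, hℓ.const_mul (e t), ?_⟩
    rw [(hder x t ht).deriv]
    linear_combination e t * heq
  · rw [he0, one_mul, h.initial]

lemma IsStrongSolution.congr (h : IsStrongSolution s T p F u₀ u) {p' : ℝ → ℝ} {F' : E n → ℝ → ℝ}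
    (hp : ∀ t ∈ Ioo 0 T, p t = p' t) (hF : ∀ x, ∀ t ∈ Ioo 0 T, F x t = F' x t) :
    IsStrongSolution s T p' F' u₀ u where
  continuousOn := h.continuousOn
  bounded := h.bounded
  differentiableAt := h.differentiableAt
  continuousOn_deriv := h.continuousOn_deriv
  equation x t ht := by rw [← hp t ht, ← hF x t ht]; exact h.equation x t ht
  initial := h.initial

lemma IsStrongSolution.sub {F' : E n → ℝ → ℝ} {u₀' : E n → ℝ} {u' : E n → ℝ → ℝ}
    (h : IsStrongSolution s T p F u₀ u) (h' : IsStrongSolution s T p F' u₀' u') :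
    IsStrongSolution s T p (fun x t => F x t - F' x t) (fun x => u₀ x - u₀' x)
      (fun x t => u x t - u' x t) := by
  have hder : ∀ x, ∀ t ∈ Ioo 0 T, HasDerivAt (fun t => u x t - u' x t)
      (deriv (u x) t - deriv (u' x) t) t := fun x t ht =>
    (h.differentiableAt x t ht).hasDerivAt.sub (h'.differentiableAt x t ht).hasDerivAt
  refine ⟨h.continuousOn.sub h'.continuousOn, ?_, fun x t ht => (hder x t ht).differentiableAt,
    (h.continuousOn_deriv.sub h'.continuousOn_deriv).congr fun z hz => (hder z.1 z.2 hz.2).deriv,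
    fun x t ht => ?_, fun x => by rw [h.initial, h'.initial]⟩
  · obtain ⟨C, hC⟩ := h.bounded
    obtain ⟨C', hC'⟩ := h'.bounded
    exact ⟨C + C', fun x t ht => (abs_sub _ _).trans (add_le_add (hC x t ht) (hC' x t ht))⟩
  · obtain ⟨ℓ, hℓ, heq⟩ := h.equation x t ht
    obtain ⟨m, hm, heq'⟩ := h'.equation x t ht
    refine ⟨ℓ + -1 * m, ?_, ?_⟩
    · have := hℓ.add (hm.const_mul (-1))
      simpa only [neg_one_mul, ← sub_eq_add_neg] using this
    · rw [(hder x t ht).deriv]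
      linear_combination heq - heq'

/-- The maximum principle for solutions without zeroth order term, on a time interval. -/
lemma IsStrongSolution.abs_le_mul (hn : 0 < n) (hs₀ : 0 < s) (hs₁ : s < 1)
    (h : IsStrongSolution s T (fun _ => 0) F u₀ u) {a b M : ℝ} (ha : 0 ≤ a) (hb : b ≤ T)
    (hF : ∀ x, ∀ t ∈ Ioo a b, |F x t| ≤ M) (h0 : ∀ x, u x a = 0) :
    ∀ x, ∀ t ∈ Icc a b, |u x t| ≤ M * (t - a) := by
  have hsub : Icc a b ⊆ Icc 0 T := Icc_subset_Icc ha hb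
  have hsub' : Ioo a b ⊆ Ioo 0 T := Ioo_subset_Ioo ha hb
  obtain ⟨B, hB⟩ := h.bounded
  intro x t ht
  have hcon := h.continuousOn.mono (prod_mono_right hsub)
  refine abs_le'.2 ⟨?_, ?_⟩
  · refine le_mul_of_subsolution hn hs₀ hs₁ hcon (fun x t ht => hB x t (hsub ht))
      (fun x t ht => h.differentiableAt x t (hsub' ht)) (fun x t ht => ?_) (fun x => (h0 x).le) x t ht
    obtain ⟨ℓ, hℓ, heq⟩ := h.equation x t (hsub' ht)
    refine ⟨ℓ, hℓ, ?_⟩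
    rw [heq, zero_mul, zero_add]
    exact (abs_le.1 (hF x t ht)).2
  · refine le_mul_of_subsolution hn hs₀ hs₁ (w := fun x t => -u x t) hcon.neg
      (fun x t ht => by rw [abs_neg]; exact hB x t (hsub ht))
      (fun x t ht => (h.differentiableAt x t (hsub' ht)).neg) (fun x t ht => ?_)
      (fun x => by simp [h0 x]) x t ht
    obtain ⟨ℓ, hℓ, heq⟩ := h.equation x t (hsub' ht)
    refine ⟨-1 * ℓ, by simpa only [neg_one_mul] using hℓ.const_mul (-1), ?_⟩
    rw [deriv.fun_neg]
    linarith [(abs_le.1 (hF x t ht)).1]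

end

/-- The integrating factor `exp(∫₀ᵗ p)`. -/
def expInt (p : ℝ → ℝ) (t : ℝ) : ℝ := Real.exp (∫ r in 0..t, p r)

lemma expInt_zero (p : ℝ → ℝ) : expInt p 0 = 1 := by simp [expInt]

lemma expInt_pos (p : ℝ → ℝ) (t : ℝ) : 0 < expInt p t := Real.exp_pos _

lemma hasDerivAt_expInt {p : ℝ → ℝ} (hp : Continuous p) (t : ℝ) :
    HasDerivAt (expInt p) (p t * expInt p t) t := by
  have := (intervalIntegral.integral_hasDerivAt_right (hp.intervalIntegrable 0 t)
    hp.stronglyMeasurable.stronglyMeasurableAtFilter hp.continuousAt).exp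
  rwa [mul_comm] at this

lemma expInt_neg (p : ℝ → ℝ) (t : ℝ) : expInt (fun t => -p t) t = (expInt p t)⁻¹ := by
  simp [expInt, Real.exp_neg]

section

variable {s T : ℝ} {p : ℝ → ℝ} {F : E n → ℝ → ℝ} {u₀ : E n → ℝ} {u : E n → ℝ → ℝ}

lemma IsStrongSolution.div_expInt (hp : Continuous p) (h : IsStrongSolution s T p F u₀ u) :
    IsStrongSolution s T (fun _ => 0) (fun x t => (expInt p t)⁻¹ * F x t) u₀
      (fun x t => (expInt p t)⁻¹ * u x t) := by
  have := h.mul_time (e := fun t => (expInt p t)⁻¹) (r := fun t => -p t)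
    (fun t => ?_) hp.neg (by simp [expInt_zero])
  · exact this.congr (fun t _ => add_neg_cancel _) fun x t _ => rfl
  · have h1 := hasDerivAt_expInt (p := fun t => -p t) hp.neg t
    rwa [show expInt (fun t => -p t) = fun t => (expInt p t)⁻¹ from funext (expInt_neg p)] at h1

lemma IsStrongSolution.mul_expInt (hp : Continuous p) (h : IsStrongSolution s T (fun _ => 0)
    (fun x t => (expInt p t)⁻¹ * F x t) u₀ u) :
    IsStrongSolution s T p F u₀ (fun x t => expInt p t * u x t) := by
  have := h.mul_time (hasDerivAt_expInt hp) hp (expInt_zero _)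
  refine this.congr (fun t _ => zero_add _) fun x t _ => ?_
  rw [← mul_assoc, mul_inv_cancel₀ (expInt_pos p t).ne', one_mul]

theorem IsStrongSolution.unique (hn : 0 < n) (hs₀ : 0 < s) (hs₁ : s < 1) (hp : Continuous p)
    {u' : E n → ℝ → ℝ} (h : IsStrongSolution s T p F u₀ u) (h' : IsStrongSolution s T p F u₀ u') :
    ∀ x, ∀ t ∈ Icc 0 T, u' x t = u x t := by
  intro x t ht
  have hd := (h'.sub h).div_expInt hp
  have := hd.abs_le_mul hn hs₀ hs₁ le_rfl le_rfl (M := 0) (fun x t _ => by simp)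
    (fun x => by simp [h.initial, h'.initial]) x t ht
  rw [zero_mul] at this
  have h0 := abs_eq_zero.1 (le_antisymm this (abs_nonneg _))
  rcases mul_eq_zero.1 h0 with h1 | h1
  · exact absurd h1 (inv_ne_zero (expInt_pos p t).ne')
  · exact sub_eq_zero.1 h1

end

end

/-! ### Existence of strong solutions -/

section

variable {n : ℕ}

/-- The projection of the line onto `[0,T]`. -/
def clamp (T t : ℝ) : ℝ := max 0 (min T t)

lemma continuous_clamp (T : ℝ) : Continuous (clamp T) := by unfold clamp; fun_prop

lemma clamp_mem {T : ℝ} (hT : 0 < T) (t : ℝ) : clamp T t ∈ Icc 0 T :=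
  ⟨le_max_left _ _, max_le hT.le (min_le_left _ _)⟩

lemma clamp_of_mem {T t : ℝ} (ht : t ∈ Icc 0 T) : clamp T t = t := by
  rw [clamp, min_eq_right ht.2, max_eq_right ht.1]

lemma continuous_comp_clamp {T : ℝ} (hT : 0 < T) {p : ℝ → ℝ} (hp : ContinuousOn p (Icc 0 T)) :
    Continuous fun t => p (clamp T t) :=
  hp.comp_continuous (continuous_clamp T) (clamp_mem hT)

lemma continuous_uncurry_clamp {T : ℝ} (hT : 0 < T) {F : E n → ℝ → ℝ}
    (hF : ContinuousOn (fun z : E n × ℝ => F z.1 z.2) (univ ×ˢ Icc 0 T)) :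
    Continuous fun z : E n × ℝ => F z.1 (clamp T z.2) :=
  hF.comp_continuous (f := fun z : E n × ℝ => (z.1, clamp T z.2))
    (continuous_fst.prodMk ((continuous_clamp T).comp continuous_snd))
    fun z => ⟨mem_univ _, clamp_mem hT z.2⟩

/-- A strict violation at a point of S persists on a relative neighbourhood. Since S lies in the
closure of O, this neighbourhood meets O in a nonempty open set, which has positive measure. -/
lemma abs_le_of_ae_of_continuousOn {X : Type*} [TopologicalSpace X] [MeasurableSpace X]
    [OpensMeasurableSpace X] {μ : Measure X} [μ.IsOpenPosMeasure] {O S : Set X} (hO : IsOpen O)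
    (hOS : O ⊆ S) (hSO : S ⊆ closure O) {g : X → ℝ} (hg : ContinuousOn g S) {C : ℝ}
    (hae : ∀ᵐ z ∂μ.restrict O, |g z| ≤ C) : ∀ z ∈ S, |g z| ≤ C := by
  intro z hz
  by_contra! hlt
  have h1 : ∀ᶠ y in 𝓝[S] z, C < |g y| := (hg z hz).abs.eventually_const_lt hlt
  obtain ⟨U, hU, hzU, hUS⟩ := mem_nhdsWithin.1 h1
  have hne : (U ∩ O).Nonempty := mem_closure_iff.1 (hSO hz) U hU hzU
  have hpos : 0 < μ (U ∩ O) := (hU.inter hO).measure_pos μ hne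
  rw [ae_restrict_iff' hO.measurableSet] at hae
  refine hpos.ne' (measure_mono_null (fun y hy => ?_) (ae_iff.1 hae))
  simp only [mem_ofPred_eq, Classical.not_imp, not_le]
  exact ⟨hy.2, hUS ⟨hy.1, hOS hy.2⟩⟩

lemma MemLInfty.ae_le {T : ℝ} {F : E n → ℝ → ℝ} (h : MemLInfty T F) :
    ∃ C, ∀ᵐ z ∂(volume.restrict (slab n T)), |F z.1 z.2| ≤ C := by
  have hlt := h.eLpNorm_lt_top
  rw [eLpNorm_exponent_top] at hlt
  refine ⟨(eLpNormEssSup (fun z : E n × ℝ => F z.1 z.2) (volume.restrict (slab n T))).toReal, ?_⟩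
  filter_upwards [ae_le_eLpNormEssSup (f := fun z : E n × ℝ => F z.1 z.2)
    (μ := volume.restrict (slab n T))] with z hz
  rw [← Real.norm_eq_abs, ← toReal_enorm]
  exact ENNReal.toReal_mono hlt.ne hz

lemma ae_slice_of_ae_slab {T : ℝ} {P : E n × ℝ → Prop}
    (h : ∀ᵐ z ∂(volume.restrict (slab n T)), P z) :
    ∀ᵐ t ∂(volume.restrict (Ioo 0 T)), ∀ᵐ x : E n, P (x, t) := by
  have e : (volume : Measure (E n × ℝ)).restrict (slab n T) =
      (volume : Measure (E n)).prod (volume.restrict (Ioo 0 T)) := by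
    rw [slab, Measure.volume_eq_prod, ← Measure.prod_restrict, Measure.restrict_univ]
  rw [e] at h
  have h2 : ∀ᵐ z ∂((volume.restrict (Ioo 0 T)).prod (volume : Measure (E n))), P z.swap :=
    (Measure.measurePreserving_swap).quasiMeasurePreserving.ae h
  exact Measure.ae_ae_of_ae_prod h2

section

variable {s T : ℝ} {M K : ℝ} {F : E n → ℝ → ℝ}

lemma GoodSource.mono {M' : ℝ} (hF : GoodSource s M K F) (h : M ≤ M') : GoodSource s M' K F :=
  ⟨hF.cont, fun x t => (hF.bdd x t).trans h, hF.holder⟩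

lemma GoodSource.mul_time (hF : GoodSource s M K F) {a : ℝ → ℝ} (ha : Continuous a) {D : ℝ}
    (hD : ∀ t, |a t| ≤ D) : GoodSource s (D * M) (D * K) (fun x t => a t * F x t) := by
  have hD0 : 0 ≤ D := (abs_nonneg _).trans (hD 0)
  refine ⟨(ha.comp continuous_snd).mul hF.cont, fun x t => ?_, fun t x h => ?_⟩
  · rw [abs_mul]
    exact mul_le_mul (hD t) (hF.bdd x t) (abs_nonneg _) hD0
  · have e : secondDiff (fun y => a t * F y t) x h = a t * secondDiff (fun y => F y t) x h := by
      simp only [secondDiff, smul_eq_mul]; ring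
    rw [e, norm_mul, mul_assoc]
    exact mul_le_mul (hD t) (hF.holder t x h) (norm_nonneg _) hD0

lemma isStrongSolution_mild (hn : 0 < n) (hs₀ : 0 < s) (hs₁ : s < 1) {φ : E n → ℝ} (hφ : Continuous φ)
    (hφM : ∀ x, |φ x| ≤ M) (hF : GoodSource s M K F) :
    IsStrongSolution s T (fun _ => 0) F φ (mild s φ F) := by
  have hder : ∀ x, ∀ t ∈ Ioo 0 T, HasDerivAt (mild s φ F x) (F x t - mildA s φ F x t) t :=
    fun x t ht => hasDerivAt_mild hn hs₀ hs₁ hφ hφM hF ht.1 x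
  refine ⟨(continuous_mild hs₀ hs₁ hφ hφM hF).continuousOn, ?_,
    fun x t ht => (hder x t ht).differentiableAt, ?_, fun x t ht => ?_, mild_zero hs₀ hs₁⟩
  · refine ⟨(∫ y : E n, |hk s 1 y|) * M * (1 + T), fun x t ht =>
      (abs_mild_le hs₀ hs₁ hφM hF ht.1 x).trans ?_⟩
    have hM0 : 0 ≤ M := (abs_nonneg _).trans (hφM 0)
    have : 0 ≤ ∫ y : E n, |hk s 1 y| := integral_nonneg fun _ => abs_nonneg _
    gcongr
    exact ht.2
  · have : ContinuousOn (fun z : E n × ℝ => F z.1 z.2 - mildA s φ F z.1 z.2) (slab n T) :=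
      hF.cont.continuousOn.sub ((continuousOn_mildA hn hs₀ hs₁ hφ hφM hF).mono fun z hz => hz.2.1)
    exact this.congr fun z hz => (hder z.1 z.2 hz.2).deriv
  · refine ⟨_, hasFracLaplacianAt_mild hn hs₀ hs₁ hφ hφM hF ht.1 x, ?_⟩
    rw [(hder x t ht).deriv]; ring

lemma heat_const_mul (s t c : ℝ) (u : E n → ℝ) (x : E n) :
    heat s t (fun y => c * u y) x = c * heat s t u x := by
  unfold heat
  rw [← integral_const_mul]
  simp_rw [mul_left_comm]

lemma heatA_const_mul (s t c : ℝ) (u : E n → ℝ) (x : E n) :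
    heatA s t (fun y => c * u y) x = c * heatA s t u x := by
  unfold heatA
  simp_rw [mul_left_comm _ c, integral_const_mul]
  ring

/-- The operator commutes with the semigroup and with the time factor a, so applying it to the mild
solution amounts to applying it to the data. This is the identity v₂ = (-Δ)^s v₁ after division by
the integrating factor. -/
lemma mildA_eq_mild (hn : 0 < n) (hs₀ : 0 < s) (hs₁ : s < 1) {φ φs : E n → ℝ} {f fs : E n → ℝ → ℝ}
    {a : ℝ → ℝ} {M K M' K' : ℝ} (hφ : Continuous φ) (hφM : ∀ x, |φ x| ≤ M) (hφs : Continuous φs)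
    (hφsM : ∀ x, |φs x| ≤ M') (hφφs : IsFracLaplacian s φ φs)
    (hf : GoodSource s M K f) (hfs : GoodSource s M' K' fs)
    (hffs : ∀ t, IsFracLaplacian s (fun x => f x t) (fun x => fs x t)) {t : ℝ} (ht : 0 < t) (x : E n) :
    mildA s φ (fun x t => a t * f x t) x t = mild s φs (fun x t => a t * fs x t) x t := by
  rw [mildA, mild, heatA_eq_heat_of_isFracLaplacian hn hs₀ hs₁ hφ hφM hφs hφsM hφφs ht]
  congr 1
  rw [intervalIntegral.integral_of_le ht.le, intervalIntegral.integral_of_le ht.le,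
    integral_Ioc_eq_integral_Ioo, integral_Ioc_eq_integral_Ioo]
  refine setIntegral_congr_fun measurableSet_Ioo fun r hr => ?_
  rw [heatA_const_mul, heat_const_mul, heatA_eq_heat_of_isFracLaplacian hn hs₀ hs₁ (hf.slice r)
    (fun y => hf.bdd y r) (hfs.slice r) (fun y => hfs.bdd y r) (hffs r) (sub_pos.2 hr.2)]

/-- The reciprocal of the integrating factor, frozen outside `[0,T]`. -/
lemma exists_abs_inv_expInt_clamp_le (hT : 0 < T) {p : ℝ → ℝ} (hp : Continuous p) :
    (Continuous fun t => (expInt p (clamp T t))⁻¹) ∧ ∃ D, ∀ t, |(expInt p (clamp T t))⁻¹| ≤ D := by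
  have hc : Continuous fun t => (expInt p t)⁻¹ :=
    (continuous_iff_continuousAt.2 fun t => (hasDerivAt_expInt hp t).continuousAt).inv₀
      fun t => (expInt_pos p t).ne'
  obtain ⟨D, hD⟩ := isCompact_Icc.exists_bound_of_continuousOn (hc.continuousOn (s := Icc 0 T))
  exact ⟨hc.comp (continuous_clamp T), D, fun t => hD _ (clamp_mem hT t)⟩

/-- The solution of the Cauchy problem with coefficient `p`. -/
def sol (s T : ℝ) (p : ℝ → ℝ) (φ : E n → ℝ) (F : E n → ℝ → ℝ) (x : E n) (t : ℝ) : ℝ :=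
  expInt p t * mild s φ (fun x t => (expInt p (clamp T t))⁻¹ * F x t) x t

lemma GoodSource.exists_div_expInt (hT : 0 < T) {p : ℝ → ℝ} (hp : Continuous p)
    (hF : GoodSource s M K F) {φ : E n → ℝ} {C : ℝ} (hφ : ∀ x, |φ x| ≤ C) :
    ∃ M' K', (∀ x, |φ x| ≤ M') ∧
      GoodSource s M' K' (fun x t => (expInt p (clamp T t))⁻¹ * F x t) := by
  obtain ⟨hc, D, hD⟩ := exists_abs_inv_expInt_clamp_le hT hp
  exact ⟨max (D * M) C, D * K, fun x => (hφ x).trans (le_max_right _ _),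
    (hF.mul_time hc hD).mono (le_max_left _ _)⟩

lemma isStrongSolution_sol (hn : 0 < n) (hs₀ : 0 < s) (hs₁ : s < 1) (hT : 0 < T) {p : ℝ → ℝ}
    (hp : Continuous p) {φ : E n → ℝ} (hφ : Continuous φ) {C : ℝ} (hφC : ∀ x, |φ x| ≤ C)
    (hF : GoodSource s M K F) : IsStrongSolution s T p F φ (sol s T p φ F) := by
  obtain ⟨M', K', h1, h2⟩ := hF.exists_div_expInt hT hp hφC
  refine IsStrongSolution.mul_expInt hp
    ((isStrongSolution_mild hn hs₀ hs₁ hφ h1 h2).congr (fun _ _ => rfl) fun x t ht => ?_)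
  rw [clamp_of_mem (Ioo_subset_Icc_self ht)]

lemma continuous_sol (hs₀ : 0 < s) (hs₁ : s < 1) (hT : 0 < T) {p : ℝ → ℝ}
    (hp : Continuous p) {φ : E n → ℝ} (hφ : Continuous φ) {C : ℝ} (hφC : ∀ x, |φ x| ≤ C)
    (hF : GoodSource s M K F) (x : E n) : Continuous fun t => sol s T p φ F x t := by
  obtain ⟨M', K', h1, h2⟩ := hF.exists_div_expInt hT hp hφC
  exact (continuous_iff_continuousAt.2 fun t => (hasDerivAt_expInt hp t).continuousAt).mul
    ((continuous_mild hs₀ hs₁ hφ h1 h2).comp (by fun_prop : Continuous fun t : ℝ => (x, t)))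

/-- At interior times this is the equation, with the fractional Laplacian replaced by the solution
for the transformed data. The right-hand side is continuous on the whole line, so the solution is
its primitive on [0,T] and has one-sided derivatives at the end points. -/
lemma hasDerivWithinAt_sol (hn : 0 < n) (hs₀ : 0 < s) (hs₁ : s < 1) (hT : 0 < T)
    {φ φs : E n → ℝ} {f fs : E n → ℝ → ℝ} {p : ℝ → ℝ} (hp : Continuous p)
    {M K M' K' C C' : ℝ} (hφ : Continuous φ) (hφC : ∀ x, |φ x| ≤ C) (hφs : Continuous φs)
    (hφsC : ∀ x, |φs x| ≤ C') (hφφs : IsFracLaplacian s φ φs)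
    (hf : GoodSource s M K f) (hfs : GoodSource s M' K' fs)
    (hffs : ∀ t, IsFracLaplacian s (fun x => f x t) (fun x => fs x t)) (x : E n) {t : ℝ}
    (ht : t ∈ Icc 0 T) :
    HasDerivWithinAt (sol s T p φ f x) (p t * sol s T p φ f x t + f x t - sol s T p φs fs x t)
      (Icc 0 T) t := by
  set R : ℝ → ℝ := fun t => p t * sol s T p φ f x t + f x t - sol s T p φs fs x t with hR
  have hc := continuous_sol hs₀ hs₁ hT hp hφ hφC hf x
  have hRc : Continuous R := ((hp.mul hc).add
    (hf.cont.comp (by fun_prop : Continuous fun t : ℝ => (x, t)))).sub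
    (continuous_sol hs₀ hs₁ hT hp hφs hφsC hfs x)
  have hder : ∀ t ∈ Ioo 0 T, HasDerivAt (sol s T p φ f x) (R t) t := by
    intro t ht
    obtain ⟨M₁, K₁, h1, h2⟩ := hf.exists_div_expInt hT hp hφC
    have h3 := (hasDerivAt_expInt hp t).mul (hasDerivAt_mild hn hs₀ hs₁ hφ h1 h2 ht.1 x)
    have hfm := hf.mono (le_max_left M C)
    have hfsm := hfs.mono (le_max_left M' C')
    rw [mildA_eq_mild hn hs₀ hs₁ hφ (fun x => (hφC x).trans (le_max_right M C)) hφs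
      (fun x => (hφsC x).trans (le_max_right M' C')) hφφs hfm hfsm hffs ht.1,
      clamp_of_mem (Ioo_subset_Icc_self ht)] at h3
    have := (expInt_pos p t).ne'
    refine h3.congr_deriv ?_
    change _ = p t * sol s T p φ f x t + f x t - sol s T p φs fs x t
    unfold sol
    field_simp
    ring
  have hint : ∀ t ∈ Icc 0 T, sol s T p φ f x t = sol s T p φ f x 0 + ∫ r in 0..t, R r := by
    intro t ht
    have := intervalIntegral.integral_eq_sub_of_hasDerivAt_of_le ht.1 hc.continuousOn
      (fun r hr => hder r ⟨hr.1, hr.2.trans_le ht.2⟩) (hRc.intervalIntegrable _ _)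
    linarith
  have h4 : HasDerivAt (fun t => sol s T p φ f x 0 + ∫ r in 0..t, R r) (R t) t :=
    (intervalIntegral.integral_hasDerivAt_right (hRc.intervalIntegrable _ _)
      hRc.stronglyMeasurable.stronglyMeasurableAtFilter hRc.continuousAt).const_add _
  exact h4.hasDerivWithinAt.congr hint (hint t ht)

end

/-- The source and its fractional Laplacian are admissible after extension to all times. -/
lemma exists_goodSource (hn : 0 < n) {s T : ℝ} (hs₀ : 0 < s) (hs₁ : s < 1) (hT : 0 < T)
    {f fs : E n → ℝ → ℝ}
    (hf : ContinuousOn (fun z : E n × ℝ => f z.1 z.2) (univ ×ˢ Icc 0 T))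
    (hfs : ContinuousOn (fun z : E n × ℝ => fs z.1 z.2) (univ ×ˢ Icc 0 T))
    (hffs : ∀ t ∈ Icc 0 T, IsFracLaplacian s (fun x => f x t) (fun x => fs x t))
    (hfsupp : ∃ K : Set (E n), IsCompact K ∧ ∀ t ∈ Icc 0 T, ∀ x ∉ K, f x t = 0)
    (hfsb : MemLInfty T fs)
    (hf2s : ∃ f2s : E n → ℝ → ℝ, MemLInfty T f2s ∧
      ∀ᵐ t ∂(volume.restrict (Ioo 0 T)),
        IsFracLaplacian (2 * s) (fun x => f x t) (fun x => f2s x t)) :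
    ∃ M K M' K', GoodSource s M K (fun x t => f x (clamp T t)) ∧
      GoodSource s M' K' (fun x t => fs x (clamp T t)) := by
  obtain ⟨S, hSc, hS⟩ := hfsupp
  obtain ⟨f2s, hf2b, hf2⟩ := hf2s
  have hL0 : 0 ≤ ∫ y : E n, |hk s 1 y| := integral_nonneg fun _ => abs_nonneg _
  have hslice : ∀ {F : E n → ℝ → ℝ},
      ContinuousOn (fun z : E n × ℝ => F z.1 z.2) (univ ×ˢ Icc 0 T) → ∀ t ∈ Icc 0 T,
      Continuous fun x => F x t := fun hF t ht =>
    hF.comp_continuous (f := fun x => (x, t)) (by fun_prop) fun x => ⟨mem_univ _, ht⟩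
  obtain ⟨M₀, hM₀⟩ := (hSc.prod isCompact_Icc).exists_bound_of_continuousOn
    (hf.mono (prod_mono_left (subset_univ S)))
  have hM : ∀ x, ∀ t ∈ Icc 0 T, |f x t| ≤ max M₀ 0 := by
    intro x t ht
    by_cases hx : x ∈ S
    · exact (hM₀ (x, t) ⟨hx, ht⟩).trans (le_max_left _ _)
    · rw [hS t ht x hx, abs_zero]; exact le_max_right _ _
  have hcl : closure (Ioo 0 T) = Icc 0 T := closure_Ioo hT.ne
  obtain ⟨M', hM'⟩ := hfsb.ae_le
  have hMs : ∀ x, ∀ t ∈ Icc 0 T, |fs x t| ≤ M' := by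
    -- Continuity turns the essential bound on the open slab into a bound everywhere on the closed
    -- one.
    have := abs_le_of_ae_of_continuousOn (O := slab n T) (S := univ ×ˢ Icc 0 T)
      (isOpen_univ.prod isOpen_Ioo) (prod_mono_right Ioo_subset_Icc_self)
      (by rw [slab, closure_prod_eq, closure_univ, hcl]) hfs hM'
    exact fun x t ht => this (x, t) ⟨mem_univ _, ht⟩
  obtain ⟨K, hK⟩ := exists_secondDiff_le_of_heatA hn hs₀ hs₁ (max M₀ 0) ((∫ y : E n, |hk s 1 y|) * M')
  obtain ⟨G, hG⟩ := hf2b.ae_le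
  obtain ⟨K', hK'⟩ := exists_secondDiff_le_of_heatA hn hs₀ hs₁ M' ((∫ y : E n, |hk s 1 y|) * G)
  refine ⟨max M₀ 0, K, M', K', ⟨continuous_uncurry_clamp hT hf, fun x t => hM _ _ (clamp_mem hT t),
    fun t => ?_⟩, ⟨continuous_uncurry_clamp hT hfs, fun x t => hMs _ _ (clamp_mem hT t), fun t => ?_⟩⟩
  · have ht := clamp_mem hT t
    refine hK _ (hslice hf _ ht) (fun x => hM x _ ht) fun τ hτ x => ?_
    rw [heatA_eq_heat_of_isFracLaplacian hn hs₀ hs₁ (hslice hf _ ht) (fun x => hM x _ ht)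
      (hslice hfs _ ht) (fun x => hMs x _ ht) (hffs _ ht) hτ]
    exact abs_heat_le hs₀ hs₁ (fun x => hMs x _ ht) τ x
  · intro x h
    -- The function (-Δ)^{2s} f is defined and bounded only for almost every time. The resulting
    -- inequality for fixed x and h is a closed condition on a function continuous in t, and
    -- therefore extends to every t.
    have hae : ∀ᵐ t ∂(volume.restrict (Ioo 0 T)),
        |secondDiff (fun y => fs y t) x h| ≤ K' * min 1 (‖h‖ ^ s) := by
      filter_upwards [hf2, ae_slice_of_ae_slab hG, ae_restrict_mem measurableSet_Ioo] with r h1 h2 hr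
      have hr' := Ioo_subset_Icc_self hr
      refine hK' _ (hslice hfs r hr') (fun x => hMs x r hr') (fun τ hτ x => ?_) x h
      refine abs_heatA_le_of_fracOp_mollify hn hs₀ hs₁ (hslice hfs r hr') (fun x => hMs x r hr')
        (fun k z => ?_) hτ x
      have hfi : Integrable fun x => f x r := (hslice hf r hr').integrable_of_hasCompactSupport
        (HasCompactSupport.intro hSc fun x hx => hS r hr' x hx)
      rw [fracOp_mollify_of_two_mul hn hs₀ hs₁ (hslice hf r hr') hfi (hffs r hr') h1]
      exact abs_mollify_le (moll_nonneg k) (integral_moll k) h2 z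
    have hcx : ∀ z, ContinuousOn (fun t => fs z t) (Icc 0 T) := fun z =>
      hfs.comp (by fun_prop : Continuous fun r : ℝ => (z, r)).continuousOn fun r hr => ⟨mem_univ _, hr⟩
    exact abs_le_of_ae_of_continuousOn (O := Ioo 0 T) (S := Icc 0 T) (μ := volume) isOpen_Ioo
      Ioo_subset_Icc_self hcl.ge (g := fun t => secondDiff (fun y => fs y t) x h)
      (((hcx _).add (hcx _)).sub ((hcx _).const_smul (2 : ℝ))) hae _ (clamp_mem hT t)

end

/-! ### Uniqueness of the coefficient -/

section

variable {n : ℕ}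

lemma expInt_eq_mul {p : ℝ → ℝ} (hp : Continuous p) (a t : ℝ) :
    expInt p t = expInt p a * Real.exp (∫ r in a..t, p r) := by
  rw [expInt, expInt, ← Real.exp_add, intervalIntegral.integral_add_adjacent_intervals
    (hp.intervalIntegrable _ _) (hp.intervalIntegrable _ _)]

/-- At a simple zero the difference quotient keeps w away from zero; at a nonzero value continuity
does. -/
lemma eventually_ne_zero_right {w : ℝ → ℝ} {c T t : ℝ} (ht : t ∈ Ico 0 T)
    (hw : HasDerivWithinAt w c (Icc 0 T) t) (h : w t ≠ 0 ∨ c ≠ 0) :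
    ∃ b ∈ Ioc t T, ∀ r ∈ Ioo t b, w r ≠ 0 := by
  have hle : 𝓝[Ioo t T] t ≤ 𝓝[Icc 0 T] t :=
    nhdsWithin_mono _ fun r hr => ⟨ht.1.trans hr.1.le, hr.2.le⟩
  have hev : ∀ᶠ r in 𝓝[Ioo t T] t, w r ≠ 0 := by
    rcases h with h | h
    · exact (hw.continuousWithinAt.mono_left hle).eventually_ne h
    · exact (hw.eventually_ne h).filter_mono
        (nhdsWithin_mono _ (show Ioo t T ⊆ Icc 0 T \ {t} from
          fun r hr => ⟨⟨ht.1.trans hr.1.le, hr.2.le⟩, hr.1.ne'⟩))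
  rw [nhdsWithin_Ioo_eq_nhdsGT ht.2] at hev
  obtain ⟨b, hb, hsub⟩ := (mem_nhdsGT_iff_exists_Ioo_subset' ht.2).1 hev
  refine ⟨min b T, ⟨lt_min hb ht.2, min_le_right _ _⟩, fun r hr => ?_⟩
  exact hsub (show r ∈ Ioo t b from ⟨hr.1, hr.2.trans_le (min_le_left _ _)⟩)

/-- Induction along the real line. The condition defining A concerns r < t only, which makes A
closed; continuity of D supplies the value at t itself, and the hypothesis extends A to the right.
-/
lemma eqOn_zero_of_right_extension {D : ℝ → ℝ} {T : ℝ} (hD : Continuous D) (h0 : D 0 = 0)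
    (hext : ∀ t ∈ Ico 0 T, (∀ r ∈ Icc 0 t, D r = 0) → ∃ b ∈ Ioc t T, ∀ r ∈ Ico t b, D r = 0) :
    ∀ t ∈ Icc 0 T, D t = 0 := by
  set A : Set ℝ := {t | ∀ r, 0 ≤ r → r < t → D r = 0} with hA
  have hAc : IsClosed A := by
    have : A = ⋂ r ∈ {r | 0 ≤ r ∧ D r ≠ 0}, Iic r := by
      ext t
      simp only [hA, mem_ofPred_eq, mem_iInter, mem_Iic]
      constructor
      · intro h r hr
        by_contra! hlt
        exact hr.2 (h r hr.1 hlt)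
      · intro h r h0 hlt
        by_contra hne
        exact absurd (h r ⟨h0, hne⟩) (not_le.2 hlt)
    rw [this]
    exact isClosed_biInter fun r _ => isClosed_Iic
  have hle : ∀ t ∈ A, 0 ≤ t → ∀ r ∈ Icc 0 t, D r = 0 := by
    intro t ht ht0 r hr
    rcases hr.2.lt_or_eq with h | rfl
    · exact ht r hr.1 h
    rcases hr.1.eq_or_lt with rfl | hpos
    · exact h0
    have h1 : Tendsto D (𝓝[<] r) (𝓝 (D r)) := (hD.tendsto r).mono_left nhdsWithin_le_nhds
    refine tendsto_nhds_unique h1 (tendsto_const_nhds.congr' ?_)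
    filter_upwards [Ioo_mem_nhdsLT hpos] with y hy using (ht y hy.1.le hy.2).symm
  have hsub : Icc 0 T ⊆ A := by
    refine IsClosed.Icc_subset_of_forall_exists_gt (hAc.inter isClosed_Icc)
      (fun r h1 h2 => absurd h1 (not_le.2 h2)) fun t ht y hy => ?_
    obtain ⟨b, hb, hbD⟩ := hext t ht.2 (hle t ht.1 ht.2.1)
    refine ⟨min b y, fun r hr0 hr => ?_, lt_min hb.1 hy, min_le_right _ _⟩
    rcases lt_or_ge r t with h | h
    · exact ht.1 r hr0 h
    · exact hbD r ⟨h, hr.trans_le (min_le_left _ _)⟩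
  exact fun t ht => hle t (hsub ht) ht.1 t ⟨ht.1, le_rfl⟩

/-- Two coefficients with the same observations coincide. -/
theorem coefficient_unique (hn : 0 < n) {s T : ℝ} (hs₀ : 0 < s) (hs₁ : s < 1) (hT : 0 < T)
    {fs : E n → ℝ → ℝ} {φs : E n → ℝ} {q : E n} {g w₁ w₂ p p' : ℝ → ℝ} (hp : Continuous p)
    (hp' : Continuous p') {M : ℝ} (hfs : ∀ x, ∀ t ∈ Icc 0 T, |fs x t| ≤ M)
    (hg : ∀ t ∈ Icc 0 T, g t ≠ 0) (hw₂ : ContinuousOn w₂ (Icc 0 T))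
    (hd : ∀ t ∈ Icc 0 T, HasDerivWithinAt w₁ (p t * w₁ t + g t - w₂ t) (Icc 0 T) t)
    (hd' : ∀ t ∈ Icc 0 T, HasDerivWithinAt w₁ (p' t * w₁ t + g t - w₂ t) (Icc 0 T) t)
    {v v' : E n → ℝ → ℝ} (hv : IsStrongSolution s T p fs φs v)
    (hv' : IsStrongSolution s T p' fs φs v') (hvq : ∀ t ∈ Icc 0 T, w₂ t = v q t)
    (hvq' : ∀ t ∈ Icc 0 T, w₂ t = v' q t) : ∀ t ∈ Icc 0 T, p' t = p t := by
  have huniq := uniqueDiffOn_Icc hT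
  have hM0 : 0 ≤ M := (abs_nonneg _).trans (hfs 0 0 ⟨le_rfl, hT.le⟩)
  have hpw : ∀ t ∈ Icc 0 T, w₁ t ≠ 0 → p t = p' t := by
    intro t ht h
    have := (huniq t ht).eq_deriv _ (hd t ht) (hd' t ht)
    exact mul_right_cancel₀ h (by linarith)
  -- The difference of the reciprocal integrating factors replaces p - p': it is the time factor
  -- multiplying fs in the equation for Z, and it vanishes identically only if the coefficients
  -- agree.
  set D : ℝ → ℝ := fun t => (expInt p t)⁻¹ - (expInt p' t)⁻¹ with hD
  have hPc : ∀ {p : ℝ → ℝ}, Continuous p → Continuous fun t => (expInt p t)⁻¹ := fun {p} hp =>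
    (continuous_iff_continuousAt.2 fun t => (hasDerivAt_expInt hp t).continuousAt).inv₀
      fun t => (expInt_pos p t).ne'
  have hDc : Continuous D := (hPc hp).sub (hPc hp')
  have hZ := ((hv.div_expInt hp).sub (hv'.div_expInt hp'))
  set Z : E n → ℝ → ℝ := fun x t => (expInt p t)⁻¹ * v x t - (expInt p' t)⁻¹ * v' x t with hZdef
  have hZs : ∀ x t, (expInt p t)⁻¹ * fs x t - (expInt p' t)⁻¹ * fs x t = fs x t * D t :=
    fun x t => by rw [hD]; ring
  simp only [hZs] at hZ
  have hZq : ∀ t ∈ Icc 0 T, Z q t = w₂ t * D t := fun t ht => by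
    simp only [hZdef, hD]; rw [← hvq t ht, ← hvq' t ht]; ring
  have hZ0 : ∀ x, Z x 0 = 0 := fun x => by
    simp [hZdef, expInt_zero, hv.initial, hv'.initial]
  have hDzero : ∀ t ∈ Icc 0 T, D t = 0 := by
    refine eqOn_zero_of_right_extension hDc (by simp [hD, expInt_zero]) fun t ht hDt => ?_
    have htI := Ico_subset_Icc_self ht
    -- The second alternative is w₁'(t) ≠ 0. In both cases w₁ has no zero just after t, so p = p'
    -- there, and the integrating factors, equal at t, stay equal.
    by_cases hcase : w₁ t ≠ 0 ∨ p t * w₁ t + g t - w₂ t ≠ 0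
    · obtain ⟨b, hb, hne⟩ := eventually_ne_zero_right ht (hd t htI) hcase
      refine ⟨b, hb, fun r hr => ?_⟩
      have hPt : expInt p t = expInt p' t := inv_injective (sub_eq_zero.1 (hDt t ⟨ht.1, le_rfl⟩))
      have hint : ∫ y in t..r, p y = ∫ y in t..r, p' y := by
        rw [intervalIntegral.integral_of_le hr.1, intervalIntegral.integral_of_le hr.1]
        refine setIntegral_congr_fun measurableSet_Ioc fun y hy => ?_
        have hyb := hy.2.trans_lt hr.2
        exact hpw y ⟨ht.1.trans hy.1.le, hyb.le.trans hb.2⟩ (hne y ⟨hy.1, hyb⟩)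
      simp only [hD]
      rw [expInt_eq_mul hp t r, expInt_eq_mul hp' t r, hPt, hint, sub_self]
    · push Not at hcase
      -- At a double zero of w₁ the identity for w₁' reduces to w₂(t) = g(t), which is nonzero.
      have hw2 : w₂ t ≠ 0 := by
        have h2 := hcase.2
        rw [hcase.1, mul_zero, zero_add, sub_eq_zero] at h2
        rw [← h2]; exact hg t htI
      have hm : 0 < |w₂ t| / 2 := by have := abs_pos.2 hw2; positivity
      have hev : ∀ᶠ r in 𝓝[>] t, |w₂ t| / 2 < |w₂ r| := by
        have h1 : Tendsto (fun r => |w₂ r|) (𝓝[Ioo t T] t) (𝓝 |w₂ t|) :=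
          ((hw₂ t htI).mono_left (nhdsWithin_mono _
            fun r hr => ⟨ht.1.trans hr.1.le, hr.2.le⟩)).abs
        rw [nhdsWithin_Ioo_eq_nhdsGT ht.2] at h1
        exact h1.eventually_const_lt (by linarith)
      obtain ⟨b₀, hb₀, hsub⟩ := (mem_nhdsGT_iff_exists_Ioo_subset' ht.2).1 hev
      -- The interval is short enough that the growth M(b-t) of Z, relative to max |D|, stays below
      -- the lower bound |w₂(t)|/2 for |w₂|.
      obtain ⟨b, hb, hbb, hbM⟩ : ∃ b ∈ Ioc t T, b < b₀ ∧ M * (b - t) < |w₂ t| / 2 := by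
        have h1 : Tendsto (fun b => M * (b - t)) (𝓝[>] t) (𝓝 0) := by
          have : Tendsto (fun b => M * (b - t)) (𝓝 t) (𝓝 (M * (t - t))) :=
            (by fun_prop : Continuous fun b => M * (b - t)).tendsto t
          rw [sub_self, mul_zero] at this
          exact this.mono_left nhdsWithin_le_nhds
        obtain ⟨b, h2, h3, h4⟩ := ((h1.eventually_lt_const hm).and
          (inter_mem (Ioo_mem_nhdsGT hb₀) (Ioo_mem_nhdsGT ht.2))).exists
        exact ⟨b, ⟨h4.1, h4.2.le⟩, h3.2, h2⟩
      obtain ⟨r₀, hr₀, hmax⟩ := isCompact_Icc.exists_isMaxOn (nonempty_Icc.2 hb.1.le)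
        (hDc.abs.continuousOn (s := Icc t b))
      have hmax' : ∀ r ∈ Icc t b, |D r| ≤ |D r₀| := fun r hr => hmax hr
      have hZt : ∀ x, Z x t = 0 := by
        intro x
        have := hZ.abs_le_mul hn hs₀ hs₁ le_rfl ht.2.le (M := 0)
          (fun x r hr => by rw [hDt r ⟨hr.1.le, hr.2.le⟩]; simp) hZ0 x t ⟨ht.1, le_rfl⟩
        rw [zero_mul] at this
        exact abs_eq_zero.1 (le_antisymm this (abs_nonneg _))
      have hZb := hZ.abs_le_mul hn hs₀ hs₁ (a := t) (b := b) ht.1 hb.2 (M := M * |D r₀|)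
        (fun x r hr => by
          rw [abs_mul]
          exact mul_le_mul (hfs x r ⟨ht.1.trans hr.1.le, hr.2.le.trans hb.2⟩)
            (hmax' r ⟨hr.1.le, hr.2.le⟩) (abs_nonneg _) hM0) hZt q r₀ hr₀
      change |Z q r₀| ≤ _ at hZb
      rw [hZq r₀ ⟨ht.1.trans hr₀.1, hr₀.2.trans hb.2⟩, abs_mul] at hZb
      -- At the maximum point r₀ of |D| the two descriptions of Z give |w₂(r₀)||D(r₀)| ≤
      -- M|D(r₀)|(r₀-t), where |w₂(r₀)| > |w₂(t)|/2. Division by |D(r₀)| would contradict the choice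
      -- of b.
      have hD0 : |D r₀| = 0 := by
        by_contra hne
        have hpos : 0 < |D r₀| := lt_of_le_of_ne (abs_nonneg _) (Ne.symm hne)
        have hrt : t < r₀ := by
          refine lt_of_le_of_ne hr₀.1 ?_
          rintro rfl
          exact hne (by rw [hDt _ ⟨ht.1, le_rfl⟩, abs_zero])
        have h1 : |w₂ t| / 2 < |w₂ r₀| := hsub ⟨hrt, hr₀.2.trans_lt hbb⟩
        have h2 : M * (r₀ - t) ≤ M * (b - t) := by gcongr; exact hr₀.2
        nlinarith
      exact ⟨b, hb, fun r hr => abs_eq_zero.1 (le_antisymm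
        ((hmax' r (Ico_subset_Icc_self hr)).trans hD0.le) (abs_nonneg _))⟩
  intro t ht
  -- Equal integrating factors have equal derivatives within [0,T], and p is the logarithmic
  -- derivative.
  have hP : ∀ r ∈ Icc 0 T, expInt p r = expInt p' r := fun r hr =>
    inv_injective (sub_eq_zero.1 (hDzero r hr))
  have h1 := (hasDerivAt_expInt hp t).hasDerivWithinAt (s := Icc 0 T)
  have h2 := ((hasDerivAt_expInt hp' t).hasDerivWithinAt (s := Icc 0 T)).congr hP (hP t ht)
  have h3 := (huniq t ht).eq_deriv _ h1 h2
  rw [hP t ht] at h3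
  exact (mul_right_cancel₀ (expInt_pos p' t).ne' h3).symm

end

end FracHeat

end

/-! ### The main theorem -/

open FracHeat in
theorem mainTheorem4 {n : ℕ} (hn : 0 < n) {s T : ℝ} (hs₀ : 0 < s) (hs₁ : s < 1) (hT : 0 < T)
    (φ φs : E n → ℝ) (f fs : E n → ℝ → ℝ) (q : E n)
    -- `φ` and `φs = (-Δ)^s φ` are continuous and bounded
    (hφ : Continuous φ) (hφb : ∃ C : ℝ, ∀ x, |φ x| ≤ C)
    (hφs : Continuous φs) (hφsb : ∃ C : ℝ, ∀ x, |φs x| ≤ C)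
    (hφφs : IsFracLaplacian s φ φs)
    -- `fs = (-Δ)^s f`; both are continuous, and `f` has compact support
    (hf : ContinuousOn (fun z : E n × ℝ => f z.1 z.2) (Set.univ ×ˢ Set.Icc 0 T))
    (hfs : ContinuousOn (fun z : E n × ℝ => fs z.1 z.2) (Set.univ ×ˢ Set.Icc 0 T))
    (hffs : ∀ t ∈ Set.Icc 0 T, IsFracLaplacian s (fun x => f x t) (fun x => fs x t))
    (hfsupp : ∃ K : Set (E n), IsCompact K ∧ ∀ t ∈ Set.Icc 0 T, ∀ x ∉ K, f x t = 0)
    -- `f_t`, `(-Δ)^s f`, `∂_t (-Δ)^s f` and `(-Δ)^{2s} f` belong to `L^∞(ℝⁿ × (0,T))`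
    (hft : ∃ ft : E n → ℝ → ℝ, IsWeakTimeDeriv T f ft ∧ MemLInfty T ft)
    (hfsb : MemLInfty T fs)
    (hfst : ∃ fst : E n → ℝ → ℝ, IsWeakTimeDeriv T fs fst ∧ MemLInfty T fst)
    (hf2s : ∃ f2s : E n → ℝ → ℝ, MemLInfty T f2s ∧
      ∀ᵐ t ∂(MeasureTheory.volume.restrict (Set.Ioo 0 T)),
        IsFracLaplacian (2 * s) (fun x => f x t) (fun x => f2s x t))
    (hfsH : ∀ t ∈ Set.Icc 0 T, MemFracSobolev s (fun x => fs x t))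
    -- the source at the observation point
    (hfq : ContDiffOn ℝ 1 (f q) (Set.Icc 0 T)) (hfq₀ : ∀ t ∈ Set.Icc 0 T, f q t ≠ 0) :
    -- the two direct problems are well posed, so that every `p ∈ C[0,T]` produces observations
    (∀ p : ℝ → ℝ, ContinuousOn p (Set.Icc 0 T) →
      HasUniqueStrongSolution s T p f φ ∧ HasUniqueStrongSolution s T p fs φs) ∧
    -- observations that some `p ∈ C[0,T]` produces determine the pair `(u, p)`
    ∀ w₁ w₂ : ℝ → ℝ,
      (∃ p₀ : ℝ → ℝ, ContinuousOn p₀ (Set.Icc 0 T) ∧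
        IsObservation s T φ φs f fs q p₀ w₁ w₂) →
      ∃ (u : E n → ℝ → ℝ) (p : ℝ → ℝ),
        IsInverseSolution s T φ φs f fs q w₁ w₂ u p ∧
        (∀ (u' : E n → ℝ → ℝ) (p' : ℝ → ℝ), IsInverseSolution s T φ φs f fs q w₁ w₂ u' p' →
          (∀ t ∈ Set.Icc 0 T, p' t = p t) ∧ ∀ x, ∀ t ∈ Set.Icc 0 T, u' x t = u x t) ∧
        ∀ t ∈ Set.Icc 0 T, DifferentiableWithinAt ℝ w₁ (Set.Icc 0 T) t ∧
          p t * w₁ t = derivWithin w₁ (Set.Icc 0 T) t + w₂ t - f q t := by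
  obtain ⟨C, hC⟩ := hφb
  obtain ⟨C', hC'⟩ := hφsb
  obtain ⟨M, K, M', K', hF, hFs⟩ := exists_goodSource hn hs₀ hs₁ hT hf hfs hffs hfsupp hfsb hf2s
  -- Coefficients and sources are frozen outside [0,T] to become continuous for all times. The
  -- notion of solution uses them only on (0,T), where nothing changes.
  have hcl : ∀ {p : ℝ → ℝ}, ∀ t ∈ Ioo 0 T, p t = p (clamp T t) := fun t ht => by
    rw [clamp_of_mem (Ioo_subset_Icc_self ht)]
  have hex : ∀ {p : ℝ → ℝ}, ContinuousOn p (Icc 0 T) → ∀ {ψ : E n → ℝ} {B M K : ℝ} {F : E n → ℝ → ℝ},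
      Continuous ψ → (∀ x, |ψ x| ≤ B) → GoodSource s M K (fun x t => F x (clamp T t)) →
      IsStrongSolution s T p F ψ
        (sol s T (fun t => p (clamp T t)) ψ (fun x t => F x (clamp T t))) := by
    intro p hp ψ B M K F hψ hB hF
    exact (isStrongSolution_sol hn hs₀ hs₁ hT (continuous_comp_clamp hT hp) hψ hB hF).congr
      (fun t ht => (hcl t ht).symm) fun x t ht => (hcl (p := F x) t ht).symm
  have huni : ∀ {p : ℝ → ℝ}, ContinuousOn p (Icc 0 T) → ∀ {ψ : E n → ℝ} {F v v' : E n → ℝ → ℝ},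
      IsStrongSolution s T p F ψ v → IsStrongSolution s T p F ψ v' →
      ∀ x, ∀ t ∈ Icc 0 T, v' x t = v x t := by
    intro p hp ψ F v v' h h'
    exact (h.congr hcl fun _ _ _ => rfl).unique hn hs₀ hs₁ (continuous_comp_clamp hT hp)
      (h'.congr hcl fun _ _ _ => rfl)
  have hobs : ∀ {p w₁ w₂ : ℝ → ℝ}, ContinuousOn p (Icc 0 T) →
      IsObservation s T φ φs f fs q p w₁ w₂ → ∀ t ∈ Icc 0 T,
      HasDerivWithinAt w₁ (p t * w₁ t + f q t - w₂ t) (Icc 0 T) t := by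
    rintro p w₁ w₂ hp ⟨v₁, v₂, hv₁, hv₂, hw⟩ t ht
    -- By uniqueness, any solutions producing the observations agree with the explicit ones, whose
    -- derivative in time is known.
    have e1 : ∀ r ∈ Icc 0 T, w₁ r = _ := fun r hr =>
      (hw r hr).1.trans (huni hp (hex hp hφ hC hF) hv₁ q r hr)
    have e2 := (hw t ht).2.trans (huni hp (hex hp hφs hC' hFs) hv₂ q t ht)
    have h := hasDerivWithinAt_sol hn hs₀ hs₁ hT (continuous_comp_clamp hT hp) hφ hC hφs hC' hφφs
      hF hFs (fun r => hffs _ (clamp_mem hT r)) q ht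
    rw [clamp_of_mem ht] at h
    rw [e2, e1 t ht]
    exact h.congr e1 (e1 t ht)
  refine ⟨fun p hp => ⟨⟨_, hex hp hφ hC hF, fun v' hv' => huni hp (hex hp hφ hC hF) hv'⟩,
    ⟨_, hex hp hφs hC' hFs, fun v' hv' => huni hp (hex hp hφs hC' hFs) hv'⟩⟩, ?_⟩
  rintro w₁ w₂ ⟨p, hp, hO⟩
  obtain ⟨v₁, v₂, hv₁, hv₂, hw⟩ := id hO
  -- Existence needs no construction: the coefficient that produces the observations, with its own
  -- solution, is the pair.
  refine ⟨v₁, p, ⟨hp, hv₁, hO⟩, fun u' p' ⟨hp', hu', hO'⟩ => ?_, fun t ht => ?_⟩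
  · obtain ⟨v₁', v₂', hv₁', hv₂', hw'⟩ := id hO'
    have hpp : ∀ t ∈ Icc 0 T, p' t = p t := by
      have hw₂c : ContinuousOn w₂ (Icc 0 T) :=
        (hv₂.continuousOn.comp (by fun_prop : Continuous fun r : ℝ => (q, r)).continuousOn
          fun r hr => ⟨mem_univ _, hr⟩).congr fun r hr => (hw r hr).2
      have h := coefficient_unique hn hs₀ hs₁ hT (continuous_comp_clamp hT hp)
        (continuous_comp_clamp hT hp') (M := M') (g := f q) (w₁ := w₁) (w₂ := w₂)
        (fun x t ht => by have := hFs.bdd x t; rwa [clamp_of_mem ht] at this) hfq₀ hw₂c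
        (fun t ht => by rw [clamp_of_mem ht]; exact hobs hp hO t ht)
        (fun t ht => by rw [clamp_of_mem ht]; exact hobs hp' hO' t ht)
        (hv₂.congr hcl fun _ _ _ => rfl) (hv₂'.congr hcl fun _ _ _ => rfl)
        (fun t ht => (hw t ht).2) (fun t ht => (hw' t ht).2)
      intro t ht
      have := h t ht
      rwa [clamp_of_mem ht] at this
    exact ⟨hpp, huni hp hv₁ (hu'.congr (fun t ht => hpp t (Ioo_subset_Icc_self ht)) fun _ _ _ => rfl)⟩
  · have h := hobs hp hO t ht
    refine ⟨h.differentiableWithinAt, ?_⟩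
    rw [h.derivWithin (uniqueDiffOn_Icc hT t ht)]
    ring
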